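/- Let $\mathbb F\in\{\mathbb R,\mathbb C\}$ and let $w=(w_n)_{n\ge 1}$ be non-negative reals with $w_1>0$, whose primitive weight $s_n=w_1+\dots+w_n$ is doubling: $\sup_{m\ge1} s_m/s_{\lceil m/2\rceil}<\infty$. For $0<q\le\infty$ let $d_{1,q}(w)$ be the space of all $f\in c_0(\mathbb N,\mathbb F)$ whose non-increasing rearrangement $(a_n)_{n\ge 1}$ satisfies $$\|f\|_{1,q,w}=\Big(\sum_{n=1}^\infty (a_ns_n)^q\,\frac{w_n}{s_n}\Big)^{1/q}<\infty\quad (q<\infty),\qquad \|f\|_{1,\infty,w}=\sup_n a_ns_n<\infty ,$$ and let $d^{0}_{1,\infty}(w)$ be the closed linear span of $c_{00}$ in $d_{1,\infty}(w)$. *Terminology.* A countable family $(x_n)_{n\in\mathcal N}$ in a quasi-Banach space $X$ is an unconditional basic sequence if every $f$ in its closed linear span $[x_n]$ has a unique expansion $f=\sum_n x_n^*(f)\,x_n$ with unconditional convergence, and an unconditional basis of $X$ if moreover $[x_n]=X$. In that case $\operatorname{supp}(f)=\{n: x_n^*(f)\neq0\}$ for $f\in X$ and $\operatorname{supp}(f^*)=\{n: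 f^*(x_n)\ne 0\}$ for $f^*\in X^*$. The basis is *strongly absolute* if for every $R>0$ there is $C>0$ such that, for all $f\in X$, $\sum_n|x_n^*(f)|\,\|x_n\|\le\max\{C\sup_n|x_n^*(f)|\,\|x_n\|,\ \|f\|/R\}$. An unconditional basic sequence $(y_m)_{m\in\mathcal M}$ in $X$ is *well $C$-complemented* if the sets $\operatorname{supp}(y_m)$ are finite and pairwise disjoint and there are $y_m^*\in X^*$ with $\operatorname{supp}(y_m^*)\subseteq\operatorname{supp}(y_m)$, $y_m^*(y_k)=\delta_{m,k}$, such that $P(f)=\sum_m y_m^*(f)\,y_m$ converges unconditionally for all $f\in X$ and defines a bounded operator on $X$, and $\|\sum_{m\in A}y_m^*(f)\,y_m\|\le C$ for all $A\subseteq\mathcal M$ and all $f$ with $\|f\|\le1$. Families $(y_m)$, $(z_m)$ are *$D$-equivalent* if some linear embedding $T$ of $[y_m]$ with $T y_m=z_m$ has $\max\{\|T\|,\|T^{-1}\|\}\le D$. A normalized unconditional basis $(x_n)_{n\in\mathcal N}$ is *uniformly universal for well complemented block basic sequences* if there is $\eta\colon[1,\infty)\to[1,\infty)$ such that for every $C\ge1$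 and every normalized well $C$-complemented $(y_m)_{m\in\mathcal M}$ there is $\pi\colon\mathcal M\to\mathcal N$ with $\pi(m)\in\operatorname{supp}(y_m)$ for all $m$ such that $(y_m)$ is $\eta(C)$-equivalent to $(x_{\pi(m)})$. *Claims.* (a) The following are equivalent: (i) $d_{1,\infty}(w)$ is continuously included in $\ell_1$; (ii) $\sum_{n=1}^\infty 1/s_n<\infty$; (iii) the unit vector system is a strongly absolute unconditional basis of the quasi-Banach space $d^{0}_{1,\infty}(w)$. (b) Let $1<q<\infty$ with conjugate exponent $q'$. If $\sum_{n=1}^\infty w_n^{-q'+1}s_n^{-1}<\infty$ (where the sum is $\infty$ if some $w_n=0$), then the unit vector system is a strongly absolute unconditional basis of the quasi-Banach space $d_{1,q}(w)$. (c) Let $0<q\le1$. (i) $d_{1,q}(w)$ is continuously included in $\ell_1$ if and only if $\inf_n s_n/n>0$. (ii) If $\lim_n s_n/n=\infty$, the unit vector system is a strongly absolute unconditional basis of the quasi-Banach space $d_{1,q}(w)$. (iii) If $\inf_n s_n/n>0$ and $q<1$, the normalized unit vector system $(w_1^{-1}e_n)_{n=1}^\infty$ is a normalized unconditional basis of the quasi-Banach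 space $d_{1,q}(w)$ that is uniformly universal for well complemented block basic sequences. -/

import Mathlib

open Filter Topology
open scoped ENNReal

/-! ### Quasi-Banach spaces, unconditional bases -/

section QuasiBanach

variable {𝕜 : Type*} [RCLike 𝕜] {E F : Type*} [AddCommGroup E] [Module 𝕜 E]
  [AddCommGroup F] [Module 𝕜 F] {ι : Type*}

variable (𝕜) in
/-- `N` is a quasi-norm on the vector space `E`, and `E` is complete for it. -/
structure IsQuasiBanach (N : E → ℝ) : Prop where
  nonneg : ∀ f, 0 ≤ N f
  eq_zero_iff : ∀ f, N f = 0 ↔ f = 0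
  smul : ∀ (a : 𝕜) (f : E), N (a • f) = ‖a‖ * N f
  add_le : ∃ κ : ℝ, 1 ≤ κ ∧ ∀ f g, N (f + g) ≤ κ * (N f + N g)
  complete : ∀ u : ℕ → E,
    (∀ ε > 0, ∃ n₀, ∀ m ≥ n₀, ∀ n ≥ n₀, N (u m - u n) < ε) →
      ∃ f, Tendsto (fun n => N (u n - f)) atTop (𝓝 0)

variable (𝕜) in
/-- The closed linear span `[x]` of a family: the smallest closed subspace that contains it. -/
def closedSpan (N : E → ℝ) (x : ι → E) : Submodule 𝕜 E :=
  sInf {S | Set.range x ⊆ S ∧ ∀ f, (∀ ε > 0, ∃ g ∈ S, N (f - g) < ε) → f ∈ S}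

theorem mem_closedSpan (N : E → ℝ) (x : ι → E) (n : ι) : x n ∈ closedSpan 𝕜 N x :=
  (Submodule.mem_sInf).2 fun _ hS => hS.1 ⟨n, rfl⟩

/-- The series `∑ n, a n • x n` converges unconditionally to `f`. -/
def HasUncondSum (N : E → ℝ) (x : ι → E) (a : ι → 𝕜) (f : E) : Prop :=
  Tendsto (fun s : Finset ι => N (f - ∑ n ∈ s, a n • x n)) atTop (𝓝 0)

variable (𝕜) in
/-- Every `f ∈ [x]` has a unique expansion `∑ n, a n • x n`, with unconditional convergence. -/
def IsUncondBasicSeq (N : E → ℝ) (x : ι → E) : Prop :=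
  ∀ f ∈ closedSpan 𝕜 N x, ∃! a : ι → 𝕜, HasUncondSum N x a f

variable (𝕜) in
/-- `x` is an unconditional basis of the quasi-Banach space `(E, N)`. -/
structure IsUncondBasis (N : E → ℝ) (x : ι → E) : Prop where
  countable : Countable ι
  quasiBanach : IsQuasiBanach 𝕜 N
  basicSeq : IsUncondBasicSeq 𝕜 N x
  span_eq_top : closedSpan 𝕜 N x = ⊤

open Classical in
variable (𝕜) in
/-- The coefficient transform `f ↦ (xₙ*(f))ₙ` of an unconditional basis `x`
(and `0` on vectors that have no expansion; a basis has no such vectors). -/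
noncomputable def coeffTransform (N : E → ℝ) (x : ι → E) (f : E) : ι → 𝕜 :=
  if h : ∃ a : ι → 𝕜, HasUncondSum N x a f then h.choose else 0

variable (𝕜) in
/-- The support of a vector with respect to the basis `x`. -/
def vecSupport (N : E → ℝ) (x : ι → E) (f : E) : Set ι :=
  {n | coeffTransform 𝕜 N x f n ≠ 0}

/-- The support of a functional with respect to the basis `x`. -/
def functionalSupport (x : ι → E) (φ : E →ₗ[𝕜] 𝕜) : Set ι :=
  {n | φ (x n) ≠ 0}

/-- All the vectors of the family have quasi-norm one. -/
def IsNormalized (N : E → ℝ) (x : ι → E) : Prop := ∀ n, N (x n) = 1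

variable (𝕜) in
/-- `x` is a strongly absolute (unconditional) basis of `(E, N)`: for every `R > 0` there is
`C > 0` with `∑ |xₙ*(f)| ‖xₙ‖ ≤ max (C * sup |xₙ*(f)| ‖xₙ‖) (‖f‖ / R)` for all `f`.
The inequality is one in `[0, ∞]`, so that it comprises the convergence of the sum. -/
def IsStronglyAbsoluteBasis (N : E → ℝ) (x : ι → E) : Prop :=
  IsUncondBasis 𝕜 N x ∧
  ∀ R : ℝ, 0 < R → ∃ C : ℝ, 0 < C ∧ ∀ f : E,
    ∑' n, ENNReal.ofReal (‖coeffTransform 𝕜 N x f n‖ * N (x n)) ≤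
      max (ENNReal.ofReal C * ⨆ n, ENNReal.ofReal (‖coeffTransform 𝕜 N x f n‖ * N (x n)))
        (ENNReal.ofReal (N f / R))

variable (𝕜) in
/-- The families `x` in `(E, N)` and `y` in `(F, N')` are `C`-equivalent: there is a linear
embedding `T` of `[x]` into `F` with `T xₙ = yₙ`, `‖T‖ ≤ C` and `‖T⁻¹‖ ≤ C`. -/
def CEquivalent (N : E → ℝ) (N' : F → ℝ) (C : ℝ) (x : ι → E) (y : ι → F) : Prop :=
  ∃ T : closedSpan 𝕜 N x →ₗ[𝕜] F,
    (∀ n, T ⟨x n, mem_closedSpan N x n⟩ = y n) ∧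
    ∀ f : closedSpan 𝕜 N x, N' (T f) ≤ C * N f ∧ N f ≤ C * N' (T f)

/-- `y'` is a sequence of projecting functionals for `y`: the `y' m` are bounded linear
functionals, biorthogonal to `y`, and `f ↦ ∑ m, y' m f • y m` is a bounded linear map on `E`
(which is then a projection onto `[y]`). -/
structure IsProjecting (N : E → ℝ) {M : Type*} (y : M → E) (y' : M → E →ₗ[𝕜] 𝕜) : Prop where
  bounded : ∀ m, ∃ B : ℝ, ∀ f, ‖y' m f‖ ≤ B * N f
  biorthogonal_self : ∀ m, y' m (y m) = 1
  biorthogonal_ne : ∀ m n, m ≠ n → y' m (y n) = 0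
  projection : ∃ P : E →ₗ[𝕜] E, (∃ B : ℝ, ∀ f, N (P f) ≤ B * N f) ∧
    ∀ f, HasUncondSum N y (fun m => y' m f) (P f)

variable (𝕜) in
/-- `y` is well `C`-complemented in the space `(E, N)` with unconditional basis `x`: it is an
unconditional basic sequence, the supports of the `y m` are finite and pairwise disjoint, and
there are projecting functionals `y'` with `supp (y' m) ⊆ supp (y m)` and
`‖∑_{m ∈ A} y' m f • y m‖ ≤ C` for all sets `A` of indices and all `f` in the unit ball. -/
def IsWellComplemented (N : E → ℝ) (x : ι → E) (C : ℝ) {M : Type*} (y : M → E) : Prop :=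
  IsUncondBasicSeq 𝕜 N y ∧
  (∀ m, (vecSupport 𝕜 N x (y m)).Finite) ∧
  (∀ m n, m ≠ n → Disjoint (vecSupport 𝕜 N x (y m)) (vecSupport 𝕜 N x (y n))) ∧
  ∃ y' : M → E →ₗ[𝕜] 𝕜, IsProjecting N y y' ∧
    (∀ m, functionalSupport x (y' m) ⊆ vecSupport 𝕜 N x (y m)) ∧
    ∀ (A : Set M) (f : E), N f ≤ 1 →
      ∃ g, HasUncondSum N y (A.indicator fun m => y' m f) g ∧ N g ≤ C

variable (𝕜) in
/-- The normalized unconditional basis `x` of `(E, N)` is uniformly universal for well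
complemented block basic sequences: with a function `η` on `[1, ∞)`, every normalized well
`C`-complemented basic sequence `y` is `η C`-equivalent to a family `(x (π m))` with
`π m ∈ supp (y m)`. -/
def IsUniformlyUniversal (N : E → ℝ) (x : ι → E) : Prop :=
  IsUncondBasis 𝕜 N x ∧ IsNormalized N x ∧
  ∃ η : ℝ → ℝ, (∀ C, 1 ≤ C → 1 ≤ η C) ∧
    ∀ C, 1 ≤ C → ∀ (M : Type) [Countable M] (y : M → E),
      IsNormalized N y → IsWellComplemented 𝕜 N x C y →
      ∃ π : M → ι, (∀ m, π m ∈ vecSupport 𝕜 N x (y m)) ∧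
        CEquivalent 𝕜 N N (η C) y (fun m => x (π m))

end QuasiBanach

/-! ### Lorentz sequence spaces

Sequences `(bₙ)` with `n = 1, 2, …` are written as functions `b : ℕ → _` with `bₙ = b (n - 1)`,
except for the primitive weight, where `primitiveWeight w n` is `sₙ = w₁ + ⋯ + wₙ` itself. -/

/-- Non-negative weights with positive first term. -/
def IsWeight (w : ℕ → ℝ) : Prop := (∀ n, 0 ≤ w n) ∧ 0 < w 0

/-- The primitive weight `sₙ = w₁ + ⋯ + wₙ`. -/
def primitiveWeight (w : ℕ → ℝ) (n : ℕ) : ℝ := ∑ k ∈ Finset.range n, w k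

/-- The primitive weight is doubling: `sup_{m ≥ 1} s_m / s_{⌈m/2⌉} < ∞`. -/
def IsDoubling (w : ℕ → ℝ) : Prop :=
  ∃ C : ℝ, ∀ m : ℕ, 1 ≤ m → primitiveWeight w m / primitiveWeight w ((m + 1) / 2) ≤ C

section Lorentz

variable {𝕜 : Type*} [RCLike 𝕜]

/-- The non-increasing rearrangement of a bounded sequence; `rearrangement f n` is its
`(n + 1)`-st term. -/
noncomputable def rearrangement (f : ℕ → 𝕜) (n : ℕ) : ℝ :=
  sInf {t : ℝ | 0 ≤ t ∧ {k | t < ‖f k‖}.encard ≤ n}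

/-- `(∑ (aₙ sₙ)^q wₙ / sₙ)^(1/q)` if `q < ∞`, and `sup aₙ sₙ` if `q = ∞`. -/
noncomputable def lorentzENorm (w : ℕ → ℝ) (q : ℝ≥0∞) (f : ℕ → 𝕜) : ℝ≥0∞ :=
  if q = ∞ then ⨆ n, ENNReal.ofReal (rearrangement f n * primitiveWeight w (n + 1))
  else (∑' n, ENNReal.ofReal ((rearrangement f n * primitiveWeight w (n + 1)) ^ q.toReal *
    (w n / primitiveWeight w (n + 1)))) ^ (1 / q.toReal)

theorem primitiveWeight_pos {w : ℕ → ℝ} (hw : IsWeight w) (n : ℕ) :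
    0 < primitiveWeight w (n + 1) := by
  unfold primitiveWeight
  rw [Finset.sum_range_succ']
  have := Finset.sum_nonneg (s := Finset.range n) (f := fun k => w (k + 1)) fun k _ => hw.1 _
  linarith [hw.2]

theorem rearrangement_set_nonempty {f : ℕ → 𝕜} (hf : Tendsto f atTop (𝓝 0)) (n : ℕ) :
    {t : ℝ | 0 ≤ t ∧ {k | t < ‖f k‖}.encard ≤ n}.Nonempty := by
  obtain ⟨B, hB⟩ := hf.norm.bddAbove_range
  have hB' : ∀ k, ‖f k‖ ≤ B := fun k => hB ⟨k, rfl⟩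
  refine ⟨B, (norm_nonneg _).trans (hB' 0), ?_⟩
  have : {k | B < ‖f k‖} = ∅ := by
    ext k; simpa using hB' k
  simp [this]

theorem rearrangement_nonneg (f : ℕ → 𝕜) (n : ℕ) : 0 ≤ rearrangement f n :=
  Real.sInf_nonneg fun _ h => h.1

theorem rearrangement_le {f : ℕ → 𝕜} {n : ℕ} {t : ℝ} (ht : 0 ≤ t)
    (h : {k | t < ‖f k‖}.encard ≤ n) : rearrangement f n ≤ t :=
  csInf_le ⟨0, fun _ h => h.1⟩ ⟨ht, h⟩

theorem rearrangement_antitone {f : ℕ → 𝕜} (hf : Tendsto f atTop (𝓝 0)) :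
    Antitone (rearrangement f) := fun m _ hmn =>
  le_csInf (rearrangement_set_nonempty hf m) fun _ ht =>
    rearrangement_le ht.1 (ht.2.trans (by exact_mod_cast hmn))

theorem rearrangement_add_le {f g : ℕ → 𝕜} (hf : Tendsto f atTop (𝓝 0))
    (hg : Tendsto g atTop (𝓝 0)) (m n : ℕ) :
    rearrangement (f + g) (m + n) ≤ rearrangement f m + rearrangement g n := by
  have key : ∀ t ∈ {t : ℝ | 0 ≤ t ∧ {k | t < ‖f k‖}.encard ≤ m},
      ∀ u ∈ {t : ℝ | 0 ≤ t ∧ {k | t < ‖g k‖}.encard ≤ n},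
      rearrangement (f + g) (m + n) ≤ t + u := by
    intro t ht u hu
    refine rearrangement_le (add_nonneg ht.1 hu.1) ?_
    have hsub : {k | t + u < ‖(f + g) k‖} ⊆ {k | t < ‖f k‖} ∪ {k | u < ‖g k‖} := by
      intro k hk
      by_contra hcon
      simp only [Set.mem_union, Set.mem_ofPred_eq, not_or, not_lt] at hcon hk
      have := norm_add_le (f k) (g k)
      simp only [Pi.add_apply] at hk
      linarith [hcon.1, hcon.2]
    calc _ ≤ _ := Set.encard_le_encard hsub
      _ ≤ _ := Set.encard_union_le _ _
      _ ≤ (m : ℕ∞) + n := add_le_add ht.2 hu.2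
      _ = _ := by push_cast; rfl
  have h1 : ∀ t ∈ {t : ℝ | 0 ≤ t ∧ {k | t < ‖f k‖}.encard ≤ m},
      rearrangement (f + g) (m + n) - t ≤ rearrangement g n := fun t ht =>
    le_csInf (rearrangement_set_nonempty hg n) fun u hu => by linarith [key t ht u hu]
  have h2 : rearrangement (f + g) (m + n) - rearrangement g n ≤ rearrangement f m :=
    le_csInf (rearrangement_set_nonempty hf m) fun t ht => by linarith [h1 t ht]
  linarith

theorem rearrangement_add_le_half {f g : ℕ → 𝕜} (hf : Tendsto f atTop (𝓝 0))
    (hg : Tendsto g atTop (𝓝 0)) (n : ℕ) :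
    rearrangement (f + g) n ≤ rearrangement f (n / 2) + rearrangement g (n / 2) := by
  have hfg : Tendsto (f + g) atTop (𝓝 0) := add_zero (0 : 𝕜) ▸ hf.add hg
  exact (rearrangement_antitone hfg (by omega)).trans (rearrangement_add_le hf hg (n / 2) (n / 2))

theorem rearrangement_smul_le {f : ℕ → 𝕜} (hf : Tendsto f atTop (𝓝 0)) (c : 𝕜) (n : ℕ) :
    rearrangement (c • f) n ≤ ‖c‖ * rearrangement f n := by
  have key : ∀ t ∈ {t : ℝ | 0 ≤ t ∧ {k | t < ‖f k‖}.encard ≤ n},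
      rearrangement (c • f) n ≤ ‖c‖ * t := by
    intro t ht
    refine rearrangement_le (mul_nonneg (norm_nonneg _) ht.1) ((Set.encard_le_encard ?_).trans ht.2)
    intro k hk
    simp only [Set.mem_ofPred_eq, Pi.smul_apply, norm_smul] at hk ⊢
    exact lt_of_mul_lt_mul_left hk (norm_nonneg _)
  rcases eq_or_lt_of_le (norm_nonneg c) with h0 | h0
  · obtain ⟨t, ht⟩ := rearrangement_set_nonempty hf n
    have := key t ht
    rw [← h0] at this ⊢
    simpa using this
  · have : rearrangement (c • f) n / ‖c‖ ≤ rearrangement f n :=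
      le_csInf (rearrangement_set_nonempty hf n) fun t ht => by
        rw [div_le_iff₀ h0, mul_comm]; exact key t ht
    rwa [div_le_iff₀ h0, mul_comm] at this

theorem primitiveWeight_doubling {w : ℕ → ℝ} (hw : IsWeight w) (hd : IsDoubling w) :
    ∃ C : ℝ, 0 ≤ C ∧ ∀ m : ℕ, 1 ≤ m →
      primitiveWeight w m ≤ C * primitiveWeight w ((m + 1) / 2) := by
  obtain ⟨C, hC⟩ := hd
  have h : ∀ m : ℕ, 1 ≤ m → primitiveWeight w m ≤ C * primitiveWeight w ((m + 1) / 2) := by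
    intro m hm
    have hpos : 0 < primitiveWeight w ((m + 1) / 2) := by
      obtain ⟨j, hj⟩ : ∃ j, (m + 1) / 2 = j + 1 := ⟨(m + 1) / 2 - 1, by omega⟩
      rw [hj]; exact primitiveWeight_pos hw j
    exact (div_le_iff₀ hpos).1 (hC m hm)
  refine ⟨C, ?_, h⟩
  have h1 := h 1 le_rfl
  have h2 := primitiveWeight_pos hw 0
  norm_num at h1 h2
  by_contra hcon
  nlinarith

/-- The sums of the weights in the Lorentz quasi-norm are comparable to `sₙ ^ r`. -/
theorem lorentzWeight_comparable {w : ℕ → ℝ} (hw : IsWeight w) {r : ℝ} (hr : 0 < r) (n : ℕ) :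
    min 1 r * ∑ k ∈ Finset.range n,
        primitiveWeight w (k + 1) ^ r * (w k / primitiveWeight w (k + 1)) ≤
      primitiveWeight w n ^ r ∧
    primitiveWeight w n ^ r ≤ max 1 r * ∑ k ∈ Finset.range n,
        primitiveWeight w (k + 1) ^ r * (w k / primitiveWeight w (k + 1)) := by
  induction n with
  | zero => simp [primitiveWeight, Real.zero_rpow hr.ne']
  | succ n ih =>
    have hx := primitiveWeight_pos hw n
    have hy : 0 ≤ primitiveWeight w n := Finset.sum_nonneg fun k _ => hw.1 k
    have hxy : primitiveWeight w (n + 1) = primitiveWeight w n + w n :=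
      Finset.sum_range_succ _ _
    rw [Finset.sum_range_succ]
    set x := primitiveWeight w (n + 1)
    set y := primitiveWeight w n
    have hyx : y ≤ x := by have := hw.1 n; linarith
    have hρ0 : 0 ≤ y / x := by positivity
    have hρ1 : y / x ≤ 1 := (div_le_one hx).2 hyx
    have hyr : y ^ r = x ^ r * (y / x) ^ r := by
      rw [← Real.mul_rpow hx.le hρ0, mul_div_cancel₀ _ hx.ne']
    have hw' : w n / x = 1 - y / x := by
      field_simp; linarith
    have hxr : 0 < x ^ r := Real.rpow_pos_of_pos hx r
    have hlo : min 1 r * (1 - y / x) ≤ 1 - (y / x) ^ r := by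
      rcases le_total 1 r with h | h
      · rw [min_eq_left h]
        have := Real.rpow_le_rpow_of_exponent_ge' hρ0 hρ1 zero_le_one h
        rw [Real.rpow_one] at this; linarith
      · rw [min_eq_right h]
        have := rpow_one_add_le_one_add_mul_self (s := y / x - 1) (by linarith) hr.le h
        rw [add_sub_cancel] at this; linarith
    have hhi : 1 - (y / x) ^ r ≤ max 1 r * (1 - y / x) := by
      rcases le_total 1 r with h | h
      · rw [max_eq_right h]
        have := one_add_mul_self_le_rpow_one_add (s := y / x - 1) (by linarith) h
        rw [add_sub_cancel] at this; linarith
      · rw [max_eq_left h]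
        have := Real.rpow_le_rpow_of_exponent_ge' hρ0 hρ1 hr.le h
        rw [Real.rpow_one] at this; linarith
    rw [hw']
    rw [hyr] at ih
    have h1 := mul_le_mul_of_nonneg_left hlo hxr.le
    have h2 := mul_le_mul_of_nonneg_left hhi hxr.le
    constructor <;> nlinarith [ih.1, ih.2]

/-- Comparison of weighted sums of non-increasing sequences. -/
theorem sum_antitone_mul_le {b u v : ℕ → ℝ} (hb : Antitone b) (hb0 : ∀ n, 0 ≤ b n) {C : ℝ}
    (h : ∀ n, ∑ k ∈ Finset.range n, u k ≤ C * ∑ k ∈ Finset.range n, v k) (n : ℕ) :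
    ∑ k ∈ Finset.range n, b k * u k ≤ C * ∑ k ∈ Finset.range n, b k * v k := by
  have key : ∀ n, b n * (C * ∑ k ∈ Finset.range n, v k - ∑ k ∈ Finset.range n, u k) ≤
      C * ∑ k ∈ Finset.range n, b k * v k - ∑ k ∈ Finset.range n, b k * u k := by
    intro n
    induction n with
    | zero => simp
    | succ n ih =>
      have h1 := mul_le_mul_of_nonneg_right (hb n.le_succ) (sub_nonneg.2 (h (n + 1)))
      refine h1.trans ?_
      simp only [Finset.sum_range_succ]
      linarith
  have := mul_nonneg (hb0 n) (sub_nonneg.2 (h n))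
  linarith [key n]

theorem lorentzENorm_add_lt_top {w : ℕ → ℝ} (hw : IsWeight w) (hd : IsDoubling w) {q : ℝ≥0∞}
    (hq : 0 < q) {f g : ℕ → 𝕜} (hf : Tendsto f atTop (𝓝 0)) (hg : Tendsto g atTop (𝓝 0))
    (hf' : lorentzENorm w q f < ∞) (hg' : lorentzENorm w q g < ∞) :
    lorentzENorm w q (f + g) < ∞ := by
  obtain ⟨C, hC0, hC⟩ := primitiveWeight_doubling hw hd
  by_cases hq' : q = ∞
  · simp only [lorentzENorm, hq', if_true] at hf' hg' ⊢
    refine lt_of_le_of_lt (iSup_le fun n => ?_)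
      (ENNReal.mul_lt_top (ENNReal.ofReal_lt_top (r := C)) (ENNReal.add_lt_top.2 ⟨hf', hg'⟩))
    have hs := hC (n + 1) (by omega)
    have hidx : (n + 1 + 1) / 2 = n / 2 + 1 := by omega
    rw [hidx] at hs
    have h1 := rearrangement_add_le_half hf hg n
    have hf0 := rearrangement_nonneg f (n / 2)
    have hg0 := rearrangement_nonneg g (n / 2)
    have hp := primitiveWeight_pos hw (n / 2)
    calc ENNReal.ofReal (rearrangement (f + g) n * primitiveWeight w (n + 1))
        ≤ ENNReal.ofReal (C * (rearrangement f (n / 2) * primitiveWeight w (n / 2 + 1) +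
            rearrangement g (n / 2) * primitiveWeight w (n / 2 + 1))) := by
          apply ENNReal.ofReal_le_ofReal
          have := mul_le_mul h1 hs (primitiveWeight_pos hw n).le (add_nonneg hf0 hg0)
          linarith
      _ = ENNReal.ofReal C *
          (ENNReal.ofReal (rearrangement f (n / 2) * primitiveWeight w (n / 2 + 1)) +
            ENNReal.ofReal (rearrangement g (n / 2) * primitiveWeight w (n / 2 + 1))) := by
          rw [ENNReal.ofReal_mul hC0, ENNReal.ofReal_add (by positivity) (by positivity)]
      _ ≤ _ := by
          gcongr
          · exact le_iSup (fun n => ENNReal.ofReal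
              (rearrangement f n * primitiveWeight w (n + 1))) (n / 2)
          · exact le_iSup (fun n => ENNReal.ofReal
              (rearrangement g n * primitiveWeight w (n + 1))) (n / 2)
  · have hr : 0 < q.toReal := ENNReal.toReal_pos hq.ne' hq'
    simp only [lorentzENorm, hq', if_false,
      ENNReal.rpow_lt_top_iff_of_pos (one_div_pos.2 hr)] at hf' hg' ⊢
    set r := q.toReal
    set v : ℕ → ℝ := fun n =>
      primitiveWeight w (n + 1) ^ r * (w n / primitiveWeight w (n + 1)) with hv
    have hv0 : ∀ n, 0 ≤ v n := fun n => by
      have := primitiveWeight_pos hw n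
      have := hw.1 n
      positivity
    have hterm : ∀ (f : ℕ → 𝕜) (n : ℕ),
        (rearrangement f n * primitiveWeight w (n + 1)) ^ r *
          (w n / primitiveWeight w (n + 1)) = rearrangement f n ^ r * v n := fun f n => by
      rw [Real.mul_rpow (rearrangement_nonneg f n) (primitiveWeight_pos hw n).le, hv, mul_assoc]
    simp only [hterm] at hf' hg' ⊢
    set D : ℝ := max 1 r / min 1 r * C ^ r with hD
    have hmin : 0 < min 1 r := lt_min one_pos hr
    have hmax : 0 < max 1 r := lt_max_of_lt_left one_pos
    have hD0 : 0 ≤ D := by positivity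
    have hV : ∀ n, ∑ k ∈ Finset.range n, (v (2 * k) + v (2 * k + 1)) ≤
        D * ∑ k ∈ Finset.range n, v k := by
      intro n
      have e : ∑ k ∈ Finset.range n, (v (2 * k) + v (2 * k + 1)) =
          ∑ k ∈ Finset.range (2 * n), v k := by
        induction n with
        | zero => simp
        | succ n ih =>
          rw [Finset.sum_range_succ, ih, show 2 * (n + 1) = 2 * n + 1 + 1 by ring,
            Finset.sum_range_succ, Finset.sum_range_succ, add_assoc]
      rw [e]
      rcases Nat.eq_zero_or_pos n with rfl | hn
      · simp
      have h1 := (lorentzWeight_comparable hw hr (2 * n)).1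
      have h2 := (lorentzWeight_comparable hw hr n).2
      have h3 := hC (2 * n) (by omega)
      rw [show (2 * n + 1) / 2 = n by omega] at h3
      have hs0 : ∀ n, 0 ≤ primitiveWeight w n := fun n => Finset.sum_nonneg fun k _ => hw.1 k
      have h4 := Real.rpow_le_rpow (hs0 _) h3 hr.le
      rw [Real.mul_rpow hC0 (hs0 _)] at h4
      have h5 := mul_le_mul_of_nonneg_left h2 (Real.rpow_nonneg hC0 r)
      have h6 := (h1.trans h4).trans h5
      rw [← le_div_iff₀' hmin] at h6
      refine h6.trans (le_of_eq ?_)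
      rw [hD, hv]; ring
    have hhalf : ∀ f : ℕ → 𝕜, Tendsto f atTop (𝓝 0) →
        ∑' n, ENNReal.ofReal (rearrangement f n ^ r * v n) < ∞ →
        ∑' n, ENNReal.ofReal (rearrangement f (n / 2) ^ r * v n) < ∞ := by
      intro f hf hlt
      refine lt_of_le_of_lt (ENNReal.tsum_le_of_sum_range_le (c := ENNReal.ofReal D *
        ∑' n, ENNReal.ofReal (rearrangement f n ^ r * v n)) fun n => ?_)
        (ENNReal.mul_lt_top ENNReal.ofReal_lt_top hlt)
      have hb0 : ∀ n, 0 ≤ rearrangement f n ^ r := fun n =>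
        Real.rpow_nonneg (rearrangement_nonneg f n) r
      have hb : Antitone fun n => rearrangement f n ^ r := fun m n hmn =>
        Real.rpow_le_rpow (rearrangement_nonneg f n) (rearrangement_antitone hf hmn) hr.le
      have e : ∑ k ∈ Finset.range (2 * n), rearrangement f (k / 2) ^ r * v k =
          ∑ k ∈ Finset.range n, rearrangement f k ^ r * (v (2 * k) + v (2 * k + 1)) := by
        clear hV
        induction n with
        | zero => simp
        | succ n ih =>
          rw [Finset.sum_range_succ _ n, ← ih, show 2 * (n + 1) = 2 * n + 1 + 1 by ring,
            Finset.sum_range_succ, Finset.sum_range_succ, show 2 * n / 2 = n by omega,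
            show (2 * n + 1) / 2 = n by omega]
          ring
      calc ∑ k ∈ Finset.range n, ENNReal.ofReal (rearrangement f (k / 2) ^ r * v k)
          ≤ ∑ k ∈ Finset.range (2 * n), ENNReal.ofReal (rearrangement f (k / 2) ^ r * v k) :=
            Finset.sum_le_sum_of_subset (Finset.range_mono (by omega))
        _ = ENNReal.ofReal (∑ k ∈ Finset.range (2 * n), rearrangement f (k / 2) ^ r * v k) :=
            (ENNReal.ofReal_sum_of_nonneg fun k _ => mul_nonneg (hb0 _) (hv0 k)).symm
        _ ≤ ENNReal.ofReal (D * ∑ k ∈ Finset.range n, rearrangement f k ^ r * v k) := by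
            rw [e]
            exact ENNReal.ofReal_le_ofReal (sum_antitone_mul_le hb hb0 hV n)
        _ = ENNReal.ofReal D *
            ∑ k ∈ Finset.range n, ENNReal.ofReal (rearrangement f k ^ r * v k) := by
            rw [ENNReal.ofReal_mul hD0,
              ENNReal.ofReal_sum_of_nonneg fun k _ => mul_nonneg (hb0 _) (hv0 k)]
        _ ≤ _ := by
            gcongr
            exact ENNReal.sum_le_tsum _
    refine lt_of_le_of_lt (ENNReal.tsum_le_tsum (g := fun n => ENNReal.ofReal (2 ^ r) *
      (ENNReal.ofReal (rearrangement f (n / 2) ^ r * v n) +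
        ENNReal.ofReal (rearrangement g (n / 2) ^ r * v n))) fun n => ?_) ?_
    · have hf0 := rearrangement_nonneg f (n / 2)
      have hg0 := rearrangement_nonneg g (n / 2)
      have hvn := hv0 n
      rw [← ENNReal.ofReal_add (by positivity) (by positivity),
        ← ENNReal.ofReal_mul (by positivity)]
      apply ENNReal.ofReal_le_ofReal
      rw [← add_mul, ← mul_assoc (2 ^ r)]
      refine mul_le_mul_of_nonneg_right ?_ hvn
      set A := rearrangement f (n / 2)
      set B := rearrangement g (n / 2)
      calc rearrangement (f + g) n ^ r ≤ (2 * max A B) ^ r := by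
            refine Real.rpow_le_rpow (rearrangement_nonneg _ _) ?_ hr.le
            have := rearrangement_add_le_half hf hg n
            linarith [le_max_left A B, le_max_right A B]
        _ = 2 ^ r * max A B ^ r := Real.mul_rpow (by norm_num) (le_max_of_le_left hf0)
        _ ≤ 2 ^ r * (A ^ r + B ^ r) := by
            gcongr
            rcases max_choice A B with h | h <;> rw [h]
            · linarith [Real.rpow_nonneg hg0 r]
            · linarith [Real.rpow_nonneg hf0 r]
    · rw [ENNReal.tsum_mul_left, ENNReal.tsum_add]
      exact ENNReal.mul_lt_top ENNReal.ofReal_lt_top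
        (ENNReal.add_lt_top.2 ⟨hhalf f hf hf', hhalf g hg hg'⟩)

theorem lorentzENorm_smul_lt_top {w : ℕ → ℝ} (hw : IsWeight w) {q : ℝ≥0∞} (hq : 0 < q)
    {f : ℕ → 𝕜} (hf : Tendsto f atTop (𝓝 0)) (hf' : lorentzENorm w q f < ∞) (c : 𝕜) :
    lorentzENorm w q (c • f) < ∞ := by
  by_cases hq' : q = ∞
  · simp only [lorentzENorm, hq', if_true] at hf' ⊢
    refine lt_of_le_of_lt (iSup_le fun n => ?_)
      (ENNReal.mul_lt_top (ENNReal.ofReal_lt_top (r := ‖c‖)) hf')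
    refine le_trans ?_ (mul_le_mul_right (le_iSup (fun n => ENNReal.ofReal
      (rearrangement f n * primitiveWeight w (n + 1))) n) _)
    rw [← ENNReal.ofReal_mul (norm_nonneg c), ← mul_assoc]
    exact ENNReal.ofReal_le_ofReal (mul_le_mul_of_nonneg_right (rearrangement_smul_le hf c n)
      (primitiveWeight_pos hw n).le)
  · have hr : 0 < q.toReal := ENNReal.toReal_pos hq.ne' hq'
    simp only [lorentzENorm, hq', if_false,
      ENNReal.rpow_lt_top_iff_of_pos (one_div_pos.2 hr)] at hf' ⊢
    refine lt_of_le_of_lt (ENNReal.tsum_le_tsum fun n => ?_)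
      (lt_of_eq_of_lt ENNReal.tsum_mul_left
        (ENNReal.mul_lt_top (ENNReal.ofReal_lt_top (r := ‖c‖ ^ q.toReal)) hf'))
    have hp := primitiveWeight_pos hw n
    have hf0 := rearrangement_nonneg f n
    rw [← ENNReal.ofReal_mul (by positivity), ← mul_assoc,
      ← Real.mul_rpow (norm_nonneg c) (by positivity), ← mul_assoc]
    refine ENNReal.ofReal_le_ofReal (mul_le_mul_of_nonneg_right (Real.rpow_le_rpow
      (mul_nonneg (rearrangement_nonneg _ _) hp.le) ?_ hr.le) (div_nonneg (hw.1 n) hp.le))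
    exact mul_le_mul_of_nonneg_right (rearrangement_smul_le hf c n) hp.le

theorem lorentzENorm_finite_support_lt_top (w : ℕ → ℝ) {q : ℝ≥0∞} (hq : 0 < q) {f : ℕ → 𝕜}
    (hf : {k | f k ≠ 0}.Finite) : lorentzENorm w q f < ∞ := by
  have h0 : ∀ n, hf.toFinset.card ≤ n → rearrangement f n = 0 := fun n hn => by
    refine le_antisymm (rearrangement_le le_rfl ?_) (rearrangement_nonneg f n)
    have : {k | 0 < ‖f k‖} = {k | f k ≠ 0} := by ext k; simp
    rw [this, hf.encard_eq_coe_toFinset_card]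
    exact_mod_cast hn
  by_cases hq' : q = ∞
  · simp only [lorentzENorm, hq', if_true]
    refine lt_of_le_of_lt (iSup_le fun n => ?_) (ENNReal.sum_lt_top (s := Finset.range
      hf.toFinset.card) (f := fun n => ENNReal.ofReal
        (rearrangement f n * primitiveWeight w (n + 1))) |>.2 fun _ _ => ENNReal.ofReal_lt_top)
    by_cases hn : n < hf.toFinset.card
    · exact Finset.single_le_sum (f := fun n => ENNReal.ofReal
        (rearrangement f n * primitiveWeight w (n + 1))) (fun _ _ => zero_le)
        (Finset.mem_range.2 hn)
    · simp [h0 n (not_lt.1 hn)]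
  · have hr : 0 < q.toReal := ENNReal.toReal_pos hq.ne' hq'
    simp only [lorentzENorm, hq', if_false, ENNReal.rpow_lt_top_iff_of_pos (one_div_pos.2 hr)]
    rw [tsum_eq_sum (s := Finset.range hf.toFinset.card) fun n hn => by
      rw [h0 n (by simpa using hn)]; simp [Real.zero_rpow hr.ne']]
    exact ENNReal.sum_lt_top.2 fun _ _ => ENNReal.ofReal_lt_top

variable (𝕜) in
/-- The Lorentz sequence space `d_{1,q}(w)`, a space of null sequences. -/
def lorentzSpace (w : ℕ → ℝ) (hw : IsWeight w) (hd : IsDoubling w) (q : ℝ≥0∞) (hq : 0 < q) :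
    Submodule 𝕜 (ℕ → 𝕜) where
  carrier := {f | Tendsto f atTop (𝓝 0) ∧ lorentzENorm w q f < ∞}
  add_mem' hf hg := ⟨add_zero (0 : 𝕜) ▸ hf.1.add hg.1,
    lorentzENorm_add_lt_top hw hd hq hf.1 hg.1 hf.2 hg.2⟩
  zero_mem' := ⟨tendsto_const_nhds, lorentzENorm_finite_support_lt_top w hq (by simp)⟩
  smul_mem' c f hf := ⟨smul_zero (A := 𝕜) c ▸ hf.1.const_smul c,
    lorentzENorm_smul_lt_top hw hq hf.1 hf.2 c⟩

variable {w : ℕ → ℝ} {hw : IsWeight w} {hd : IsDoubling w} {q : ℝ≥0∞} {hq : 0 < q}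

/-- The quasi-norm `‖f‖_{1,q,w}` of the Lorentz space. -/
noncomputable def lorentzNorm (f : lorentzSpace 𝕜 w hw hd q hq) : ℝ :=
  (lorentzENorm w q (f : ℕ → 𝕜)).toReal

variable (𝕜 hw hd hq) in
/-- The unit vectors as elements of the Lorentz space. -/
def lorentzUnit (n : ℕ) : lorentzSpace 𝕜 w hw hd q hq :=
  ⟨Pi.single n 1, by
    refine tendsto_const_nhds.congr' ?_
    filter_upwards [eventually_gt_atTop n] with k hk
    rw [Pi.single_eq_of_ne hk.ne'],
    lorentzENorm_finite_support_lt_top w hq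
      ((Set.finite_singleton n).subset fun k hk => by
        by_contra h
        exact hk (Pi.single_eq_of_ne h _))⟩

variable (𝕜 hw hd hq) in
/-- The closed linear span of `c₀₀` in the Lorentz space; for `q = ∞` this is the separable
part `d⁰_{1,∞}(w)`. -/
noncomputable def lorentzSeparablePart : Submodule 𝕜 (lorentzSpace 𝕜 w hw hd q hq) :=
  closedSpan 𝕜 lorentzNorm (lorentzUnit 𝕜 hw hd hq)

variable (𝕜 hw hd hq) in
/-- The unit vectors as elements of the separable part. -/
noncomputable def lorentzSeparableUnit (n : ℕ) : lorentzSeparablePart 𝕜 hw hd hq :=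
  ⟨lorentzUnit 𝕜 hw hd hq n, mem_closedSpan _ _ n⟩

variable (𝕜 hw hd hq) in
/-- The Lorentz space is continuously included in `ℓ₁`. -/
def LorentzIncludedInEllOne : Prop :=
  (∀ f : lorentzSpace 𝕜 w hw hd q hq, Memℓp (f : ℕ → 𝕜) 1) ∧
  ∃ C : ℝ, ∀ f : lorentzSpace 𝕜 w hw hd q hq, ∑' n, ‖(f : ℕ → 𝕜) n‖ ≤ C * lorentzNorm f

end Lorentz

/-! ### The non-increasing rearrangement -/

section Rearrangement

variable {𝕜 𝕜' : Type*} [RCLike 𝕜] [RCLike 𝕜']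

/-! Throughout, `(aₙ)` is the rearrangement of `f` and `r` is the real number `q`.

Inclusions and strong absoluteness. Since `∑ |f k| ≤ ∑ aₙ`, inclusion in `ℓ₁` follows from `∑ aₙ ≤ K
‖f‖`. Strong absoluteness follows if every `ε > 0` admits `A` with `∑ aₙ ≤ A a₁ + ε ‖f‖`, because
`a₁` is the largest coefficient and all unit vectors have the same quasi-norm
(`isStronglyAbsoluteBasis_lorentzUnit`). In the weak space `aₙ ≤ ‖f‖ / sₙ`, so the tails of `∑ 1 /
sₙ` supply `ε`; conversely the truncations of `(1 / sₙ)` stay in the unit ball and detect the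
divergence of that series. For `1 < q < ∞`, Hölder's inequality is applied to a tail of `∑ aₙ`. For
`q ≤ 1`, writing `aₙ sₙ = (aₙ sₙ)^(1-r) (aₙ sₙ)^r` and bounding the first factor by the weak
quasi-norm gives `∑ aₙ wₙ ≤ K ‖f‖` (`tsum_rearrangement_mul_weight_le`). Abel summation against the
non-increasing `(aₙ)` then converts `n ≤ c⁻¹ sₙ` into the inclusion, and `n ≤ m + (ε / K) sₙ` into
strong absoluteness. Indicators of initial segments show that `inf sₙ / n > 0` is necessary.

Universality for `q < 1`. The engine is the interpolation inequality `‖f‖₁ ≤ K ‖f‖^r W^(1-r)`, where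
`W` bounds the weak `ℓ₁` norm (`sum_norm_le_of_weak`). Let `y m` be the blocks and `φ m` their
functionals.

The coordinatewise product of `y m` and `φ m` has `ℓ₁` norm at least `1` and bounded Lorentz
quasi-norm, so its weak `ℓ₁` norm is bounded below. A level set realizing this contains a flat part
`B m`, on which `|y m| ≥ c₁ / |B m|` and `|φ m| ≥ c₂` (`exists_flat_part`).

Only few blocks have a large flat part (`exists_card_bound_of_flat_parts`). Given `N` of them,
ordered by size with least size `n`, take a vector of modulus `1 / n` on about `n / (i L)` points of
the `i`-th one, where `L` is the `N`-th harmonic number. It is supported on at most `2n` points, so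
its quasi-norm is of order `sₙ / n`, which is bounded because `y m` is already flat at this level.
Its projection dominates `1 / L` times the step function with values `1 / (i |Bᵢ|)`. That function
has weak `ℓ₁` norm at most `1` but `ℓ₁` norm `L`, and interpolation yields `L ≤ K' L^r`, which is
false for large `N`.

Every other block has a coordinate `π m` at which both `y m` and `φ m` are bounded below.
Restriction to these coordinates in one direction, the projection in the other, and a crude bound on
the few exceptional blocks give the equivalence (`exists_cEquivalent_lorentzUnit`). -/

theorem rearrangement_le_of_norm_le_add {f : ℕ → 𝕜} {g : ℕ → 𝕜'} (hg : Tendsto g atTop (𝓝 0))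
    {ε : ℝ} (hε : 0 ≤ ε) (h : ∀ k, ‖f k‖ ≤ ‖g k‖ + ε) (n : ℕ) :
    rearrangement f n ≤ rearrangement g n + ε := by
  rw [← sub_le_iff_le_add]
  refine le_csInf (rearrangement_set_nonempty hg n) fun t ht => ?_
  rw [sub_le_iff_le_add]
  refine rearrangement_le (add_nonneg ht.1 hε) ((Set.encard_le_encard fun k hk => ?_).trans ht.2)
  simp only [Set.mem_ofPred_eq] at hk ⊢
  linarith [h k]

theorem rearrangement_mono {f : ℕ → 𝕜} {g : ℕ → 𝕜'} (hg : Tendsto g atTop (𝓝 0))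
    (h : ∀ k, ‖f k‖ ≤ ‖g k‖) (n : ℕ) : rearrangement f n ≤ rearrangement g n := by
  simpa using rearrangement_le_of_norm_le_add hg le_rfl (fun k => by simpa using h k) n

theorem rearrangement_le_of_norm_le {f : ℕ → 𝕜} {B : ℝ} (hB : 0 ≤ B) (h : ∀ k, ‖f k‖ ≤ B)
    (n : ℕ) : rearrangement f n ≤ B := by
  refine rearrangement_le hB ?_
  have : {k | B < ‖f k‖} = ∅ := by
    ext k; simpa using h k
  simp [this]

theorem lt_encard_of_lt_rearrangement {f : ℕ → 𝕜} {n : ℕ} {t : ℝ} (ht : 0 ≤ t)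
    (h : t < rearrangement f n) : (n : ℕ∞) < {k | t < ‖f k‖}.encard := by
  by_contra hcon
  exact absurd (rearrangement_le ht (not_lt.1 hcon)) (not_le.2 h)

theorem le_rearrangement {f : ℕ → 𝕜} (hf : Tendsto f atTop (𝓝 0)) {n : ℕ} {t : ℝ}
    {s : Finset ℕ} (hs : n < s.card) (h : ∀ k ∈ s, t ≤ ‖f k‖) : t ≤ rearrangement f n := by
  refine le_csInf (rearrangement_set_nonempty hf n) fun u hu => ?_
  by_contra! hut
  have h1 : (s : Set ℕ) ⊆ {k | u < ‖f k‖} := fun k hk => hut.trans_le (h k hk)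
  have h2 := (Set.encard_le_encard h1).trans hu.2
  rw [Set.encard_coe_eq_coe_finsetCard] at h2
  have : s.card ≤ n := by exact_mod_cast h2
  omega

theorem rearrangement_eq_zero {f : ℕ → 𝕜} {s : Finset ℕ} (h : ∀ k ∉ s, f k = 0) {n : ℕ}
    (hn : s.card ≤ n) : rearrangement f n = 0 := by
  refine le_antisymm (rearrangement_le le_rfl ?_) (rearrangement_nonneg f n)
  have h1 : {k | 0 < ‖f k‖} ⊆ (s : Set ℕ) := fun k hk => by
    by_contra hks
    simp only [Set.mem_ofPred_eq, h k (by simpa using hks), norm_zero, lt_irrefl] at hk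
  refine (Set.encard_le_encard h1).trans ?_
  rw [Set.encard_coe_eq_coe_finsetCard]
  exact_mod_cast hn

theorem rearrangement_smul {f : ℕ → 𝕜} (hf : Tendsto f atTop (𝓝 0)) (c : 𝕜) (n : ℕ) :
    rearrangement (c • f) n = ‖c‖ * rearrangement f n := by
  refine le_antisymm (rearrangement_smul_le hf c n) ?_
  rcases eq_or_ne c 0 with rfl | hc
  · simpa using rearrangement_nonneg _ _
  have hcf : Tendsto (c • f) atTop (𝓝 0) := smul_zero (A := 𝕜) c ▸ hf.const_smul c
  have h := rearrangement_smul_le hcf c⁻¹ n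
  rw [smul_smul, inv_mul_cancel₀ hc, one_smul, norm_inv] at h
  have hc' : 0 < ‖c‖ := norm_pos_iff.2 hc
  calc _ ≤ ‖c‖ * (‖c‖⁻¹ * rearrangement (c • f) n) := by gcongr
    _ = _ := by rw [← mul_assoc, mul_inv_cancel₀ hc'.ne', one_mul]

theorem norm_le_rearrangement_zero {f : ℕ → 𝕜} (hf : Tendsto f atTop (𝓝 0)) (k : ℕ) :
    ‖f k‖ ≤ rearrangement f 0 :=
  le_rearrangement hf (s := {k}) (by simp) (by simp)

/-- If `s` has `n + 1` elements, the least modulus on `s` is reached or exceeded at `n + 1` indices,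
so it is at most the rearranged term with index `n`. Deleting its index leaves a set of size `n` for
the induction. -/
theorem sum_norm_le_sum_rearrangement {f : ℕ → 𝕜} (hf : Tendsto f atTop (𝓝 0)) (s : Finset ℕ) :
    ∑ k ∈ s, ‖f k‖ ≤ ∑ n ∈ Finset.range s.card, rearrangement f n := by
  induction h : s.card generalizing s with
  | zero => simp [Finset.card_eq_zero.1 h]
  | succ n ih =>
    obtain ⟨k, hk, hmin⟩ := s.exists_min_image (fun k => ‖f k‖) (Finset.card_pos.1 (by omega))
    rw [← Finset.sum_erase_add _ _ hk, Finset.sum_range_succ]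
    exact add_le_add (ih _ (by rw [Finset.card_erase_of_mem hk]; omega))
      (le_rearrangement hf (by omega) hmin)

theorem tsum_ofReal_norm_le {f : ℕ → 𝕜} (hf : Tendsto f atTop (𝓝 0)) :
    ∑' k, ENNReal.ofReal ‖f k‖ ≤ ∑' n, ENNReal.ofReal (rearrangement f n) := by
  rw [ENNReal.tsum_eq_iSup_sum]
  refine iSup_le fun s => ?_
  rw [← ENNReal.ofReal_sum_of_nonneg fun k _ => norm_nonneg _]
  refine (ENNReal.ofReal_le_ofReal (sum_norm_le_sum_rearrangement hf s)).trans ?_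
  rw [ENNReal.ofReal_sum_of_nonneg fun k _ => rearrangement_nonneg f k]
  exact ENNReal.sum_le_tsum _

end Rearrangement

/-! ### The Lorentz quasi-norm on sequences -/

section LorentzENorm

variable {𝕜 𝕜' : Type*} [RCLike 𝕜] [RCLike 𝕜'] {w : ℕ → ℝ} {q : ℝ≥0∞}

/-- The weight `sₙ ^ r * wₙ / sₙ` of `aₙ ^ r` in the Lorentz quasi-norm. -/
noncomputable def lorentzWeight (w : ℕ → ℝ) (r : ℝ) (n : ℕ) : ℝ :=
  primitiveWeight w (n + 1) ^ r * (w n / primitiveWeight w (n + 1))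

theorem lorentzWeight_nonneg (hw : IsWeight w) (r : ℝ) (n : ℕ) : 0 ≤ lorentzWeight w r n := by
  have := primitiveWeight_pos hw n
  have := hw.1 n
  unfold lorentzWeight
  positivity

theorem primitiveWeight_nonneg (hw : IsWeight w) (n : ℕ) : 0 ≤ primitiveWeight w n :=
  Finset.sum_nonneg fun k _ => hw.1 k

theorem primitiveWeight_mono (hw : IsWeight w) : Monotone (primitiveWeight w) :=
  monotone_nat_of_le_succ fun n => by
    rw [primitiveWeight, primitiveWeight, Finset.sum_range_succ]
    linarith [hw.1 n]

theorem lorentzENorm_top (f : ℕ → 𝕜) : lorentzENorm w ∞ f =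
    ⨆ n, ENNReal.ofReal (rearrangement f n * primitiveWeight w (n + 1)) := if_pos rfl

theorem lorentzENorm_of_ne_top (hw : IsWeight w) (hq' : q ≠ ∞) (f : ℕ → 𝕜) :
    lorentzENorm w q f = (∑' n, ENNReal.ofReal
      (rearrangement f n ^ q.toReal * lorentzWeight w q.toReal n)) ^ (1 / q.toReal) := by
  rw [lorentzENorm, if_neg hq']
  congr 2
  ext n
  rw [Real.mul_rpow (rearrangement_nonneg f n) (primitiveWeight_pos hw n).le, lorentzWeight,
    mul_assoc]

theorem lorentzENorm_rpow (hw : IsWeight w) (hq : 0 < q) (hq' : q ≠ ∞) (f : ℕ → 𝕜) :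
    lorentzENorm w q f ^ q.toReal = ∑' n, ENNReal.ofReal
      (rearrangement f n ^ q.toReal * lorentzWeight w q.toReal n) := by
  have hr : 0 < q.toReal := ENNReal.toReal_pos hq.ne' hq'
  rw [lorentzENorm_of_ne_top hw hq', ← ENNReal.rpow_mul, one_div_mul_cancel hr.ne',
    ENNReal.rpow_one]

theorem lorentzENorm_le_of_rearrangement_le (hw : IsWeight w) {f : ℕ → 𝕜} {g : ℕ → 𝕜'}
    (h : ∀ n, rearrangement f n ≤ rearrangement g n) :
    lorentzENorm w q f ≤ lorentzENorm w q g := by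
  by_cases hq' : q = ∞
  · subst hq'
    rw [lorentzENorm_top, lorentzENorm_top]
    gcongr with n
    · exact (primitiveWeight_pos hw n).le
    · exact h n
  · rw [lorentzENorm_of_ne_top hw hq', lorentzENorm_of_ne_top hw hq']
    gcongr with n
    · exact lorentzWeight_nonneg hw _ n
    · exact rearrangement_nonneg f n
    · exact h n

theorem lorentzENorm_mono (hw : IsWeight w) {f : ℕ → 𝕜} {g : ℕ → 𝕜'} (hg : Tendsto g atTop (𝓝 0))
    (h : ∀ k, ‖f k‖ ≤ ‖g k‖) : lorentzENorm w q f ≤ lorentzENorm w q g :=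
  lorentzENorm_le_of_rearrangement_le hw (rearrangement_mono hg h)

theorem lorentzENorm_smul (hw : IsWeight w) (hq : 0 < q) {f : ℕ → 𝕜} (hf : Tendsto f atTop (𝓝 0))
    (c : 𝕜) : lorentzENorm w q (c • f) = ENNReal.ofReal ‖c‖ * lorentzENorm w q f := by
  by_cases hq' : q = ∞
  · subst hq'
    rw [lorentzENorm_top, lorentzENorm_top, ENNReal.mul_iSup]
    simp_rw [rearrangement_smul hf, mul_assoc, ENNReal.ofReal_mul (norm_nonneg c)]
  · have hr : 0 < q.toReal := ENNReal.toReal_pos hq.ne' hq'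
    rw [lorentzENorm_of_ne_top hw hq', lorentzENorm_of_ne_top hw hq']
    simp_rw [rearrangement_smul hf, Real.mul_rpow (norm_nonneg c) (rearrangement_nonneg f _),
      mul_assoc, ENNReal.ofReal_mul (Real.rpow_nonneg (norm_nonneg c) _)]
    rw [ENNReal.tsum_mul_left, ENNReal.mul_rpow_of_nonneg _ _ (by positivity),
      ENNReal.ofReal_rpow_of_nonneg (by positivity) (by positivity), ← Real.rpow_mul
        (norm_nonneg c), mul_one_div_cancel hr.ne', Real.rpow_one]

/-! ### The quasi-triangle inequality -/

theorem sum_lorentzWeight_pair_le (hw : IsWeight w) {C : ℝ} (hC0 : 0 ≤ C)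
    (hC : ∀ m : ℕ, 1 ≤ m → primitiveWeight w m ≤ C * primitiveWeight w ((m + 1) / 2))
    {r : ℝ} (hr : 0 < r) (n : ℕ) :
    ∑ k ∈ Finset.range n, (lorentzWeight w r (2 * k) + lorentzWeight w r (2 * k + 1)) ≤
      max 1 r / min 1 r * C ^ r * ∑ k ∈ Finset.range n, lorentzWeight w r k := by
  have hmin : 0 < min 1 r := lt_min one_pos hr
  have e : ∑ k ∈ Finset.range n, (lorentzWeight w r (2 * k) + lorentzWeight w r (2 * k + 1)) =
      ∑ k ∈ Finset.range (2 * n), lorentzWeight w r k := by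
    induction n with
    | zero => simp
    | succ n ih =>
      rw [Finset.sum_range_succ, ih, show 2 * (n + 1) = 2 * n + 1 + 1 by ring,
        Finset.sum_range_succ, Finset.sum_range_succ, add_assoc]
  rw [e]
  rcases Nat.eq_zero_or_pos n with rfl | hn
  · simp
  have h1 : _ * ∑ k ∈ Finset.range (2 * n), lorentzWeight w r k ≤ _ :=
    (lorentzWeight_comparable hw hr (2 * n)).1
  have h2 : _ ≤ _ * ∑ k ∈ Finset.range n, lorentzWeight w r k :=
    (lorentzWeight_comparable hw hr n).2
  have h3 := hC (2 * n) (by omega)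
  rw [show (2 * n + 1) / 2 = n by omega] at h3
  have h4 := Real.rpow_le_rpow (primitiveWeight_nonneg hw _) h3 hr.le
  rw [Real.mul_rpow hC0 (primitiveWeight_nonneg hw _)] at h4
  have h5 := mul_le_mul_of_nonneg_left h2 (Real.rpow_nonneg hC0 r)
  have h6 := (h1.trans h4).trans h5
  rw [← le_div_iff₀' hmin] at h6
  exact h6.trans (le_of_eq (by ring))

/-- The sequence `a (n / 2)` repeats every term of the rearrangement twice, which amounts to adding
up the weights in pairs. Doubling controls the partial sums of the paired weights, and Abel
summation against the non-increasing `a ^ r` carries this over to the series. -/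
theorem tsum_rearrangement_half_le (hw : IsWeight w) {C : ℝ} (hC0 : 0 ≤ C)
    (hC : ∀ m : ℕ, 1 ≤ m → primitiveWeight w m ≤ C * primitiveWeight w ((m + 1) / 2))
    {r : ℝ} (hr : 0 < r) {f : ℕ → 𝕜} (hf : Tendsto f atTop (𝓝 0)) :
    ∑' n, ENNReal.ofReal (rearrangement f (n / 2) ^ r * lorentzWeight w r n) ≤
      ENNReal.ofReal (max 1 r / min 1 r * C ^ r) *
        ∑' n, ENNReal.ofReal (rearrangement f n ^ r * lorentzWeight w r n) := by
  have hD0 : 0 ≤ max 1 r / min 1 r * C ^ r := by positivity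
  refine ENNReal.tsum_le_of_sum_range_le fun n => ?_
  have hv0 := lorentzWeight_nonneg hw r
  have hb0 : ∀ n, 0 ≤ rearrangement f n ^ r := fun n =>
    Real.rpow_nonneg (rearrangement_nonneg f n) r
  have hb : Antitone fun n => rearrangement f n ^ r := fun m n hmn =>
    Real.rpow_le_rpow (rearrangement_nonneg f n) (rearrangement_antitone hf hmn) hr.le
  have e : ∑ k ∈ Finset.range (2 * n), rearrangement f (k / 2) ^ r * lorentzWeight w r k =
      ∑ k ∈ Finset.range n, rearrangement f k ^ r *
        (lorentzWeight w r (2 * k) + lorentzWeight w r (2 * k + 1)) := by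
    induction n with
    | zero => simp
    | succ n ih =>
      rw [Finset.sum_range_succ _ n, ← ih, show 2 * (n + 1) = 2 * n + 1 + 1 by ring,
        Finset.sum_range_succ, Finset.sum_range_succ, show 2 * n / 2 = n by omega,
        show (2 * n + 1) / 2 = n by omega]
      ring
  calc ∑ k ∈ Finset.range n, ENNReal.ofReal (rearrangement f (k / 2) ^ r * lorentzWeight w r k)
      ≤ ∑ k ∈ Finset.range (2 * n),
          ENNReal.ofReal (rearrangement f (k / 2) ^ r * lorentzWeight w r k) :=
        Finset.sum_le_sum_of_subset (Finset.range_mono (by omega))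
    _ = ENNReal.ofReal (∑ k ∈ Finset.range (2 * n),
          rearrangement f (k / 2) ^ r * lorentzWeight w r k) :=
        (ENNReal.ofReal_sum_of_nonneg fun k _ => mul_nonneg (hb0 _) (hv0 k)).symm
    _ ≤ ENNReal.ofReal (max 1 r / min 1 r * C ^ r *
          ∑ k ∈ Finset.range n, rearrangement f k ^ r * lorentzWeight w r k) := by
        rw [e]
        exact ENNReal.ofReal_le_ofReal
          (sum_antitone_mul_le hb hb0 (sum_lorentzWeight_pair_le hw hC0 hC hr) n)
    _ = ENNReal.ofReal (max 1 r / min 1 r * C ^ r) *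
        ∑ k ∈ Finset.range n, ENNReal.ofReal (rearrangement f k ^ r * lorentzWeight w r k) := by
        rw [ENNReal.ofReal_mul hD0,
          ENNReal.ofReal_sum_of_nonneg fun k _ => mul_nonneg (hb0 _) (hv0 k)]
    _ ≤ _ := by
        gcongr
        exact ENNReal.sum_le_tsum _

variable (𝕜) in
-- The bound `rearrangement (f + g) n ≤ rearrangement f (n / 2) + rearrangement g (n / 2)` reduces
-- the claim to the cost of halving the index, which doubling controls.
theorem lorentzENorm_add_le (hw : IsWeight w) (hd : IsDoubling w) (hq : 0 < q) :
    ∃ κ : ℝ, 1 ≤ κ ∧ ∀ f g : ℕ → 𝕜, Tendsto f atTop (𝓝 0) → Tendsto g atTop (𝓝 0) →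
      lorentzENorm w q (f + g) ≤
        ENNReal.ofReal κ * (lorentzENorm w q f + lorentzENorm w q g) := by
  obtain ⟨C, hC0, hC⟩ := primitiveWeight_doubling hw hd
  suffices ∃ κ : ℝ, 0 ≤ κ ∧ ∀ f g : ℕ → 𝕜, Tendsto f atTop (𝓝 0) → Tendsto g atTop (𝓝 0) →
      lorentzENorm w q (f + g) ≤
        ENNReal.ofReal κ * (lorentzENorm w q f + lorentzENorm w q g) by
    obtain ⟨κ, -, h⟩ := this
    refine ⟨max 1 κ, le_max_left _ _, fun f g hf hg => (h f g hf hg).trans ?_⟩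
    gcongr
    exact le_max_right _ _
  by_cases hq' : q = ∞
  · subst hq'
    refine ⟨C, hC0, fun f g hf hg => ?_⟩
    rw [lorentzENorm_top, lorentzENorm_top, lorentzENorm_top]
    refine iSup_le fun n => ?_
    have hs := hC (n + 1) (by omega)
    have hidx : (n + 1 + 1) / 2 = n / 2 + 1 := by omega
    rw [hidx] at hs
    have h1 := rearrangement_add_le_half hf hg n
    have hf0 := rearrangement_nonneg f (n / 2)
    have hg0 := rearrangement_nonneg g (n / 2)
    have hp := primitiveWeight_pos hw (n / 2)
    calc ENNReal.ofReal (rearrangement (f + g) n * primitiveWeight w (n + 1))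
        ≤ ENNReal.ofReal (C * (rearrangement f (n / 2) * primitiveWeight w (n / 2 + 1) +
            rearrangement g (n / 2) * primitiveWeight w (n / 2 + 1))) := by
          apply ENNReal.ofReal_le_ofReal
          have := mul_le_mul h1 hs (primitiveWeight_pos hw n).le (add_nonneg hf0 hg0)
          linarith
      _ = ENNReal.ofReal C *
          (ENNReal.ofReal (rearrangement f (n / 2) * primitiveWeight w (n / 2 + 1)) +
            ENNReal.ofReal (rearrangement g (n / 2) * primitiveWeight w (n / 2 + 1))) := by
          rw [ENNReal.ofReal_mul hC0, ENNReal.ofReal_add (by positivity) (by positivity)]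
      _ ≤ _ := by
          gcongr
          · exact le_iSup (fun n => ENNReal.ofReal
              (rearrangement f n * primitiveWeight w (n + 1))) (n / 2)
          · exact le_iSup (fun n => ENNReal.ofReal
              (rearrangement g n * primitiveWeight w (n + 1))) (n / 2)
  · have hr : 0 < q.toReal := ENNReal.toReal_pos hq.ne' hq'
    set r := q.toReal with hr_def
    set D : ℝ := max 1 r / min 1 r * C ^ r with hD
    have hD0 : 0 ≤ D := by positivity
    -- The factor `2 ^ r` comes from `(A + B)^r ≤ 2^r (A^r + B^r)`, `D` from halving the index, and
    -- the last `2` from `X^r + Y^r ≤ 2 (X + Y)^r`.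
    refine ⟨(2 ^ r * D * 2) ^ (1 / r), by positivity, fun f g hf hg => ?_⟩
    rw [← ENNReal.rpow_le_rpow_iff hr, ENNReal.mul_rpow_of_nonneg _ _ hr.le,
      ENNReal.ofReal_rpow_of_nonneg (by positivity) hr.le, ← Real.rpow_mul (by positivity),
      one_div_mul_cancel hr.ne', Real.rpow_one]
    have key : lorentzENorm w q (f + g) ^ r ≤ ENNReal.ofReal (2 ^ r * D) *
        (lorentzENorm w q f ^ r + lorentzENorm w q g ^ r) := by
      rw [hr_def, lorentzENorm_rpow hw hq hq', lorentzENorm_rpow hw hq hq',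
        lorentzENorm_rpow hw hq hq', ← hr_def]
      rw [ENNReal.ofReal_mul (by positivity), mul_assoc, mul_add]
      refine le_trans ?_ (mul_le_mul_right (add_le_add
        (tsum_rearrangement_half_le hw hC0 hC hr hf)
        (tsum_rearrangement_half_le hw hC0 hC hr hg)) _)
      rw [← ENNReal.tsum_add, ← ENNReal.tsum_mul_left]
      refine ENNReal.tsum_le_tsum fun n => ?_
      have hf0 := rearrangement_nonneg f (n / 2)
      have hg0 := rearrangement_nonneg g (n / 2)
      have hvn := lorentzWeight_nonneg hw r n
      rw [← ENNReal.ofReal_add (by positivity) (by positivity),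
        ← ENNReal.ofReal_mul (by positivity)]
      apply ENNReal.ofReal_le_ofReal
      rw [← add_mul, ← mul_assoc (2 ^ r)]
      refine mul_le_mul_of_nonneg_right ?_ hvn
      set A := rearrangement f (n / 2)
      set B := rearrangement g (n / 2)
      calc rearrangement (f + g) n ^ r ≤ (2 * max A B) ^ r := by
            refine Real.rpow_le_rpow (rearrangement_nonneg _ _) ?_ hr.le
            have := rearrangement_add_le_half hf hg n
            linarith [le_max_left A B, le_max_right A B]
        _ = 2 ^ r * max A B ^ r := Real.mul_rpow (by norm_num) (le_max_of_le_left hf0)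
        _ ≤ 2 ^ r * (A ^ r + B ^ r) := by
            gcongr
            rcases max_choice A B with h | h <;> rw [h]
            · linarith [Real.rpow_nonneg hg0 r]
            · linarith [Real.rpow_nonneg hf0 r]
    refine key.trans ?_
    rw [ENNReal.ofReal_mul (p := 2 ^ r * D) (by positivity), mul_assoc]
    gcongr
    rw [show ENNReal.ofReal 2 = 2 by simp, two_mul]
    gcongr
    · exact le_self_add
    · exact le_add_self

/-! ### Comparison with the weak quasi-norm, and flat vectors -/

theorem sum_lorentzWeight_ge (hw : IsWeight w) {r : ℝ} (hr : 0 < r) (n : ℕ) :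
    primitiveWeight w n ^ r ≤ max 1 r * ∑ k ∈ Finset.range n, lorentzWeight w r k :=
  (lorentzWeight_comparable hw hr n).2

theorem sum_lorentzWeight_le (hw : IsWeight w) {r : ℝ} (hr : 0 < r) (n : ℕ) :
    ∑ k ∈ Finset.range n, lorentzWeight w r k ≤ (min 1 r)⁻¹ * primitiveWeight w n ^ r := by
  rw [inv_mul_eq_div, le_div_iff₀' (lt_min one_pos hr)]
  exact (lorentzWeight_comparable hw hr n).1

variable (𝕜) in
-- This is the embedding of `d_{1,q}(w)` in the weak space: the first `n + 1` rearranged terms are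
-- at least the last of them, and their weights add up to a multiple of `s ^ r` at `n + 1`.
theorem rearrangement_mul_primitiveWeight_le (hw : IsWeight w) (hq : 0 < q) :
    ∃ K : ℝ, 0 < K ∧ ∀ f : ℕ → 𝕜, Tendsto f atTop (𝓝 0) → ∀ n,
      ENNReal.ofReal (rearrangement f n * primitiveWeight w (n + 1)) ≤
        ENNReal.ofReal K * lorentzENorm w q f := by
  by_cases hq' : q = ∞
  · subst hq'
    refine ⟨1, one_pos, fun f _ n => ?_⟩
    rw [lorentzENorm_top, ENNReal.ofReal_one, one_mul]
    exact le_iSup (fun n => ENNReal.ofReal (rearrangement f n * primitiveWeight w (n + 1))) n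
  · have hr : 0 < q.toReal := ENNReal.toReal_pos hq.ne' hq'
    set r := q.toReal with hr_def
    have hmax : 0 < max 1 r := lt_max_of_lt_left one_pos
    refine ⟨(max 1 r) ^ (1 / r), by positivity, fun f hf n => ?_⟩
    have hf0 := rearrangement_nonneg f n
    have hs := primitiveWeight_pos hw n
    rw [← ENNReal.rpow_le_rpow_iff hr, ENNReal.mul_rpow_of_nonneg _ _ hr.le,
      ENNReal.ofReal_rpow_of_nonneg (by positivity) hr.le,
      ENNReal.ofReal_rpow_of_nonneg (by positivity) hr.le, ← Real.rpow_mul (by positivity),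
      one_div_mul_cancel hr.ne', Real.rpow_one, lorentzENorm_rpow hw hq hq', ← hr_def]
    have h0 : ∀ k, 0 ≤ rearrangement f k ^ r * lorentzWeight w r k := fun k =>
      mul_nonneg (Real.rpow_nonneg (rearrangement_nonneg f k) r) (lorentzWeight_nonneg hw r k)
    refine le_trans ?_ (mul_le_mul_right (ENNReal.sum_le_tsum (Finset.range (n + 1))) _)
    rw [← ENNReal.ofReal_sum_of_nonneg fun k _ => h0 k, ← ENNReal.ofReal_mul hmax.le]
    apply ENNReal.ofReal_le_ofReal
    rw [Real.mul_rpow hf0 hs.le]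
    calc rearrangement f n ^ r * primitiveWeight w (n + 1) ^ r
        ≤ rearrangement f n ^ r * (max 1 r * ∑ k ∈ Finset.range (n + 1), lorentzWeight w r k) := by
          gcongr
          exact sum_lorentzWeight_ge hw hr _
      _ = max 1 r * ∑ k ∈ Finset.range (n + 1), rearrangement f n ^ r * lorentzWeight w r k := by
          rw [Finset.mul_sum, Finset.mul_sum, Finset.mul_sum]
          exact Finset.sum_congr rfl fun k _ => by ring
      _ ≤ _ := by
          gcongr with k hk
          · exact lorentzWeight_nonneg hw r k
          · exact rearrangement_antitone hf (Nat.lt_succ_iff.1 (Finset.mem_range.1 hk))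

theorem ofReal_mul_norm_le_lorentzENorm (hw : IsWeight w) (hq : 0 < q) {f : ℕ → 𝕜}
    (hf : Tendsto f atTop (𝓝 0)) (k : ℕ) :
    ENNReal.ofReal (w 0 * ‖f k‖) ≤ lorentzENorm w q f := by
  have hk := norm_le_rearrangement_zero hf k
  have hw0 := hw.2
  have hs : primitiveWeight w 1 = w 0 := by simp [primitiveWeight]
  by_cases hq' : q = ∞
  · subst hq'
    rw [lorentzENorm_top]
    refine le_trans ?_ (le_iSup _ 0)
    apply ENNReal.ofReal_le_ofReal
    rw [zero_add, hs, mul_comm]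
    gcongr
  · have hr : 0 < q.toReal := ENNReal.toReal_pos hq.ne' hq'
    rw [← ENNReal.rpow_le_rpow_iff hr, lorentzENorm_rpow hw hq hq',
      ENNReal.ofReal_rpow_of_nonneg (by positivity) hr.le]
    refine le_trans ?_ (ENNReal.le_tsum 0)
    apply ENNReal.ofReal_le_ofReal
    rw [lorentzWeight, zero_add, hs, div_self hw0.ne', mul_one, mul_comm (w 0),
      Real.mul_rpow (norm_nonneg _) hw0.le]
    gcongr

theorem lorentzENorm_single (hw : IsWeight w) (hq : 0 < q) (n : ℕ) :
    lorentzENorm w q (Pi.single n 1 : ℕ → 𝕜) = ENNReal.ofReal (w 0) := by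
  have hfin : Tendsto (Pi.single n 1 : ℕ → 𝕜) atTop (𝓝 0) := by
    refine tendsto_const_nhds.congr' ?_
    filter_upwards [eventually_gt_atTop n] with k hk
    rw [Pi.single_eq_of_ne hk.ne']
  have hn : ∀ k, ‖(Pi.single n 1 : ℕ → 𝕜) k‖ ≤ 1 := fun k => by
    rcases eq_or_ne k n with rfl | h
    · simp
    · simp [Pi.single_eq_of_ne h]
  have h0 : ∀ j, j ≠ 0 → rearrangement (Pi.single n 1 : ℕ → 𝕜) j = 0 := fun j hj =>
    rearrangement_eq_zero (s := {n}) (fun k hk => Pi.single_eq_of_ne (by simpa using hk) _)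
      (by rw [Finset.card_singleton]; omega)
  have h1 := rearrangement_le_of_norm_le zero_le_one hn 0
  have hs : primitiveWeight w 1 = w 0 := by simp [primitiveWeight]
  refine le_antisymm ?_ (by simpa using ofReal_mul_norm_le_lorentzENorm hw hq hfin n)
  by_cases hq' : q = ∞
  · subst hq'
    rw [lorentzENorm_top]
    refine iSup_le fun j => ?_
    rcases eq_or_ne j 0 with rfl | hj
    · rw [zero_add, hs]
      exact ENNReal.ofReal_le_ofReal (mul_le_of_le_one_left hw.2.le h1)
    · simp [h0 j hj]
  · have hr : 0 < q.toReal := ENNReal.toReal_pos hq.ne' hq'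
    rw [← ENNReal.rpow_le_rpow_iff hr, lorentzENorm_rpow hw hq hq',
      ENNReal.ofReal_rpow_of_nonneg hw.2.le hr.le, tsum_eq_single 0 fun j hj => by
        simp [h0 j hj, Real.zero_rpow hr.ne']]
    apply ENNReal.ofReal_le_ofReal
    rw [lorentzWeight, zero_add, hs, div_self hw.2.ne', mul_one]
    exact mul_le_of_le_one_left (Real.rpow_nonneg hw.2.le _)
      (Real.rpow_le_one (rearrangement_nonneg _ _) h1 hr.le)

variable (𝕜) in
-- Only `s.card` rearranged terms can be non-zero, and each is at most `v`. With the weak-type bound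
-- this says that a vector of modulus about `v` on `s` has quasi-norm about `v * primitiveWeight w
-- s.card`.
theorem lorentzENorm_le_of_norm_le (hw : IsWeight w) (hq : 0 < q) :
    ∃ K : ℝ, 0 < K ∧ ∀ (f : ℕ → 𝕜) (s : Finset ℕ) (v : ℝ), 0 ≤ v → (∀ k, ‖f k‖ ≤ v) →
      (∀ k ∉ s, f k = 0) →
      lorentzENorm w q f ≤ ENNReal.ofReal (K * (v * primitiveWeight w s.card)) := by
  by_cases hq' : q = ∞
  · subst hq'
    refine ⟨1, one_pos, fun f s v hv hfv hfs => ?_⟩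
    rw [lorentzENorm_top, one_mul]
    refine iSup_le fun n => ENNReal.ofReal_le_ofReal ?_
    rcases lt_or_ge n s.card with hn | hn
    · exact mul_le_mul (rearrangement_le_of_norm_le hv hfv n) (primitiveWeight_mono hw hn)
        (primitiveWeight_nonneg hw _) hv
    · rw [rearrangement_eq_zero hfs hn, zero_mul]
      exact mul_nonneg hv (primitiveWeight_nonneg hw _)
  · have hr : 0 < q.toReal := ENNReal.toReal_pos hq.ne' hq'
    set r := q.toReal with hr_def
    have hmin : 0 < min 1 r := lt_min one_pos hr
    refine ⟨((min 1 r)⁻¹) ^ (1 / r), by positivity, fun f s v hv hfv hfs => ?_⟩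
    have hs0 := primitiveWeight_nonneg hw s.card
    rw [← ENNReal.rpow_le_rpow_iff hr, ENNReal.ofReal_rpow_of_nonneg (by positivity) hr.le,
      Real.mul_rpow (by positivity) (by positivity), ← Real.rpow_mul (by positivity),
      one_div_mul_cancel hr.ne', Real.rpow_one, lorentzENorm_rpow hw hq hq', ← hr_def,
      tsum_eq_sum (s := Finset.range s.card) fun n hn => by
        rw [rearrangement_eq_zero hfs (by simpa using hn), Real.zero_rpow hr.ne']; simp,
      ← ENNReal.ofReal_sum_of_nonneg fun k _ => mul_nonneg
        (Real.rpow_nonneg (rearrangement_nonneg f k) r) (lorentzWeight_nonneg hw r k)]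
    apply ENNReal.ofReal_le_ofReal
    calc ∑ n ∈ Finset.range s.card, rearrangement f n ^ r * lorentzWeight w r n
        ≤ ∑ n ∈ Finset.range s.card, v ^ r * lorentzWeight w r n := by
          gcongr with n
          · exact lorentzWeight_nonneg hw r n
          · exact rearrangement_nonneg f n
          · exact rearrangement_le_of_norm_le hv hfv n
      _ = v ^ r * ∑ n ∈ Finset.range s.card, lorentzWeight w r n := by rw [Finset.mul_sum]
      _ ≤ v ^ r * ((min 1 r)⁻¹ * primitiveWeight w s.card ^ r) := by
          gcongr
          exact sum_lorentzWeight_le hw hr _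
      _ = _ := by rw [Real.mul_rpow hv hs0]; ring

/-- The Fatou property of the Lorentz quasi-norm. -/
theorem lorentzENorm_le_of_uniform_limit (hw : IsWeight w) (hq : 0 < q) {g : ℕ → 𝕜} {M : ℝ≥0∞}
    (h : ∀ ε : ℝ, 0 < ε → ∃ f : ℕ → 𝕜, Tendsto f atTop (𝓝 0) ∧ lorentzENorm w q f ≤ M ∧
      ∀ k, ‖g k‖ ≤ ‖f k‖ + ε) :
    lorentzENorm w q g ≤ M := by
  -- Truncating `a - ε` at zero keeps the base of the power non-negative, so that it can be compared
  -- with the rearrangement of the approximant before `ε` tends to `0`.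
  have hlim : ∀ n, Tendsto (fun ε : ℝ => max (rearrangement g n - ε) 0) (𝓝[>] 0)
      (𝓝 (rearrangement g n)) := fun n => by
    have : ContinuousAt (fun ε : ℝ => max (rearrangement g n - ε) 0) 0 := by fun_prop
    have h2 := this.tendsto.mono_left (nhdsWithin_le_nhds (s := Set.Ioi 0))
    simpa [max_eq_left (rearrangement_nonneg g n)] using h2
  by_cases hq' : q = ∞
  · subst hq'
    rw [lorentzENorm_top]
    refine iSup_le fun n => ?_
    have ht := ENNReal.tendsto_ofReal ((hlim n).mul_const (primitiveWeight w (n + 1)))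
    refine le_of_tendsto ht ?_
    filter_upwards [self_mem_nhdsWithin] with ε hε
    obtain ⟨f, hf, hfM, hfg⟩ := h ε hε
    refine le_trans ?_ hfM
    rw [lorentzENorm_top]
    refine le_trans (ENNReal.ofReal_le_ofReal ?_) (le_iSup (fun n => ENNReal.ofReal
      (rearrangement f n * primitiveWeight w (n + 1))) n)
    gcongr
    · exact (primitiveWeight_pos hw n).le
    · refine max_le ?_ (rearrangement_nonneg f n)
      linarith [rearrangement_le_of_norm_le_add hf (le_of_lt hε) hfg n]
  · have hr : 0 < q.toReal := ENNReal.toReal_pos hq.ne' hq'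
    rw [← ENNReal.rpow_le_rpow_iff hr, lorentzENorm_rpow hw hq hq']
    refine ENNReal.tsum_le_of_sum_range_le fun N => ?_
    have ht : Tendsto (fun ε : ℝ => ∑ n ∈ Finset.range N, ENNReal.ofReal
        (max (rearrangement g n - ε) 0 ^ q.toReal * lorentzWeight w q.toReal n)) (𝓝[>] 0)
        (𝓝 (∑ n ∈ Finset.range N, ENNReal.ofReal
          (rearrangement g n ^ q.toReal * lorentzWeight w q.toReal n))) :=
      tendsto_finsetSum _ fun n _ => ENNReal.tendsto_ofReal
        (((hlim n).rpow_const (Or.inr hr.le)).mul_const _)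
    refine le_of_tendsto ht ?_
    filter_upwards [self_mem_nhdsWithin] with ε hε
    obtain ⟨f, hf, hfM, hfg⟩ := h ε hε
    refine le_trans ?_ (ENNReal.rpow_le_rpow hfM hr.le)
    rw [lorentzENorm_rpow hw hq hq']
    refine le_trans (Finset.sum_le_sum fun n _ => ENNReal.ofReal_le_ofReal ?_)
      (ENNReal.sum_le_tsum (Finset.range N))
    gcongr
    · exact lorentzWeight_nonneg hw _ n
    · refine max_le ?_ (rearrangement_nonneg f n)
      linarith [rearrangement_le_of_norm_le_add hf (le_of_lt hε) hfg n]

/-- Since `f` is a null sequence, every rearranged term of its tails tends to `0`, and all of them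
are dominated by the rearrangement of `f`. Dominated convergence for series applies because `q` is
finite. -/
theorem tendsto_lorentzENorm_tail (hw : IsWeight w) (hq : 0 < q) (hq' : q ≠ ∞) {f : ℕ → 𝕜}
    (hf : Tendsto f atTop (𝓝 0)) (hf' : lorentzENorm w q f < ∞) :
    Tendsto (fun s : Finset ℕ => lorentzENorm w q ((s : Set ℕ)ᶜ.indicator f)) atTop (𝓝 0) := by
  have hr : 0 < q.toReal := ENNReal.toReal_pos hq.ne' hq'
  set r := q.toReal with hr_def
  have h0 : ∀ (g : ℕ → 𝕜) n, 0 ≤ rearrangement g n ^ r * lorentzWeight w r n := fun g n =>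
    mul_nonneg (Real.rpow_nonneg (rearrangement_nonneg g n) r) (lorentzWeight_nonneg hw r n)
  have hle : ∀ (s : Finset ℕ) k, ‖(s : Set ℕ)ᶜ.indicator f k‖ ≤ ‖f k‖ := fun s k =>
    norm_indicator_le_norm_self f k
  have hlt : ∑' n, ENNReal.ofReal (rearrangement f n ^ r * lorentzWeight w r n) < ∞ := by
    rw [hr_def, ← lorentzENorm_rpow hw hq hq']
    exact ENNReal.rpow_lt_top_of_nonneg hr.le hf'.ne
  have hsum : Summable fun n => rearrangement f n ^ r * lorentzWeight w r n := by
    have := ENNReal.summable_toReal hlt.ne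
    simpa only [ENNReal.toReal_ofReal (h0 f _)] using this
  have hsumt : ∀ s : Finset ℕ, Summable fun n =>
      rearrangement ((s : Set ℕ)ᶜ.indicator f) n ^ r * lorentzWeight w r n := fun s =>
    hsum.of_nonneg_of_le (h0 _) fun n => by
      gcongr
      · exact lorentzWeight_nonneg hw r n
      · exact rearrangement_nonneg _ n
      · exact rearrangement_mono hf (hle s) n
  have hre : ∀ n, Tendsto (fun s : Finset ℕ => rearrangement ((s : Set ℕ)ᶜ.indicator f) n) atTop
      (𝓝 0) := fun n => by
    refine Metric.tendsto_atTop.2 fun ε hε => ?_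
    obtain ⟨N, hN⟩ := Metric.tendsto_atTop.1 hf (ε / 2) (by positivity)
    refine ⟨Finset.range N, fun s hs => ?_⟩
    rw [dist_zero_right, Real.norm_of_nonneg (rearrangement_nonneg _ _)]
    refine (rearrangement_le_of_norm_le (B := ε / 2) (by positivity) (fun k => ?_) n).trans_lt
      (by linarith)
    by_cases hk : k ∈ s
    · rw [Set.indicator_of_notMem (by simpa using hk), norm_zero]
      positivity
    · have hkN : N ≤ k := by
        by_contra hcon
        exact hk (hs (Finset.mem_range.2 (not_le.1 hcon)))
      have := hN k hkN
      rw [dist_zero_right] at this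
      exact (hle s k).trans this.le
  have hdom : Tendsto (fun s : Finset ℕ => ∑' n,
      rearrangement ((s : Set ℕ)ᶜ.indicator f) n ^ r * lorentzWeight w r n) atTop
      (𝓝 (∑' _ : ℕ, 0)) := by
    refine tendsto_tsum_of_dominated_convergence hsum (fun n => ?_)
      (Eventually.of_forall fun s n => ?_)
    · have := ((hre n).rpow_const (Or.inr hr.le)).mul_const (lorentzWeight w r n)
      rwa [Real.zero_rpow hr.ne', zero_mul] at this
    · rw [Real.norm_of_nonneg (h0 _ n)]
      gcongr
      · exact lorentzWeight_nonneg hw r n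
      · exact rearrangement_nonneg _ n
      · exact rearrangement_mono hf (hle s) n
  rw [tsum_zero] at hdom
  have h2 := (ENNReal.tendsto_ofReal hdom).ennrpow_const (1 / r)
  rw [ENNReal.ofReal_zero, ENNReal.zero_rpow_of_pos (by positivity)] at h2
  refine h2.congr fun s => ?_
  rw [lorentzENorm_of_ne_top hw hq', ENNReal.ofReal_tsum_of_nonneg (h0 _) (hsumt s)]

end LorentzENorm

/-! ### The Lorentz space as a quasi-Banach lattice -/

section QuasiBanachBasis

variable {𝕜 : Type*} [RCLike 𝕜] {E : Type*} [AddCommGroup E] [Module 𝕜 E] {ι : Type*}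

/-- The closed linear span is closed. -/
theorem mem_closedSpan_of_approx {N : E → ℝ} {x : ι → E} {f : E}
    (h : ∀ ε > 0, ∃ g ∈ closedSpan 𝕜 N x, N (f - g) < ε) : f ∈ closedSpan 𝕜 N x := by
  refine Submodule.mem_sInf.2 fun S hS => hS.2 f fun ε hε => ?_
  obtain ⟨g, hg, hfg⟩ := h ε hε
  exact ⟨g, Submodule.mem_sInf.1 hg S hS, hfg⟩

theorem closedSpan_le {N : E → ℝ} {x : ι → E} {S : Submodule 𝕜 E} (hx : ∀ n, x n ∈ S)
    (hS : ∀ f, (∀ ε > 0, ∃ g ∈ S, N (f - g) < ε) → f ∈ S) : closedSpan 𝕜 N x ≤ S :=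
  sInf_le ⟨Set.range_subset_iff.2 hx, hS⟩

theorem HasUncondSum.mem_closedSpan {N : E → ℝ} {x : ι → E} {a : ι → 𝕜} {f : E}
    (h : HasUncondSum N x a f) : f ∈ closedSpan 𝕜 N x :=
  mem_closedSpan_of_approx fun ε hε => by
    obtain ⟨s, hs⟩ := (h.eventually_lt_const hε).exists
    exact ⟨_, Submodule.sum_mem _ fun n _ => Submodule.smul_mem _ _ (_root_.mem_closedSpan N x n),
      hs⟩

/-- A family with unique expansions of all vectors is an unconditional basis. -/
theorem isUncondBasis_of_expansion [Countable ι] {N : E → ℝ} (hN : IsQuasiBanach 𝕜 N) {x : ι → E}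
    {a : E → ι → 𝕜} (h1 : ∀ f, HasUncondSum N x (a f) f)
    (h2 : ∀ f b, HasUncondSum N x b f → b = a f) : IsUncondBasis 𝕜 N x :=
  ⟨inferInstance, hN, fun f _ => ⟨a f, h1 f, h2 f⟩,
    eq_top_iff.2 fun f _ => (h1 f).mem_closedSpan⟩

theorem coeffTransform_eq_of_expansion {N : E → ℝ} {x : ι → E} {a : E → ι → 𝕜}
    (h1 : ∀ f, HasUncondSum N x (a f) f) (h2 : ∀ f b, HasUncondSum N x b f → b = a f) (f : E) :
    coeffTransform 𝕜 N x f = a f := by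
  have h : ∃ b : ι → 𝕜, HasUncondSum N x b f := ⟨a f, h1 f⟩
  rw [coeffTransform, dif_pos h]
  exact h2 f _ h.choose_spec

end QuasiBanachBasis

section LorentzSpace

variable {𝕜 : Type*} [RCLike 𝕜] {w : ℕ → ℝ} {hw : IsWeight w} {hd : IsDoubling w} {q : ℝ≥0∞}
  {hq : 0 < q}

theorem ofReal_lorentzNorm (f : lorentzSpace 𝕜 w hw hd q hq) :
    ENNReal.ofReal (lorentzNorm f) = lorentzENorm w q (f : ℕ → 𝕜) :=
  ENNReal.ofReal_toReal f.2.2.ne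

theorem lorentzSpace_sub_apply (f g : lorentzSpace 𝕜 w hw hd q hq) (k : ℕ) :
    ((f - g : lorentzSpace 𝕜 w hw hd q hq) : ℕ → 𝕜) k = (f : ℕ → 𝕜) k - (g : ℕ → 𝕜) k := by
  rw [Submodule.coe_sub, Pi.sub_apply]

theorem lorentzNorm_nonneg (f : lorentzSpace 𝕜 w hw hd q hq) : 0 ≤ lorentzNorm f :=
  ENNReal.toReal_nonneg

theorem lorentzENorm_le_iff (f : lorentzSpace 𝕜 w hw hd q hq) {B : ℝ} (hB : 0 ≤ B) :
    lorentzENorm w q (f : ℕ → 𝕜) ≤ ENNReal.ofReal B ↔ lorentzNorm f ≤ B := by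
  rw [← ofReal_lorentzNorm, ENNReal.ofReal_le_ofReal_iff hB]

theorem lorentzNorm_mono {f g : lorentzSpace 𝕜 w hw hd q hq}
    (h : ∀ k, ‖(f : ℕ → 𝕜) k‖ ≤ ‖(g : ℕ → 𝕜) k‖) : lorentzNorm f ≤ lorentzNorm g :=
  ENNReal.toReal_mono g.2.2.ne (lorentzENorm_mono hw g.2.1 h)

theorem lorentzNorm_smul (c : 𝕜) (f : lorentzSpace 𝕜 w hw hd q hq) :
    lorentzNorm (c • f) = ‖c‖ * lorentzNorm f := by
  rw [lorentzNorm, lorentzNorm, Submodule.coe_smul, lorentzENorm_smul hw hq f.2.1,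
    ENNReal.toReal_mul, ENNReal.toReal_ofReal (norm_nonneg c)]

theorem lorentzNorm_mono_mul {f g : lorentzSpace 𝕜 w hw hd q hq} {c : ℝ} (hc : 0 ≤ c)
    (h : ∀ k, ‖(f : ℕ → 𝕜) k‖ ≤ c * ‖(g : ℕ → 𝕜) k‖) : lorentzNorm f ≤ c * lorentzNorm g := by
  have : ‖(c : 𝕜)‖ = c := by rw [RCLike.norm_ofReal, abs_of_nonneg hc]
  rw [← this, ← lorentzNorm_smul]
  refine lorentzNorm_mono fun k => ?_
  rw [Submodule.coe_smul, Pi.smul_apply, norm_smul, this]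
  exact h k

theorem mul_norm_le_lorentzNorm (f : lorentzSpace 𝕜 w hw hd q hq) (k : ℕ) :
    w 0 * ‖(f : ℕ → 𝕜) k‖ ≤ lorentzNorm f := by
  rw [← ENNReal.ofReal_le_ofReal_iff (lorentzNorm_nonneg f), ofReal_lorentzNorm]
  exact ofReal_mul_norm_le_lorentzENorm hw hq f.2.1 k

theorem norm_apply_le (f : lorentzSpace 𝕜 w hw hd q hq) (k : ℕ) :
    ‖(f : ℕ → 𝕜) k‖ ≤ (w 0)⁻¹ * lorentzNorm f := by
  rw [inv_mul_eq_div, le_div_iff₀' hw.2]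
  exact mul_norm_le_lorentzNorm f k

variable (𝕜 hw hd hq) in
theorem lorentzNorm_add_le : ∃ κ : ℝ, 1 ≤ κ ∧ ∀ f g : lorentzSpace 𝕜 w hw hd q hq,
    lorentzNorm (f + g) ≤ κ * (lorentzNorm f + lorentzNorm g) := by
  obtain ⟨κ, hκ, h⟩ := lorentzENorm_add_le 𝕜 hw hd hq
  refine ⟨κ, hκ, fun f g => ?_⟩
  have hf := lorentzNorm_nonneg f
  have hg := lorentzNorm_nonneg g
  rw [← lorentzENorm_le_iff _ (by positivity), ENNReal.ofReal_mul (by positivity),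
    ENNReal.ofReal_add hf hg, ofReal_lorentzNorm, ofReal_lorentzNorm]
  exact h f g f.2.1 g.2.1

theorem lorentzNorm_zero : lorentzNorm (0 : lorentzSpace 𝕜 w hw hd q hq) = 0 := by
  simpa using lorentzNorm_smul (0 : 𝕜) (0 : lorentzSpace 𝕜 w hw hd q hq)

theorem lorentzNorm_neg (f : lorentzSpace 𝕜 w hw hd q hq) :
    lorentzNorm (-f) = lorentzNorm f := by
  have h := lorentzNorm_smul (-1 : 𝕜) f
  rwa [show (-1 : 𝕜) • f = -f by module, norm_neg, norm_one, one_mul] at h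

theorem lorentzNorm_sub_comm (f g : lorentzSpace 𝕜 w hw hd q hq) :
    lorentzNorm (f - g) = lorentzNorm (g - f) := by
  rw [← neg_sub, lorentzNorm_neg]

/-- A sequence dominated by an element of the Lorentz space belongs to it. -/
theorem mem_lorentzSpace_of_norm_le {g : ℕ → 𝕜} (f : lorentzSpace 𝕜 w hw hd q hq) {c : ℝ}
    (h : ∀ k, ‖g k‖ ≤ c * ‖(f : ℕ → 𝕜) k‖) : g ∈ lorentzSpace 𝕜 w hw hd q hq := by
  have hg : ∀ k, ‖g k‖ ≤ ‖((c : 𝕜) • f : lorentzSpace 𝕜 w hw hd q hq).1 k‖ := fun k => by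
    rw [Submodule.coe_smul, Pi.smul_apply, norm_smul, RCLike.norm_ofReal]
    exact (h k).trans (mul_le_mul_of_nonneg_right (le_abs_self c) (norm_nonneg _))
  refine ⟨squeeze_zero_norm hg ?_, (lorentzENorm_mono hw ((c : 𝕜) • f).2.1 hg).trans_lt
    ((c : 𝕜) • f).2.2⟩
  simpa using ((c : 𝕜) • f).2.1.norm

theorem mem_lorentzSpace_of_finite {g : ℕ → 𝕜} (s : Finset ℕ) (h : ∀ k ∉ s, g k = 0) :
    g ∈ lorentzSpace 𝕜 w hw hd q hq := by
  refine ⟨tendsto_const_nhds.congr' ?_, lorentzENorm_finite_support_lt_top w hq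
    (s.finite_toSet.subset fun k hk => by_contra fun hks => hk (h k hks))⟩
  obtain ⟨B, hB⟩ := s.bddAbove
  filter_upwards [eventually_gt_atTop B] with k hk
  exact (h k fun hks => absurd (hB hks) (not_le.2 hk)).symm

/-- The quasi-norm dominates `w 0` times the supremum norm, so a Cauchy sequence converges
uniformly. The Fatou property turns the uniform limit into a limit in quasi-norm. -/
theorem lorentzSpace_complete (u : ℕ → lorentzSpace 𝕜 w hw hd q hq)
    (hu : ∀ ε > 0, ∃ n₀, ∀ m ≥ n₀, ∀ n ≥ n₀, lorentzNorm (u m - u n) < ε) :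
    ∃ f, Tendsto (fun n => lorentzNorm (u n - f)) atTop (𝓝 0) := by
  have hw0 := hw.2
  have hunif : ∀ ε > 0, ∃ n₀, ∀ m ≥ n₀, ∀ n ≥ n₀, ∀ k,
      ‖(u m : ℕ → 𝕜) k - (u n : ℕ → 𝕜) k‖ < ε := fun ε hε => by
    obtain ⟨n₀, h⟩ := hu (w 0 * ε) (by positivity)
    refine ⟨n₀, fun m hm n hn k => ?_⟩
    have := (mul_norm_le_lorentzNorm (u m - u n) k).trans_lt (h m hm n hn)
    rw [lorentzSpace_sub_apply] at this
    exact lt_of_mul_lt_mul_left this hw0.le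
  have hcau : ∀ k, CauchySeq fun n => (u n : ℕ → 𝕜) k := fun k =>
    Metric.cauchySeq_iff.2 fun ε hε => by
      obtain ⟨n₀, h⟩ := hunif ε hε
      exact ⟨n₀, fun m hm n hn => by rw [dist_eq_norm]; exact h m hm n hn k⟩
  have hex : ∀ k, ∃ z : 𝕜, Tendsto (fun n => (u n : ℕ → 𝕜) k) atTop (𝓝 z) := fun k =>
    cauchySeq_tendsto_of_complete (hcau k)
  choose f hf using hex
  have hclose : ∀ ε > 0, ∃ n₀, ∀ m ≥ n₀, ∀ k, ‖(u m : ℕ → 𝕜) k - f k‖ ≤ ε := fun ε hε => by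
    obtain ⟨n₀, h⟩ := hunif ε hε
    refine ⟨n₀, fun m hm k => le_of_tendsto ((tendsto_const_nhds.sub (hf k)).norm) ?_⟩
    filter_upwards [eventually_ge_atTop n₀] with n hn
    exact (h m hm n hn k).le
  -- For fixed `m` the vectors `u m - u n`, with `n` large, have quasi-norm below `ε` and
  -- approximate `u m - f` uniformly.
  have hnorm : ∀ ε > 0, ∃ n₀, ∀ m ≥ n₀,
      lorentzENorm w q ((u m : ℕ → 𝕜) - f) ≤ ENNReal.ofReal ε := fun ε hε => by
    obtain ⟨n₀, h⟩ := hu ε hε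
    refine ⟨n₀, fun m hm => lorentzENorm_le_of_uniform_limit hw hq fun δ hδ => ?_⟩
    obtain ⟨n₁, h₁⟩ := hclose δ hδ
    refine ⟨u m - u (max n₀ n₁), (u m - u (max n₀ n₁)).2.1, ?_, fun k => ?_⟩
    · rw [← Submodule.coe_sub, lorentzENorm_le_iff _ hε.le]
      exact (h m hm (max n₀ n₁) (le_max_left _ _)).le
    · have := h₁ (max n₀ n₁) (le_max_right _ _) k
      have h3 := norm_sub_le_norm_sub_add_norm_sub ((u m : ℕ → 𝕜) k)
        ((u (max n₀ n₁) : ℕ → 𝕜) k) (f k)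
      rw [Pi.sub_apply, Pi.sub_apply]
      linarith
  have hf0 : Tendsto f atTop (𝓝 0) := by
    refine Metric.tendsto_atTop.2 fun ε hε => ?_
    obtain ⟨n₀, h⟩ := hclose (ε / 2) (by positivity)
    obtain ⟨K, hK⟩ := Metric.tendsto_atTop.1 (u n₀).2.1 (ε / 2) (by positivity)
    refine ⟨K, fun k hk => ?_⟩
    have h1 := h n₀ le_rfl k
    have h2 := hK k hk
    rw [dist_zero_right] at h2 ⊢
    have h3 := norm_sub_norm_le (f k) ((u n₀ : ℕ → 𝕜) k)
    rw [norm_sub_rev] at h3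
    linarith
  obtain ⟨n₁, hn₁⟩ := hnorm 1 one_pos
  -- The limit is shown to lie in the space as a difference of two members, `u n₁` and `u n₁ - f`.
  have hdiff : (u n₁ : ℕ → 𝕜) - f ∈ lorentzSpace 𝕜 w hw hd q hq :=
    ⟨by have := (u n₁).2.1.sub hf0; rwa [sub_zero] at this,
      (hn₁ n₁ le_rfl).trans_lt ENNReal.ofReal_lt_top⟩
  have hfX : f ∈ lorentzSpace 𝕜 w hw hd q hq := by
    have := Submodule.sub_mem _ (u n₁).2 hdiff
    rwa [sub_sub_cancel] at this
  refine ⟨⟨f, hfX⟩, Metric.tendsto_atTop.2 fun ε hε => ?_⟩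
  obtain ⟨n₀, h⟩ := hnorm (ε / 2) (by positivity)
  refine ⟨n₀, fun n hn => ?_⟩
  rw [dist_zero_right, Real.norm_of_nonneg (lorentzNorm_nonneg _)]
  have : lorentzNorm (u n - ⟨f, hfX⟩) ≤ ε / 2 := by
    rw [← lorentzENorm_le_iff _ (by positivity), Submodule.coe_sub]
    exact h n hn
  linarith

theorem isQuasiBanach_lorentzNorm :
    IsQuasiBanach 𝕜 (lorentzNorm : lorentzSpace 𝕜 w hw hd q hq → ℝ) where
  nonneg := lorentzNorm_nonneg
  eq_zero_iff f := by
    refine ⟨fun h => ?_, fun h => h ▸ lorentzNorm_zero⟩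
    ext k
    have := norm_apply_le f k
    rw [h, mul_zero] at this
    simpa using this
  smul := lorentzNorm_smul
  add_le := lorentzNorm_add_le 𝕜 hw hd hq
  complete := lorentzSpace_complete

/-! ### Expansions in the unit vectors -/

theorem coe_sum_smul_lorentzUnit (s : Finset ℕ) (a : ℕ → 𝕜) :
    ((∑ n ∈ s, a n • lorentzUnit 𝕜 hw hd hq n : lorentzSpace 𝕜 w hw hd q hq) : ℕ → 𝕜) =
      (s : Set ℕ).indicator a := by
  classical
  ext k
  rw [AddSubmonoidClass.coe_finsetSum, Finset.sum_apply]
  simp [lorentzUnit, Pi.single_apply, Set.indicator_apply]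

theorem coe_sub_sum_smul_lorentzUnit (f : lorentzSpace 𝕜 w hw hd q hq) (s : Finset ℕ) :
    ((f - ∑ n ∈ s, (f : ℕ → 𝕜) n • lorentzUnit 𝕜 hw hd hq n :
      lorentzSpace 𝕜 w hw hd q hq) : ℕ → 𝕜) = (s : Set ℕ)ᶜ.indicator f := by
  rw [Submodule.coe_sub, coe_sum_smul_lorentzUnit, Set.indicator_compl]

/-- Convergence in the Lorentz space implies convergence of the coordinates. -/
theorem HasUncondSum.tendsto_apply {ι : Type*} {x : ι → lorentzSpace 𝕜 w hw hd q hq} {a : ι → 𝕜}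
    {f : lorentzSpace 𝕜 w hw hd q hq} (h : HasUncondSum lorentzNorm x a f) (k : ℕ) :
    HasSum (fun n => a n * (x n : ℕ → 𝕜) k) ((f : ℕ → 𝕜) k) := by
  rw [HasSum, SummationFilter.unconditional_filter, tendsto_iff_norm_sub_tendsto_zero]
  refine squeeze_zero (fun _ => norm_nonneg _) (fun s => ?_)
    ((mul_zero (w 0)⁻¹) ▸ Tendsto.const_mul (w 0)⁻¹ h)
  have := norm_apply_le (f - ∑ n ∈ s, a n • x n) k
  rw [Submodule.coe_sub, AddSubmonoidClass.coe_finsetSum, Pi.sub_apply, Finset.sum_apply] at this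
  rw [norm_sub_rev]
  simpa using this

theorem hasUncondSum_lorentzUnit_unique {f : lorentzSpace 𝕜 w hw hd q hq} {a : ℕ → 𝕜}
    (h : HasUncondSum lorentzNorm (lorentzUnit 𝕜 hw hd hq) a f) : a = f := by
  ext k
  refine HasSum.unique ?_ (h.tendsto_apply k)
  convert hasSum_single (α := 𝕜) (f := fun n => a n * (lorentzUnit 𝕜 hw hd hq n : ℕ → 𝕜) k) k
    fun n hn => ?_ using 1
  · simp [lorentzUnit]
  · simp [lorentzUnit, Pi.single_eq_of_ne hn.symm]

/-- The elements of the closed linear span of the unit vectors are the limits of their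
truncations. -/
theorem hasUncondSum_of_mem_closedSpan {f : lorentzSpace 𝕜 w hw hd q hq}
    (hf : f ∈ lorentzSeparablePart 𝕜 hw hd hq) :
    HasUncondSum lorentzNorm (lorentzUnit 𝕜 hw hd hq) f.1 f := by
  obtain ⟨κ, hκ, hadd⟩ := lorentzNorm_add_le 𝕜 hw hd hq
  -- The vectors that are limits of their own truncations form a subspace; it contains the unit
  -- vectors, and it is closed because passing to a tail does not increase the quasi-norm.
  let S : Submodule 𝕜 (lorentzSpace 𝕜 w hw hd q hq) :=
    { carrier := {f | HasUncondSum lorentzNorm (lorentzUnit 𝕜 hw hd hq) f.1 f}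
      zero_mem' := by simp [HasUncondSum, lorentzNorm_zero]
      add_mem' := fun {f g} hf hg => by
        refine squeeze_zero (fun _ => lorentzNorm_nonneg _) (fun s => ?_)
          (show Tendsto _ _ (𝓝 (0 : ℝ)) by
            have := (Tendsto.add hf hg).const_mul κ
            rwa [add_zero, mul_zero] at this)
        refine le_trans (le_of_eq ?_) (hadd _ _)
        congr 1
        simp only [Submodule.coe_add, Pi.add_apply, add_smul, Finset.sum_add_distrib]
        abel
      smul_mem' := fun c f hf => by
        have := Tendsto.const_mul ‖c‖ hf
        rw [mul_zero] at this
        refine this.congr fun s => ?_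
        rw [← lorentzNorm_smul, smul_sub, Finset.smul_sum]
        simp only [Submodule.coe_smul, Pi.smul_apply, smul_smul, smul_eq_mul] }
  have hS : closedSpan 𝕜 lorentzNorm (lorentzUnit 𝕜 hw hd hq) ≤ S := by
    refine closedSpan_le (fun n => ?_) fun f hf => ?_
    · refine tendsto_const_nhds.congr' ?_
      filter_upwards [eventually_ge_atTop {n}] with s hs
      have hs' : n ∈ s := hs (Finset.mem_singleton_self n)
      rw [Finset.sum_eq_single_of_mem n hs' fun k _ hk => by simp [lorentzUnit,
        Pi.single_eq_of_ne hk]]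
      simp [lorentzUnit, lorentzNorm_zero]
    · refine Metric.tendsto_atTop.2 fun ε hε => ?_
      obtain ⟨g, hg, hfg⟩ := hf (ε / (2 * κ)) (by positivity)
      obtain ⟨s, hs⟩ := Metric.tendsto_atTop.1 hg (ε / (2 * κ)) (by positivity)
      refine ⟨s, fun t ht => ?_⟩
      have h1 := hs t ht
      rw [dist_zero_right, Real.norm_of_nonneg (lorentzNorm_nonneg _)] at h1 ⊢
      have h2 : lorentzNorm ((f - g) - ∑ n ∈ t, ((f - g : lorentzSpace 𝕜 w hw hd q hq) :
          ℕ → 𝕜) n • lorentzUnit 𝕜 hw hd hq n) ≤ lorentzNorm (f - g) := by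
        refine lorentzNorm_mono fun k => ?_
        rw [coe_sub_sum_smul_lorentzUnit]
        exact norm_indicator_le_norm_self _ k
      have h3 := hadd ((f - g) - ∑ n ∈ t, ((f - g : lorentzSpace 𝕜 w hw hd q hq) :
          ℕ → 𝕜) n • lorentzUnit 𝕜 hw hd hq n)
        (g - ∑ n ∈ t, (g : ℕ → 𝕜) n • lorentzUnit 𝕜 hw hd hq n)
      have h4 : (f - g) - ∑ n ∈ t, ((f - g : lorentzSpace 𝕜 w hw hd q hq) :
          ℕ → 𝕜) n • lorentzUnit 𝕜 hw hd hq n +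
          (g - ∑ n ∈ t, (g : ℕ → 𝕜) n • lorentzUnit 𝕜 hw hd hq n) =
          f - ∑ n ∈ t, (f : ℕ → 𝕜) n • lorentzUnit 𝕜 hw hd hq n := by
        rw [sub_add_sub_comm, sub_add_cancel, ← Finset.sum_add_distrib]
        simp only [Submodule.coe_sub, Pi.sub_apply, ← add_smul, sub_add_cancel]
      rw [h4] at h3
      have h5 : κ * (ε / (2 * κ) + ε / (2 * κ)) = ε := by field_simp; norm_num
      have h6 := mul_lt_mul_of_pos_left (add_lt_add_of_le_of_lt (h2.trans hfg.le) h1)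
        (zero_lt_one.trans_le hκ)
      linarith
  exact hS hf

theorem hasUncondSum_lorentzUnit (hq' : q ≠ ∞) (f : lorentzSpace 𝕜 w hw hd q hq) :
    HasUncondSum lorentzNorm (lorentzUnit 𝕜 hw hd hq) f.1 f := by
  have h := (ENNReal.continuousAt_toReal ENNReal.zero_ne_top).tendsto.comp
    (tendsto_lorentzENorm_tail hw hq hq' f.2.1 f.2.2)
  rw [ENNReal.toReal_zero] at h
  refine h.congr fun s => ?_
  rw [lorentzNorm, coe_sub_sum_smul_lorentzUnit, Function.comp]

theorem lorentzNorm_lorentzUnit (n : ℕ) : lorentzNorm (lorentzUnit 𝕜 hw hd hq n) = w 0 := by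
  rw [lorentzNorm, lorentzUnit, lorentzENorm_single hw hq, ENNReal.toReal_ofReal hw.2.le]

theorem hasUncondSum_smul_lorentzUnit_iff {c : 𝕜} {a : ℕ → 𝕜}
    {f : lorentzSpace 𝕜 w hw hd q hq} :
    HasUncondSum lorentzNorm (fun n => c • lorentzUnit 𝕜 hw hd hq n) a f ↔
      HasUncondSum lorentzNorm (lorentzUnit 𝕜 hw hd hq) (fun n => c * a n) f := by
  simp only [HasUncondSum, smul_smul, mul_comm c]

theorem isUncondBasis_lorentzUnit (hq' : q ≠ ∞) :
    IsUncondBasis 𝕜 lorentzNorm (lorentzUnit 𝕜 hw hd hq) :=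
  isUncondBasis_of_expansion isQuasiBanach_lorentzNorm (hasUncondSum_lorentzUnit hq')
    fun _ _ => hasUncondSum_lorentzUnit_unique

theorem coeffTransform_lorentzUnit (hq' : q ≠ ∞) (f : lorentzSpace 𝕜 w hw hd q hq) :
    coeffTransform 𝕜 lorentzNorm (lorentzUnit 𝕜 hw hd hq) f = f.1 :=
  coeffTransform_eq_of_expansion (N := lorentzNorm) (x := lorentzUnit 𝕜 hw hd hq)
    (a := fun f => f.1) (hasUncondSum_lorentzUnit hq')
    (fun _ _ => hasUncondSum_lorentzUnit_unique) f

/-- The rescaled system is needed because the unit vectors have quasi-norm `w 0`, whereas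
universality concerns a normalized basis. -/
theorem smul_lorentzUnit_expansion (hq' : q ≠ ∞) {c : 𝕜} (hc : c ≠ 0) :
    (∀ f : lorentzSpace 𝕜 w hw hd q hq,
      HasUncondSum lorentzNorm (fun n => c • lorentzUnit 𝕜 hw hd hq n) (c⁻¹ • f.1) f) ∧
    ∀ (f : lorentzSpace 𝕜 w hw hd q hq) b,
      HasUncondSum lorentzNorm (fun n => c • lorentzUnit 𝕜 hw hd hq n) b f → b = c⁻¹ • f.1 := by
  refine ⟨fun f => ?_, fun f b hb => ?_⟩
  · rw [hasUncondSum_smul_lorentzUnit_iff]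
    simpa [mul_inv_cancel_left₀ hc] using hasUncondSum_lorentzUnit hq' f
  · rw [hasUncondSum_smul_lorentzUnit_iff] at hb
    rw [← hasUncondSum_lorentzUnit_unique hb]
    ext k
    simp [inv_mul_cancel_left₀ hc]

theorem isUncondBasis_smul_lorentzUnit (hq' : q ≠ ∞) {c : 𝕜} (hc : c ≠ 0) :
    IsUncondBasis 𝕜 lorentzNorm fun n => c • lorentzUnit 𝕜 hw hd hq n :=
  isUncondBasis_of_expansion isQuasiBanach_lorentzNorm (smul_lorentzUnit_expansion hq' hc).1
    (smul_lorentzUnit_expansion hq' hc).2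

theorem vecSupport_smul_lorentzUnit (hq' : q ≠ ∞) {c : 𝕜} (hc : c ≠ 0)
    (f : lorentzSpace 𝕜 w hw hd q hq) :
    vecSupport 𝕜 lorentzNorm (fun n => c • lorentzUnit 𝕜 hw hd hq n) f =
      {k | (f : ℕ → 𝕜) k ≠ 0} := by
  rw [vecSupport, coeffTransform_eq_of_expansion (smul_lorentzUnit_expansion hq' hc).1
    (smul_lorentzUnit_expansion hq' hc).2]
  simp [hc]

/-! ### The separable part -/

theorem isQuasiBanach_lorentzSeparablePart :
    IsQuasiBanach 𝕜 fun f : lorentzSeparablePart 𝕜 hw hd hq =>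
      lorentzNorm (f : lorentzSpace 𝕜 w hw hd q hq) where
  nonneg f := lorentzNorm_nonneg _
  eq_zero_iff f := (isQuasiBanach_lorentzNorm.eq_zero_iff f.1).trans Submodule.coe_eq_zero
  smul c f := lorentzNorm_smul c f.1
  add_le := by
    obtain ⟨κ, hκ, h⟩ := lorentzNorm_add_le 𝕜 hw hd hq
    exact ⟨κ, hκ, fun f g => h f.1 g.1⟩
  complete u hu := by
    simp only [Submodule.coe_sub] at hu ⊢
    obtain ⟨f, hf⟩ := lorentzSpace_complete (fun n => (u n).1) hu
    refine ⟨⟨f, mem_closedSpan_of_approx fun ε hε => ?_⟩, hf⟩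
    obtain ⟨n, hn⟩ := (hf.eventually_lt_const hε).exists
    rw [lorentzNorm_sub_comm] at hn
    exact ⟨(u n).1, (u n).2, hn⟩

theorem lorentzSeparableUnit_expansion :
    (∀ f : lorentzSeparablePart 𝕜 hw hd hq,
      HasUncondSum (fun f : lorentzSeparablePart 𝕜 hw hd hq =>
        lorentzNorm (f : lorentzSpace 𝕜 w hw hd q hq)) (lorentzSeparableUnit 𝕜 hw hd hq) f.1.1 f) ∧
    ∀ (f : lorentzSeparablePart 𝕜 hw hd hq) b,
      HasUncondSum (fun f : lorentzSeparablePart 𝕜 hw hd hq =>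
        lorentzNorm (f : lorentzSpace 𝕜 w hw hd q hq)) (lorentzSeparableUnit 𝕜 hw hd hq) b f →
      b = f.1.1 := by
  have key : ∀ (f : lorentzSeparablePart 𝕜 hw hd hq) (b : ℕ → 𝕜),
      HasUncondSum (fun f : lorentzSeparablePart 𝕜 hw hd hq =>
        lorentzNorm (f : lorentzSpace 𝕜 w hw hd q hq)) (lorentzSeparableUnit 𝕜 hw hd hq) b f ↔
      HasUncondSum lorentzNorm (lorentzUnit 𝕜 hw hd hq) b f.1 := fun f b => by
    simp only [HasUncondSum, Submodule.coe_sub, AddSubmonoidClass.coe_finsetSum,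
      Submodule.coe_smul_of_tower, lorentzSeparableUnit]
  exact ⟨fun f => (key f _).2 (hasUncondSum_of_mem_closedSpan f.2),
    fun f b hb => hasUncondSum_lorentzUnit_unique ((key f b).1 hb)⟩

theorem isUncondBasis_lorentzSeparableUnit :
    IsUncondBasis 𝕜 (fun f : lorentzSeparablePart 𝕜 hw hd hq =>
      lorentzNorm (f : lorentzSpace 𝕜 w hw hd q hq)) (lorentzSeparableUnit 𝕜 hw hd hq) :=
  isUncondBasis_of_expansion isQuasiBanach_lorentzSeparablePart lorentzSeparableUnit_expansion.1
    lorentzSeparableUnit_expansion.2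

theorem coeffTransform_lorentzSeparableUnit (f : lorentzSeparablePart 𝕜 hw hd hq) :
    coeffTransform 𝕜 (fun f : lorentzSeparablePart 𝕜 hw hd hq =>
      lorentzNorm (f : lorentzSpace 𝕜 w hw hd q hq)) (lorentzSeparableUnit 𝕜 hw hd hq) f = f.1.1 :=
  coeffTransform_eq_of_expansion (N := fun f : lorentzSeparablePart 𝕜 hw hd hq =>
      lorentzNorm (f : lorentzSpace 𝕜 w hw hd q hq)) (x := lorentzSeparableUnit 𝕜 hw hd hq)
    (a := fun f => f.1.1) lorentzSeparableUnit_expansion.1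
    lorentzSeparableUnit_expansion.2 f

end LorentzSpace

/-! ### Inclusion in `ℓ₁` and strong absoluteness -/

section EllOne

variable {𝕜 : Type*} [RCLike 𝕜] {w : ℕ → ℝ} {hw : IsWeight w} {hd : IsDoubling w} {q : ℝ≥0∞}
  {hq : 0 < q}

theorem ofReal_rearrangement_zero_le (f : lorentzSpace 𝕜 w hw hd q hq) :
    ENNReal.ofReal (rearrangement f.1 0) ≤ ⨆ k, ENNReal.ofReal ‖f.1 k‖ := by
  rcases eq_or_ne (⨆ k, ENNReal.ofReal ‖f.1 k‖) ∞ with h | h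
  · rw [h]
    exact le_top
  · rw [← ENNReal.ofReal_toReal h]
    refine ENNReal.ofReal_le_ofReal (rearrangement_le_of_norm_le ENNReal.toReal_nonneg
      (fun k => ?_) 0)
    rw [← ENNReal.ofReal_le_iff_le_toReal h]
    exact le_iSup (fun k => ENNReal.ofReal ‖f.1 k‖) k

/-- The inequality of a strongly absolute basis, from one for the rearrangement. -/
theorem tsum_norm_mul_le_max {f : lorentzSpace 𝕜 w hw hd q hq} {A R : ℝ} (hA : 0 ≤ A)
    (hR : 0 < R) (h : ∑' n, ENNReal.ofReal (rearrangement f.1 n) ≤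
      ENNReal.ofReal (A * rearrangement f.1 0) +
        ENNReal.ofReal ((2 * w 0 * R)⁻¹ * lorentzNorm f)) :
    ∑' n, ENNReal.ofReal (‖f.1 n‖ * w 0) ≤
      max (ENNReal.ofReal (2 * A + 1) * ⨆ n, ENNReal.ofReal (‖f.1 n‖ * w 0))
        (ENNReal.ofReal (lorentzNorm f / R)) := by
  have hw0 := hw.2
  have hN := lorentzNorm_nonneg f
  have ha := rearrangement_nonneg f.1 0
  simp only [ENNReal.ofReal_mul (norm_nonneg _)]
  rw [ENNReal.tsum_mul_right, ← ENNReal.iSup_mul]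
  calc (∑' n, ENNReal.ofReal ‖f.1 n‖) * ENNReal.ofReal (w 0)
      ≤ (ENNReal.ofReal (A * rearrangement f.1 0) +
        ENNReal.ofReal ((2 * w 0 * R)⁻¹ * lorentzNorm f)) * ENNReal.ofReal (w 0) := by
        gcongr
        exact (tsum_ofReal_norm_le f.2.1).trans h
    _ = ENNReal.ofReal ((A * rearrangement f.1 0 + (2 * w 0 * R)⁻¹ * lorentzNorm f) * w 0) := by
        rw [← ENNReal.ofReal_add (by positivity) (by positivity),
          ← ENNReal.ofReal_mul (by positivity)]
    _ ≤ ENNReal.ofReal (max ((2 * A + 1) * (rearrangement f.1 0 * w 0)) (lorentzNorm f / R)) := by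
        apply ENNReal.ofReal_le_ofReal
        -- The left side is the mean of two quantities and hence at most their maximum. The `+ 1` in
        -- `2 * A + 1` only makes the constant positive when `A = 0`.
        have e : (A * rearrangement f.1 0 + (2 * w 0 * R)⁻¹ * lorentzNorm f) * w 0 =
            (2 * A * (rearrangement f.1 0 * w 0) + lorentzNorm f / R) / 2 := by
          field_simp
        have h1 := le_max_left ((2 * A + 1) * (rearrangement f.1 0 * w 0)) (lorentzNorm f / R)
        have h2 := le_max_right ((2 * A + 1) * (rearrangement f.1 0 * w 0)) (lorentzNorm f / R)
        have h3 : 0 ≤ rearrangement f.1 0 * w 0 := by positivity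
        rw [e]
        linarith
    _ = max (ENNReal.ofReal ((2 * A + 1) * (rearrangement f.1 0 * w 0)))
          (ENNReal.ofReal (lorentzNorm f / R)) := ENNReal.ofReal_max _ _
    _ ≤ _ := by
        gcongr
        rw [ENNReal.ofReal_mul (by positivity), ENNReal.ofReal_mul ha]
        gcongr
        exact ofReal_rearrangement_zero_le f

/-- The reduction to rearrangements: `a₁` is the supremum of the moduli of the coefficients, and all
basis vectors have quasi-norm `w 0`. -/
theorem isStronglyAbsoluteBasis_lorentzUnit (hq' : q ≠ ∞)
    (h : ∀ ε : ℝ, 0 < ε → ∃ A : ℝ, 0 ≤ A ∧ ∀ f : lorentzSpace 𝕜 w hw hd q hq,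
      ∑' n, ENNReal.ofReal (rearrangement f.1 n) ≤ ENNReal.ofReal (A * rearrangement f.1 0) +
        ENNReal.ofReal (ε * lorentzNorm f)) :
    IsStronglyAbsoluteBasis 𝕜 lorentzNorm (lorentzUnit 𝕜 hw hd hq) := by
  refine ⟨isUncondBasis_lorentzUnit hq', fun R hR => ?_⟩
  have hw0 := hw.2
  -- The factor `w 0` is the quasi-norm of the unit vectors; the `2` is what turns the sum of two
  -- terms into a maximum.
  obtain ⟨A, hA, hf⟩ := h (2 * w 0 * R)⁻¹ (by positivity)
  refine ⟨2 * A + 1, by positivity, fun f => ?_⟩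
  simp only [coeffTransform_lorentzUnit hq', lorentzNorm_lorentzUnit]
  exact tsum_norm_mul_le_max hA hR (hf f)

theorem isStronglyAbsoluteBasis_lorentzSeparableUnit
    (h : ∀ ε : ℝ, 0 < ε → ∃ A : ℝ, 0 ≤ A ∧ ∀ f : lorentzSpace 𝕜 w hw hd q hq,
      ∑' n, ENNReal.ofReal (rearrangement f.1 n) ≤ ENNReal.ofReal (A * rearrangement f.1 0) +
        ENNReal.ofReal (ε * lorentzNorm f)) :
    IsStronglyAbsoluteBasis 𝕜 (fun f : lorentzSeparablePart 𝕜 hw hd hq =>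
      lorentzNorm (f : lorentzSpace 𝕜 w hw hd q hq)) (lorentzSeparableUnit 𝕜 hw hd hq) := by
  refine ⟨isUncondBasis_lorentzSeparableUnit, fun R hR => ?_⟩
  have hw0 := hw.2
  obtain ⟨A, hA, hf⟩ := h (2 * w 0 * R)⁻¹ (by positivity)
  refine ⟨2 * A + 1, by positivity, fun f => ?_⟩
  have hu : ∀ n, lorentzNorm (lorentzSeparableUnit 𝕜 hw hd hq n).1 = w 0 :=
    lorentzNorm_lorentzUnit
  simp only [coeffTransform_lorentzSeparableUnit, hu]
  exact tsum_norm_mul_le_max hA hR (hf f.1)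

theorem lorentzIncludedInEllOne_of_tsum_le {K : ℝ} (hK : 0 ≤ K)
    (h : ∀ f : lorentzSpace 𝕜 w hw hd q hq,
      ∑' n, ENNReal.ofReal (rearrangement f.1 n) ≤ ENNReal.ofReal (K * lorentzNorm f)) :
    LorentzIncludedInEllOne 𝕜 hw hd hq := by
  have h1 : ∀ (f : lorentzSpace 𝕜 w hw hd q hq) (s : Finset ℕ),
      ∑ k ∈ s, ‖f.1 k‖ ≤ K * lorentzNorm f := fun f s => by
    rw [← ENNReal.ofReal_le_ofReal_iff (mul_nonneg hK (lorentzNorm_nonneg f)),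
      ENNReal.ofReal_sum_of_nonneg fun k _ => norm_nonneg _]
    exact (ENNReal.sum_le_tsum s).trans ((tsum_ofReal_norm_le f.2.1).trans (h f))
  have h2 : ∀ f : lorentzSpace 𝕜 w hw hd q hq, Summable fun k => ‖f.1 k‖ := fun f =>
    summable_of_sum_le (fun _ => norm_nonneg _) (h1 f)
  refine ⟨fun f => memℓp_gen (by simpa using h2 f), K, fun f => ?_⟩
  exact (h2 f).tsum_le_of_sum_le (h1 f)

theorem LorentzIncludedInEllOne.sum_le (h : LorentzIncludedInEllOne 𝕜 hw hd hq) :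
    ∃ C : ℝ, 0 ≤ C ∧ ∀ (f : lorentzSpace 𝕜 w hw hd q hq) (s : Finset ℕ),
      ∑ k ∈ s, ‖f.1 k‖ ≤ C * lorentzNorm f := by
  obtain ⟨h1, C, hC⟩ := h
  refine ⟨|C|, abs_nonneg C, fun f s => ?_⟩
  have hs : Summable fun k => ‖f.1 k‖ := by simpa using (h1 f).summable (by simp)
  exact (hs.sum_le_tsum s fun _ _ => norm_nonneg _).trans ((hC f).trans
    (mul_le_mul_of_nonneg_right (le_abs_self C) (lorentzNorm_nonneg f)))

/-- Comparison of weighted series of non-increasing sequences. -/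
theorem tsum_antitone_mul_le {b u v : ℕ → ℝ} (hb : Antitone b) (hb0 : ∀ n, 0 ≤ b n)
    (hu : ∀ n, 0 ≤ u n) (hv : ∀ n, 0 ≤ v n) {C : ℝ} (hC : 0 ≤ C)
    (h : ∀ n, ∑ k ∈ Finset.range n, u k ≤ C * ∑ k ∈ Finset.range n, v k) :
    ∑' n, ENNReal.ofReal (b n * u n) ≤ ENNReal.ofReal C * ∑' n, ENNReal.ofReal (b n * v n) := by
  refine ENNReal.tsum_le_of_sum_range_le fun n => ?_
  refine le_trans ?_ (mul_le_mul_right (ENNReal.sum_le_tsum (Finset.range n)) _)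
  rw [← ENNReal.ofReal_sum_of_nonneg fun k _ => mul_nonneg (hb0 k) (hu k),
    ← ENNReal.ofReal_sum_of_nonneg fun k _ => mul_nonneg (hb0 k) (hv k), ← ENNReal.ofReal_mul hC]
  exact ENNReal.ofReal_le_ofReal (sum_antitone_mul_le hb hb0 h n)

/-! ### The weak Lorentz space -/

theorem rearrangement_mul_le_lorentzNorm_top
    (f : lorentzSpace 𝕜 w hw hd ∞ ENNReal.zero_lt_top) (n : ℕ) :
    rearrangement f.1 n * primitiveWeight w (n + 1) ≤ lorentzNorm f := by
  rw [← ENNReal.ofReal_le_ofReal_iff (lorentzNorm_nonneg f), ofReal_lorentzNorm, lorentzENorm_top]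
  exact le_iSup (fun n => ENNReal.ofReal (rearrangement f.1 n * primitiveWeight w (n + 1))) n

theorem rearrangement_tail_top (hs : Summable fun n : ℕ => 1 / primitiveWeight w (n + 1))
    (f : lorentzSpace 𝕜 w hw hd ∞ ENNReal.zero_lt_top) (m : ℕ) :
    ∑' n, ENNReal.ofReal (rearrangement f.1 (n + m)) ≤
      ENNReal.ofReal ((∑' n, 1 / primitiveWeight w (n + m + 1)) * lorentzNorm f) := by
  have hp := fun n => (primitiveWeight_pos hw n)
  have hs' : Summable fun n : ℕ => 1 / primitiveWeight w (n + m + 1) :=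
    (summable_nat_add_iff (f := fun n => 1 / primitiveWeight w (n + 1)) m).2 hs
  rw [ENNReal.ofReal_mul (tsum_nonneg fun n => (one_div_pos.2 (hp _)).le),
    ENNReal.ofReal_tsum_of_nonneg (fun n => (one_div_pos.2 (hp _)).le) hs',
    ← ENNReal.tsum_mul_right]
  refine ENNReal.tsum_le_tsum fun n => ?_
  rw [← ENNReal.ofReal_mul (one_div_pos.2 (hp _)).le]
  apply ENNReal.ofReal_le_ofReal
  rw [one_div_mul_eq_div, le_div_iff₀ (hp _)]
  exact rearrangement_mul_le_lorentzNorm_top f (n + m)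

/-- An initial segment of the rearranged series is absorbed by the term `A * rearrangement f 0` in
the strong absoluteness estimate, with `A = m`; only the tail has to be made small. -/
theorem sum_rearrangement_le {f : lorentzSpace 𝕜 w hw hd q hq} (m : ℕ) :
    ∑ n ∈ Finset.range m, ENNReal.ofReal (rearrangement f.1 n) ≤
      ENNReal.ofReal (m * rearrangement f.1 0) := by
  rw [← ENNReal.ofReal_sum_of_nonneg fun k _ => rearrangement_nonneg f.1 k]
  apply ENNReal.ofReal_le_ofReal
  have := Finset.sum_le_card_nsmul (Finset.range m) (rearrangement f.1) (rearrangement f.1 0)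
    fun n _ => rearrangement_antitone f.2.1 n.zero_le
  simpa using this

theorem lorentzIncludedInEllOne_top (hs : Summable fun n : ℕ => 1 / primitiveWeight w (n + 1)) :
    LorentzIncludedInEllOne 𝕜 (q := ∞) hw hd ENNReal.zero_lt_top :=
  lorentzIncludedInEllOne_of_tsum_le
    (tsum_nonneg fun n => (one_div_pos.2 (primitiveWeight_pos hw n)).le)
    fun f => rearrangement_tail_top hs f 0

theorem isStronglyAbsoluteBasis_top (hs : Summable fun n : ℕ => 1 / primitiveWeight w (n + 1)) :
    IsStronglyAbsoluteBasis 𝕜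
      (fun f : lorentzSeparablePart 𝕜 (q := ∞) hw hd ENNReal.zero_lt_top =>
        lorentzNorm (f : lorentzSpace 𝕜 w hw hd ∞ ENNReal.zero_lt_top))
      (lorentzSeparableUnit 𝕜 (q := ∞) hw hd ENNReal.zero_lt_top) := by
  refine isStronglyAbsoluteBasis_lorentzSeparableUnit fun ε hε => ?_
  obtain ⟨m, hm⟩ := ((tendsto_sum_nat_add fun n => 1 / primitiveWeight w (n + 1)).eventually_lt_const
    hε).exists
  refine ⟨m, m.cast_nonneg, fun f => ?_⟩
  rw [← ENNReal.summable.sum_add_tsum_nat_add' (k := m)]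
  refine add_le_add (sum_rearrangement_le m) ((rearrangement_tail_top hs f m).trans ?_)
  exact ENNReal.ofReal_le_ofReal (mul_le_mul_of_nonneg_right hm.le (lorentzNorm_nonneg f))

/-- The vectors `∑_{k < n} s_{k+1}⁻¹ e_k` of the unit ball of the weak Lorentz space. -/
theorem exists_weak_extremal (n : ℕ) :
    ∃ f : lorentzSpace 𝕜 w hw hd ∞ ENNReal.zero_lt_top, lorentzNorm f ≤ 1 ∧
      (∀ k < n, ‖f.1 k‖ = 1 / primitiveWeight w (k + 1)) ∧ ∀ k, n ≤ k → f.1 k = 0 := by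
  have hp := fun n => (primitiveWeight_pos hw n)
  let g : ℕ → 𝕜 := fun k => if k < n then ((1 / primitiveWeight w (k + 1) : ℝ) : 𝕜) else 0
  have hg : ∀ k < n, ‖g k‖ = 1 / primitiveWeight w (k + 1) := fun k hk => by
    simp only [g, if_pos hk, RCLike.norm_ofReal, abs_of_pos (one_div_pos.2 (hp k))]
  have hg0 : ∀ k, n ≤ k → g k = 0 := fun k hk => if_neg (not_lt.2 hk)
  refine ⟨⟨g, mem_lorentzSpace_of_finite (Finset.range n) fun k hk => hg0 k (by simpa using hk)⟩,
    ?_, hg, hg0⟩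
  rw [← lorentzENorm_le_iff _ zero_le_one, lorentzENorm_top]
  refine iSup_le fun j => ENNReal.ofReal_le_ofReal ?_
  rw [← le_div_iff₀ (hp j)]
  refine rearrangement_le (one_div_pos.2 (hp j)).le ?_
  -- As `s` is non-decreasing, a value above the `j`-th one can only occur at an index below `j`.
  have hsub : {k | 1 / primitiveWeight w (j + 1) < ‖g k‖} ⊆ (Finset.range j : Set ℕ) :=
    fun k hk => by
      by_contra hkj
      have hkj' : j ≤ k := by simpa using hkj
      have hk' : 1 / primitiveWeight w (j + 1) < ‖g k‖ := hk
      refine absurd hk' (not_lt.2 ?_)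
      rcases lt_or_ge k n with h | h
      · rw [hg k h]
        exact one_div_le_one_div_of_le (hp j) (primitiveWeight_mono hw (by omega))
      · rw [hg0 k h, norm_zero]
        exact (one_div_pos.2 (hp j)).le
  refine (Set.encard_le_encard hsub).trans ?_
  rw [Set.encard_coe_eq_coe_finsetCard, Finset.card_range]

theorem summable_of_lorentzIncludedInEllOne
    (h : LorentzIncludedInEllOne 𝕜 (q := ∞) hw hd ENNReal.zero_lt_top) :
    Summable fun n : ℕ => 1 / primitiveWeight w (n + 1) := by
  obtain ⟨C, hC0, hC⟩ := h.sum_le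
  refine summable_of_sum_range_le (c := C) (fun n => (one_div_pos.2 (primitiveWeight_pos hw n)).le)
    fun n => ?_
  obtain ⟨f, hf1, hf, -⟩ := exists_weak_extremal (𝕜 := 𝕜) (hw := hw) (hd := hd) n
  rw [← Finset.sum_congr rfl fun k hk => hf k (Finset.mem_range.1 hk)]
  exact (hC f _).trans (mul_le_of_le_one_right hC0 hf1)

theorem mem_lorentzSeparablePart_of_finite {f : lorentzSpace 𝕜 w hw hd q hq} (s : Finset ℕ)
    (h : ∀ k ∉ s, f.1 k = 0) : f ∈ lorentzSeparablePart 𝕜 hw hd hq := by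
  have : f = ∑ n ∈ s, f.1 n • lorentzUnit 𝕜 hw hd hq n := by
    refine Subtype.ext ?_
    rw [coe_sum_smul_lorentzUnit]
    exact (Set.indicator_eq_self.2 fun k hk => by_contra fun hks => hk (h k hks)).symm
  rw [this]
  exact Submodule.sum_mem _ fun n _ => Submodule.smul_mem _ _ (mem_closedSpan _ _ n)

/-- The inequality with `R = 1` is tested on the truncations of `(1 / sₙ)`. They have quasi-norm at
most `1`, and their normalized coefficients `w 0 / sₖ` are at most `1`, so the right side is bounded
by `max C 1` whatever the length of the truncation. -/
theorem summable_of_isStronglyAbsoluteBasis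
    (h : IsStronglyAbsoluteBasis 𝕜
      (fun f : lorentzSeparablePart 𝕜 (q := ∞) hw hd ENNReal.zero_lt_top =>
        lorentzNorm (f : lorentzSpace 𝕜 w hw hd ∞ ENNReal.zero_lt_top))
      (lorentzSeparableUnit 𝕜 (q := ∞) hw hd ENNReal.zero_lt_top)) :
    Summable fun n : ℕ => 1 / primitiveWeight w (n + 1) := by
  obtain ⟨C, hC0, hC⟩ := h.2 1 one_pos
  have hw0 := hw.2
  have hp := fun n => (primitiveWeight_pos hw n)
  have hp1 : primitiveWeight w 1 = w 0 := by simp [primitiveWeight]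
  have hu : ∀ n, lorentzNorm (lorentzSeparableUnit 𝕜 (q := ∞) hw hd ENNReal.zero_lt_top n).1 =
    w 0 := lorentzNorm_lorentzUnit
  simp only [coeffTransform_lorentzSeparableUnit, hu, div_one] at hC
  refine summable_of_sum_range_le (c := max C 1 / w 0) (fun n => (one_div_pos.2 (hp n)).le)
    fun n => ?_
  obtain ⟨f, hf1, hf, hf0⟩ := exists_weak_extremal (𝕜 := 𝕜) (hw := hw) (hd := hd) n
  have hfS := mem_lorentzSeparablePart_of_finite (Finset.range n)
    fun k hk => hf0 k (by simpa using hk)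
  have h1 := hC ⟨f, hfS⟩
  have hsup : ⨆ k, ENNReal.ofReal (‖f.1 k‖ * w 0) ≤ 1 := iSup_le fun k => by
    rw [← ENNReal.ofReal_one]
    apply ENNReal.ofReal_le_ofReal
    rcases lt_or_ge k n with h | h
    · rw [hf k h, one_div_mul_eq_div, div_le_one (hp k), ← hp1]
      exact primitiveWeight_mono hw (by omega)
    · simp [hf0 k h]
  have h2 : ENNReal.ofReal (∑ k ∈ Finset.range n, 1 / primitiveWeight w (k + 1) * w 0) ≤
      ENNReal.ofReal (max C 1) := by
    rw [ENNReal.ofReal_sum_of_nonneg fun k _ => mul_nonneg (one_div_pos.2 (hp k)).le hw0.le,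
      ENNReal.ofReal_max, Finset.sum_congr rfl fun k hk => by rw [← hf k (Finset.mem_range.1 hk)]]
    refine (ENNReal.sum_le_tsum _).trans (h1.trans (max_le_max ?_ ?_))
    · exact mul_le_of_le_one_right' hsup
    · exact ENNReal.ofReal_le_ofReal hf1
  rw [ENNReal.ofReal_le_ofReal_iff (by positivity), ← Finset.sum_mul] at h2
  rwa [le_div_iff₀ hw0]

/-! ### The case `1 < q < ∞` -/

/-- With `vₙ = lorentzWeight w r n`, Hölder's inequality is applied to `aₙ = (aₙ vₙ^(1/r))
vₙ^(-1/r)` on a tail. The first factor contributes at most the quasi-norm, and the second a tail of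
the convergent series, since `vₙ^(-t/r) = wₙ^(1-t) / sₙ` for the conjugate exponent `t`. -/
theorem isStronglyAbsoluteBasis_of_one_lt {q' : ℝ≥0∞} (hq1 : 1 < q) (hqt : q < ∞)
    (hqq : q.HolderConjugate q')
    (h : ∑' n : ℕ, ENNReal.ofReal (w n) ^ (-q'.toReal + 1) *
        (ENNReal.ofReal (primitiveWeight w (n + 1)))⁻¹ < ∞) :
    IsStronglyAbsoluteBasis 𝕜 lorentzNorm (lorentzUnit 𝕜 hw hd hq) := by
  have hq0 : q ≠ ∞ := hqt.ne
  have hr1 : 1 < q.toReal := by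
    rw [← ENNReal.toReal_one]
    exact (ENNReal.toReal_lt_toReal ENNReal.one_ne_top hq0).2 hq1
  have hq't : q' ≠ ∞ := by
    rintro rfl
    have := hqq.inv_add_inv_eq_one
    rw [ENNReal.inv_top, add_zero, ENNReal.inv_eq_one] at this
    exact hq1.ne' this
  have hc : q.toReal.HolderConjugate q'.toReal := by
    rw [Real.holderConjugate_iff]
    refine ⟨hr1, ?_⟩
    have h1 := congrArg ENNReal.toReal hqq.inv_add_inv_eq_one
    have hq'0 : q' ≠ 0 := by
      rintro rfl
      simpa using hqq.inv_add_inv_eq_one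
    rwa [ENNReal.toReal_add (ENNReal.inv_ne_top.2 hq.ne') (ENNReal.inv_ne_top.2 hq'0),
      ENNReal.toReal_inv, ENNReal.toReal_inv, ENNReal.toReal_one] at h1
  set r := q.toReal with hr_def
  set t := q'.toReal
  have ht1 : 1 < t := hc.symm.lt
  have hr0 : 0 < r := by linarith
  have ht0 : 0 < t := by linarith
  have hp := fun n => primitiveWeight_pos hw n
  -- A zero weight would contribute `0 ^ (1 - t) = ∞`, because the exponent is negative.
  have hwpos : ∀ n, 0 < w n := fun n => by
    refine (hw.1 n).lt_of_ne fun h0 => ?_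
    have h1 := ENNReal.ne_top_of_tsum_ne_top h.ne n
    rw [← h0, ENNReal.ofReal_zero, ENNReal.zero_rpow_of_neg (by linarith)] at h1
    exact h1 (ENNReal.top_mul (ENNReal.inv_ne_zero.2 ENNReal.ofReal_ne_top))
  have hv : ∀ n, 0 < lorentzWeight w r n := fun n => by
    have := hp n
    have := hwpos n
    unfold lorentzWeight
    positivity
  have hG : ∀ n, ENNReal.ofReal (lorentzWeight w r n ^ (-(1 / r))) ^ t =
      ENNReal.ofReal (w n) ^ (-t + 1) * (ENNReal.ofReal (primitiveWeight w (n + 1)))⁻¹ := fun n => by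
    have hpn := hp n
    have hwn := hwpos n
    rw [ENNReal.ofReal_rpow_of_nonneg (Real.rpow_nonneg (hv n).le _) ht0.le,
      ENNReal.ofReal_rpow_of_pos hwn, ← ENNReal.ofReal_inv_of_pos hpn,
      ← ENNReal.ofReal_mul (by positivity), ← Real.rpow_mul (hv n).le]
    congr 1
    have e : -(1 / r) * t = -t + 1 := by
      have := hc.sub_one_mul_conj
      have h2 : t / r = t - 1 := by
        rw [div_eq_iff hr0.ne']
        linarith
      rw [neg_mul, one_div_mul_eq_div, h2]
      ring
    have e2 : r * (-t + 1) = -t := by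
      have := hc.sub_one_mul_conj
      linarith
    rw [e, lorentzWeight, Real.mul_rpow (by positivity) (by positivity),
      ← Real.rpow_mul hpn.le, e2, Real.div_rpow hwn.le hpn.le, div_eq_mul_inv,
      ← Real.rpow_neg hpn.le, mul_left_comm, ← Real.rpow_add hpn, ← Real.rpow_neg_one]
    congr 2
    ring
  refine isStronglyAbsoluteBasis_lorentzUnit hq0 fun ε hε => ?_
  have htail := (ENNReal.tendsto_sum_nat_add _ h.ne).ennrpow_const (1 / t)
  rw [ENNReal.zero_rpow_of_pos (by positivity)] at htail
  obtain ⟨m, hm⟩ := (htail.eventually_lt_const (ENNReal.ofReal_pos.2 hε)).exists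
  refine ⟨m, m.cast_nonneg, fun f => ?_⟩
  rw [← ENNReal.summable.sum_add_tsum_nat_add' (k := m)]
  refine add_le_add (sum_rearrangement_le m) (ENNReal.tsum_le_of_sum_range_le fun n => ?_)
  have hfac : ∀ k, ENNReal.ofReal (rearrangement f.1 k) =
      ENNReal.ofReal (rearrangement f.1 k * lorentzWeight w r k ^ (1 / r)) *
        ENNReal.ofReal (lorentzWeight w r k ^ (-(1 / r))) := fun k => by
    have := hv k
    rw [← ENNReal.ofReal_mul (mul_nonneg (rearrangement_nonneg _ _) (by positivity)), mul_assoc,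
      ← Real.rpow_add (hv k), add_neg_cancel, Real.rpow_zero, mul_one]
  simp only [hfac]
  refine (ENNReal.inner_le_Lp_mul_Lq _ _ _ hc).trans ?_
  rw [mul_comm, ENNReal.ofReal_mul hε.le, ofReal_lorentzNorm]
  refine mul_le_mul' ?_ ?_
  · refine le_trans ?_ hm.le
    simp only [hG]
    gcongr
    exact ENNReal.sum_le_tsum (f := fun k => ENNReal.ofReal (w (k + m)) ^ (-t + 1) *
      (ENNReal.ofReal (primitiveWeight w (k + m + 1)))⁻¹) _
  · rw [lorentzENorm_of_ne_top hw hq0, ← hr_def]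
    gcongr
    have e : ∀ k, ENNReal.ofReal (rearrangement f.1 k * lorentzWeight w r k ^ (1 / r)) ^ r =
        ENNReal.ofReal (rearrangement f.1 k ^ r * lorentzWeight w r k) := fun k => by
      have h1 := rearrangement_nonneg f.1 k
      have h2 := hv k
      rw [ENNReal.ofReal_rpow_of_nonneg (by positivity) hr0.le, Real.mul_rpow h1 (by positivity),
        ← Real.rpow_mul h2.le, one_div_mul_cancel hr0.ne', Real.rpow_one]
    simp only [e]
    refine (ENNReal.sum_le_tsum _).trans (le_trans le_add_self (le_of_eq
      (ENNReal.summable.sum_add_tsum_nat_add' (k := m)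
        (f := fun k => ENNReal.ofReal (rearrangement f.1 k ^ r * lorentzWeight w r k)))))

/-! ### The case `0 < q ≤ 1` -/

variable (𝕜 hw hd hq) in
-- The space embeds in its version with `q = 1`: in `aₙ wₙ = (aₙ sₙ) (wₙ / sₙ)` the power `(aₙ
-- sₙ)^(1-r)` is bounded by the weak quasi-norm, and what remains is the `r`-th power of the
-- quasi-norm.
theorem tsum_rearrangement_mul_weight_le (hq1 : q ≤ 1) :
    ∃ K : ℝ, 0 < K ∧ ∀ f : lorentzSpace 𝕜 w hw hd q hq,
      ∑' n, ENNReal.ofReal (rearrangement f.1 n * w n) ≤ ENNReal.ofReal (K * lorentzNorm f) := by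
  have hq' : q ≠ ∞ := (hq1.trans_lt ENNReal.one_lt_top).ne
  have hr : 0 < q.toReal := ENNReal.toReal_pos hq.ne' hq'
  have hr1 : q.toReal ≤ 1 := by
    rw [← ENNReal.toReal_one]
    exact ENNReal.toReal_mono ENNReal.one_ne_top hq1
  obtain ⟨K, hK, hKf⟩ := rearrangement_mul_primitiveWeight_le 𝕜 hw hq
  set r := q.toReal with hr_def
  refine ⟨K ^ (1 - r), by positivity, fun f => ?_⟩
  have hN := lorentzNorm_nonneg f
  have hweak : ∀ n, rearrangement f.1 n * primitiveWeight w (n + 1) ≤ K * lorentzNorm f :=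
    fun n => by
      rw [← ENNReal.ofReal_le_ofReal_iff (by positivity), ENNReal.ofReal_mul hK.le,
        ofReal_lorentzNorm]
      exact hKf f.1 f.2.1 n
  have hterm : ∀ n, rearrangement f.1 n * w n ≤
      (K * lorentzNorm f) ^ (1 - r) * (rearrangement f.1 n ^ r * lorentzWeight w r n) := fun n => by
    have ha := rearrangement_nonneg f.1 n
    have hp := primitiveWeight_pos hw n
    have hwn := hw.1 n
    set x := rearrangement f.1 n * primitiveWeight w (n + 1) with hx
    have hx0 : 0 ≤ x := by positivity
    have e1 : rearrangement f.1 n * w n = x * (w n / primitiveWeight w (n + 1)) := by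
      rw [hx]; field_simp
    have e2 : rearrangement f.1 n ^ r * lorentzWeight w r n =
        x ^ r * (w n / primitiveWeight w (n + 1)) := by
      rw [hx, Real.mul_rpow ha hp.le, lorentzWeight, mul_assoc]
    have e3 : x = x ^ (1 - r) * x ^ r := by
      rw [← Real.rpow_add_of_nonneg hx0 (by linarith) hr.le, sub_add_cancel, Real.rpow_one]
    rw [e1, e2, ← mul_assoc]
    refine mul_le_mul_of_nonneg_right ?_ (by positivity)
    calc x = x ^ (1 - r) * x ^ r := e3
      _ ≤ _ := by
        gcongr
        exact hweak n
  calc ∑' n, ENNReal.ofReal (rearrangement f.1 n * w n)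
      ≤ ∑' n, ENNReal.ofReal ((K * lorentzNorm f) ^ (1 - r)) *
          ENNReal.ofReal (rearrangement f.1 n ^ r * lorentzWeight w r n) :=
        ENNReal.tsum_le_tsum fun n => by
          rw [← ENNReal.ofReal_mul (by positivity)]
          exact ENNReal.ofReal_le_ofReal (hterm n)
    _ = ENNReal.ofReal ((K * lorentzNorm f) ^ (1 - r)) * ENNReal.ofReal (lorentzNorm f ^ r) := by
        rw [ENNReal.tsum_mul_left, hr_def, ← lorentzENorm_rpow hw hq hq', ← ofReal_lorentzNorm,
          ENNReal.ofReal_rpow_of_nonneg hN hr.le]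
    _ = _ := by
        rw [← ENNReal.ofReal_mul (by positivity), Real.mul_rpow hK.le hN, mul_assoc,
          ← Real.rpow_add_of_nonneg hN (by linarith) hr.le, sub_add_cancel, Real.rpow_one]

theorem le_primitiveWeight_of_iInf_pos (h : 0 < ⨅ n : ℕ, primitiveWeight w (n + 1) / (n + 1)) :
    ∃ c : ℝ, 0 < c ∧ ∀ n : ℕ, c * n ≤ primitiveWeight w n := by
  refine ⟨_, h, fun n => ?_⟩
  rcases n with _ | n
  · simp [primitiveWeight]
  -- A real infimum over a set that is not bounded below is `0` by convention, so the positive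
  -- infimum already forces a lower bound.
  have hbdd : BddBelow (Set.range fun n : ℕ => primitiveWeight w (n + 1) / ((n : ℝ) + 1)) := by
    by_contra hcon
    rw [Real.iInf_of_not_bddBelow hcon] at h
    exact lt_irrefl _ h
  have := ciInf_le hbdd n
  rw [le_div_iff₀ (by positivity)] at this
  push_cast
  exact this

theorem lorentzIncludedInEllOne_of_le_one (hq1 : q ≤ 1) {c : ℝ} (hc : 0 < c)
    (h : ∀ n : ℕ, c * n ≤ primitiveWeight w n) : LorentzIncludedInEllOne 𝕜 hw hd hq := by
  obtain ⟨K, hK, hKf⟩ := tsum_rearrangement_mul_weight_le 𝕜 hw hd hq hq1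
  refine lorentzIncludedInEllOne_of_tsum_le (K := c⁻¹ * K) (by positivity) fun f => ?_
  have h1 := tsum_antitone_mul_le (u := fun _ => 1) (v := w) (rearrangement_antitone f.2.1)
    (rearrangement_nonneg f.1) (fun _ => zero_le_one) hw.1 (inv_nonneg.2 hc.le) fun n => by
      rw [inv_mul_eq_div, le_div_iff₀' hc]
      simpa [primitiveWeight] using h n
  simp only [mul_one] at h1
  refine h1.trans ?_
  rw [mul_assoc, ENNReal.ofReal_mul (inv_nonneg.2 hc.le)]
  gcongr
  exact hKf f

theorem iInf_pos_of_lorentzIncludedInEllOne (h : LorentzIncludedInEllOne 𝕜 hw hd hq) :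
    0 < ⨅ n : ℕ, primitiveWeight w (n + 1) / (n + 1) := by
  obtain ⟨C, hC0, hC⟩ := h.sum_le
  obtain ⟨K, hK, hKf⟩ := lorentzENorm_le_of_norm_le 𝕜 hw hq
  -- The indicator of the first `n + 1` indices has `ℓ₁` norm `n + 1` and quasi-norm at most `K`
  -- times `primitiveWeight w (n + 1)`. Using `C + 1` in place of `C` keeps the constant invertible.
  refine lt_of_lt_of_le (show 0 < ((C + 1) * K)⁻¹ by positivity) (le_ciInf fun n => ?_)
  let g : ℕ → 𝕜 := (Finset.range (n + 1) : Set ℕ).indicator 1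
  have hg0 : ∀ k ∉ Finset.range (n + 1), g k = 0 := fun k hk =>
    Set.indicator_of_notMem (by simpa using hk) _
  have hg1 : ∀ k ∈ Finset.range (n + 1), g k = 1 := fun k hk =>
    Set.indicator_of_mem (by simpa using hk) _
  have hg : ∀ k, ‖g k‖ ≤ 1 := fun k => by
    by_cases hk : k ∈ Finset.range (n + 1)
    · simp [hg1 k hk]
    · simp [hg0 k hk]
  let f : lorentzSpace 𝕜 w hw hd q hq := ⟨g, mem_lorentzSpace_of_finite _ hg0⟩
  have hp := primitiveWeight_pos hw n
  have h1 : lorentzNorm f ≤ K * primitiveWeight w (n + 1) := by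
    rw [← lorentzENorm_le_iff _ (by positivity)]
    simpa using hKf g _ 1 zero_le_one hg hg0
  have h2 := hC f (Finset.range (n + 1))
  rw [Finset.sum_congr rfl fun k hk => by rw [show f.1 k = 1 from hg1 k hk]] at h2
  simp only [norm_one, Finset.sum_const, Finset.card_range, nsmul_eq_mul, mul_one] at h2
  push_cast at h2
  rw [inv_le_iff_one_le_mul₀ (by positivity), ← mul_div_right_comm, le_div_iff₀ (by positivity),
    one_mul]
  have h3 := mul_le_mul_of_nonneg_left h1 hC0
  have h4 : 0 < K * primitiveWeight w (n + 1) := by positivity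
  linarith

theorem isStronglyAbsoluteBasis_of_le_one (hq1 : q ≤ 1)
    (h : Tendsto (fun n : ℕ => primitiveWeight w n / n) atTop atTop) :
    IsStronglyAbsoluteBasis 𝕜 lorentzNorm (lorentzUnit 𝕜 hw hd hq) := by
  refine isStronglyAbsoluteBasis_lorentzUnit (hq1.trans_lt ENNReal.one_lt_top).ne fun ε hε => ?_
  obtain ⟨K, hK, hKf⟩ := tsum_rearrangement_mul_weight_le 𝕜 hw hd hq hq1
  obtain ⟨m, hm⟩ := eventually_atTop.1 ((tendsto_atTop.1 h) (ε / K)⁻¹)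
  refine ⟨m, m.cast_nonneg, fun f => ?_⟩
  -- The partial sums of `v` are `m + (ε / K) sₙ` for `n ≥ 1`. They dominate `n`: by the first
  -- summand if `n ≤ m`, by the second, through the choice of `m`, otherwise.
  have h1 := tsum_antitone_mul_le (u := fun _ => 1)
    (v := fun k => (if k = 0 then (m : ℝ) else 0) + ε / K * w k)
    (rearrangement_antitone f.2.1) (rearrangement_nonneg f.1) (fun _ => zero_le_one)
    (fun k => add_nonneg (by split_ifs <;> simp) (mul_nonneg (by positivity) (hw.1 k)))
    zero_le_one fun n => by
      rcases n with _ | n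
      · simp
      rw [one_mul, Finset.sum_add_distrib, ← Finset.mul_sum]
      change _ ≤ _ + ε / K * primitiveWeight w (n + 1)
      have hp := primitiveWeight_pos hw n
      rw [Finset.sum_ite_eq_of_mem' _ _ _ (by simp)]
      simp only [Finset.sum_const, Finset.card_range, nsmul_eq_mul, mul_one]
      have h3 : 0 < ε / K * primitiveWeight w (n + 1) := by positivity
      rcases le_total (n + 1) m with hnm | hnm
      · have : ((n + 1 : ℕ) : ℝ) ≤ m := by exact_mod_cast hnm
        linarith
      · have h2 := hm (n + 1) hnm
        rw [inv_le_iff_one_le_mul₀ (by positivity), ← mul_div_right_comm,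
          le_div_iff₀ (by positivity)] at h2
        have : (0 : ℝ) ≤ m := m.cast_nonneg
        linarith
  simp only [mul_one, ENNReal.ofReal_one, one_mul] at h1
  refine h1.trans (le_of_eq_of_le (b := ENNReal.ofReal (m * rearrangement f.1 0) +
    ENNReal.ofReal (ε / K) * ∑' n, ENNReal.ofReal (rearrangement f.1 n * w n)) ?_ ?_)
  · rw [← ENNReal.tsum_mul_left, ← tsum_ite_eq 0 fun _ : ℕ => ENNReal.ofReal
      (m * rearrangement f.1 0), ← ENNReal.tsum_add]
    refine tsum_congr fun n => ?_
    have ha := rearrangement_nonneg f.1 n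
    have hwn := hw.1 n
    rw [← ENNReal.ofReal_mul (by positivity)]
    split_ifs with hn
    · subst hn
      rw [← ENNReal.ofReal_add (by positivity) (by positivity)]
      congr 1; ring
    · rw [zero_add, zero_add]
      congr 1; ring
  · gcongr
    calc _ ≤ ENNReal.ofReal (ε / K) * ENNReal.ofReal (K * lorentzNorm f) := by
          gcongr
          exact hKf f
      _ = _ := by
          rw [← ENNReal.ofReal_mul (by positivity), ← mul_assoc, div_mul_cancel₀ _ hK.ne']

end EllOne

/-! ### Blocks in the Lorentz space for `q < 1` -/

section Blocks

variable {𝕜 : Type*} [RCLike 𝕜] {w : ℕ → ℝ} {hw : IsWeight w} {hd : IsDoubling w} {q : ℝ≥0∞}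
  {hq : 0 < q}

variable (𝕜 hd) in
/-- Interpolation of the `ℓ₁`-norm between the Lorentz quasi-norm and the weak `ℓ₁`-norm. -/
theorem sum_norm_le_of_weak (hq1 : q < 1) {c : ℝ} (hc : 0 < c)
    (h : ∀ n : ℕ, c * n ≤ primitiveWeight w n) :
    ∃ K : ℝ, 0 < K ∧ ∀ (f : lorentzSpace 𝕜 w hw hd q hq) (W : ℝ), 0 ≤ W →
      (∀ j : ℕ, (j + 1) * rearrangement f.1 j ≤ W) → ∀ s : Finset ℕ,
      ∑ k ∈ s, ‖f.1 k‖ ≤ K * (lorentzNorm f ^ q.toReal * W ^ (1 - q.toReal)) := by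
  have hq' : q ≠ ∞ := (hq1.trans ENNReal.one_lt_top).ne
  have hr : 0 < q.toReal := ENNReal.toReal_pos hq.ne' hq'
  have hr1 : q.toReal < 1 := by
    rw [← ENNReal.toReal_one]
    exact (ENNReal.toReal_lt_toReal hq' ENNReal.one_ne_top).2 hq1
  set r := q.toReal with hr_def
  have hw1 : IsWeight fun _ : ℕ => (1 : ℝ) := ⟨fun _ => zero_le_one, one_pos⟩
  have hp1 : ∀ n, primitiveWeight (fun _ : ℕ => (1 : ℝ)) n = n := fun n => by
    simp [primitiveWeight]
  have hmin : 0 < min 1 r := lt_min one_pos hr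
  have hmax : 0 < max 1 r := lt_max_of_lt_left one_pos
  -- The weights are compared with those of the constant sequence `1`, whose primitive weight is
  -- `n`; `n ≤ c⁻¹ sₙ` passes to the `r`-th powers and then to the partial sums of the Lorentz
  -- weights.
  set K := (min 1 r)⁻¹ * (c⁻¹ ^ r * max 1 r) with hK_def
  have hK : 0 < K := by positivity
  have hcomp : ∀ n, ∑ k ∈ Finset.range n, lorentzWeight (fun _ => 1) r k ≤
      K * ∑ k ∈ Finset.range n, lorentzWeight w r k := fun n => by
    have h1 := sum_lorentzWeight_le hw1 hr n
    rw [hp1] at h1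
    have h2 : (n : ℝ) ^ r ≤ c⁻¹ ^ r * primitiveWeight w n ^ r := by
      rw [← Real.mul_rpow (by positivity) (primitiveWeight_nonneg hw n)]
      refine Real.rpow_le_rpow n.cast_nonneg ?_ hr.le
      rw [inv_mul_eq_div, le_div_iff₀' hc]
      exact h n
    calc _ ≤ _ := h1
      _ ≤ (min 1 r)⁻¹ * (c⁻¹ ^ r * (max 1 r * ∑ k ∈ Finset.range n, lorentzWeight w r k)) := by
        gcongr
        refine h2.trans ?_
        gcongr
        exact sum_lorentzWeight_ge hw hr n
      _ = _ := by rw [hK_def]; ring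
  refine ⟨K, hK, fun f W hW hf s => ?_⟩
  have hN := lorentzNorm_nonneg f
  have hWr : 0 ≤ W ^ (1 - r) := Real.rpow_nonneg hW _
  -- With `x = (n + 1) aₙ ≤ W`, the term is `x / (n + 1)` and `x = x^(1-r) x^r ≤ W^(1-r) x^r`.
  have hterm : ∀ n, rearrangement f.1 n ≤
      W ^ (1 - r) * (rearrangement f.1 n ^ r * lorentzWeight (fun _ => 1) r n) := fun n => by
    have ha := rearrangement_nonneg f.1 n
    have hn : (0 : ℝ) < n + 1 := by positivity
    set x := (n + 1) * rearrangement f.1 n with hx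
    have hx0 : 0 ≤ x := by positivity
    have e1 : rearrangement f.1 n ^ r * lorentzWeight (fun _ => 1) r n = x ^ r * (1 / (n + 1)) := by
      rw [hx, lorentzWeight, hp1, Real.mul_rpow hn.le ha]
      push_cast
      ring
    have e2 : rearrangement f.1 n = x * (1 / (n + 1)) := by
      rw [hx]; field_simp
    have e3 : x = x ^ (1 - r) * x ^ r := by
      rw [← Real.rpow_add_of_nonneg hx0 (by linarith) hr.le, sub_add_cancel, Real.rpow_one]
    rw [e1, ← mul_assoc]
    refine e2.le.trans (mul_le_mul_of_nonneg_right ?_ (by positivity))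
    calc x = x ^ (1 - r) * x ^ r := e3
      _ ≤ _ := by
        gcongr
        exact hf n
  rw [← ENNReal.ofReal_le_ofReal_iff (by positivity), ENNReal.ofReal_sum_of_nonneg
    fun k _ => norm_nonneg _]
  calc ∑ k ∈ s, ENNReal.ofReal ‖f.1 k‖ ≤ ∑' n, ENNReal.ofReal (rearrangement f.1 n) :=
        (ENNReal.sum_le_tsum s).trans (tsum_ofReal_norm_le f.2.1)
    _ ≤ ∑' n, ENNReal.ofReal (W ^ (1 - r)) *
          ENNReal.ofReal (rearrangement f.1 n ^ r * lorentzWeight (fun _ => 1) r n) :=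
        ENNReal.tsum_le_tsum fun n => by
          rw [← ENNReal.ofReal_mul hWr]
          exact ENNReal.ofReal_le_ofReal (hterm n)
    _ ≤ ENNReal.ofReal (W ^ (1 - r)) * (ENNReal.ofReal K *
          ∑' n, ENNReal.ofReal (rearrangement f.1 n ^ r * lorentzWeight w r n)) := by
        rw [ENNReal.tsum_mul_left]
        gcongr
        exact tsum_antitone_mul_le (fun m n hmn => Real.rpow_le_rpow (rearrangement_nonneg f.1 n)
          (rearrangement_antitone f.2.1 hmn) hr.le)
          (fun n => Real.rpow_nonneg (rearrangement_nonneg f.1 n) r)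
          (lorentzWeight_nonneg hw1 r) (lorentzWeight_nonneg hw r) hK.le hcomp
    _ = _ := by
        rw [hr_def, ← lorentzENorm_rpow hw hq hq', ← ofReal_lorentzNorm,
          ENNReal.ofReal_rpow_of_nonneg hN hr.le, ← hr_def, ← ENNReal.ofReal_mul hK.le,
          ← ENNReal.ofReal_mul hWr]
        congr 1
        ring

variable (𝕜 hw hd hq) in
theorem mul_primitiveWeight_card_le :
    ∃ K : ℝ, 0 < K ∧ ∀ (f : lorentzSpace 𝕜 w hw hd q hq) (s : Finset ℕ) (v : ℝ), 0 ≤ v →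
      (∀ k ∈ s, v ≤ ‖f.1 k‖) → v * primitiveWeight w s.card ≤ K * lorentzNorm f := by
  obtain ⟨K, hK, h⟩ := rearrangement_mul_primitiveWeight_le 𝕜 hw hq
  refine ⟨K, hK, fun f s v hv hs => ?_⟩
  have hN := lorentzNorm_nonneg f
  rcases hcard : s.card with _ | n
  · simp only [primitiveWeight, Finset.range_zero, Finset.sum_empty, mul_zero]
    positivity
  · have h1 := h f.1 f.2.1 n
    rw [← ofReal_lorentzNorm, ← ENNReal.ofReal_mul hK.le,
      ENNReal.ofReal_le_ofReal_iff (by positivity)] at h1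
    refine le_trans ?_ h1
    have := (primitiveWeight_pos hw n).le
    gcongr
    exact le_rearrangement f.2.1 (by omega) hs

variable (𝕜 hw hd hq) in
theorem lorentzNorm_le_mul_primitiveWeight_card :
    ∃ K : ℝ, 0 < K ∧ ∀ (f : lorentzSpace 𝕜 w hw hd q hq) (s : Finset ℕ) (v : ℝ), 0 ≤ v →
      (∀ k, ‖f.1 k‖ ≤ v) → (∀ k ∉ s, f.1 k = 0) →
      lorentzNorm f ≤ K * (v * primitiveWeight w s.card) := by
  obtain ⟨K, hK, h⟩ := lorentzENorm_le_of_norm_le 𝕜 hw hq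
  refine ⟨K, hK, fun f s v hv hf hs => ?_⟩
  have := primitiveWeight_nonneg hw s.card
  rw [← lorentzENorm_le_iff _ (by positivity)]
  exact h f.1 s v hv hf hs

variable (𝕜 hw hd hq) in
/-- A vector of norm one that is normed by a bounded sequence has a flat part on which both are
large. -/
theorem exists_flat_part (hq1 : q < 1) {c : ℝ} (hc : 0 < c)
    (h : ∀ n : ℕ, c * n ≤ primitiveWeight w n) {D : ℝ} (hD : 0 < D) :
    ∃ c₁ c₂ : ℝ, 0 < c₁ ∧ 0 < c₂ ∧ ∀ (y : lorentzSpace 𝕜 w hw hd q hq) (ψ : ℕ → 𝕜)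
      (S : Finset ℕ), lorentzNorm y = 1 → (∀ k, ‖ψ k‖ ≤ D) → (∀ k ∉ S, y.1 k = 0) →
      ∑ k ∈ S, y.1 k * ψ k = 1 →
      ∃ B ⊆ S, B.Nonempty ∧ ∀ k ∈ B, c₁ / B.card ≤ ‖y.1 k‖ ∧ c₂ ≤ ‖ψ k‖ := by
  obtain ⟨K, hK, hweak⟩ := sum_norm_le_of_weak 𝕜 (hw := hw) hd (hq := hq) hq1 hc h
  obtain ⟨K₁, hK₁0, hK₁⟩ :=
    (lorentzIncludedInEllOne_of_le_one (𝕜 := 𝕜) (hd := hd) (hq := hq) hq1.le hc h).sum_le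
  have hq' : q ≠ ∞ := (hq1.trans ENNReal.one_lt_top).ne
  have hr : 0 < q.toReal := ENNReal.toReal_pos hq.ne' hq'
  have hr1 : q.toReal < 1 := by
    rw [← ENNReal.toReal_one]
    exact (ENNReal.toReal_lt_toReal hq' ENNReal.one_ne_top).2 hq1
  set r := q.toReal
  -- This `W` solves `K D^r W^(1-r) = 1 / 2`: a vector of quasi-norm at most `D` and weak `ℓ₁` norm
  -- at most `W` cannot have `ℓ₁` norm `1`.
  obtain ⟨W, hW0, hW⟩ : ∃ W : ℝ, 0 < W ∧ K * (D ^ r * W ^ (1 - r)) < 1 := by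
    refine ⟨(2 * (K * D ^ r))⁻¹ ^ (1 / (1 - r)), by positivity, ?_⟩
    rw [← Real.rpow_mul (by positivity), one_div_mul_cancel (by linarith), Real.rpow_one]
    have : 0 < K * D ^ r := by positivity
    rw [← mul_assoc, mul_inv, mul_comm (2 : ℝ)⁻¹, ← mul_assoc, mul_inv_cancel₀ this.ne']
    norm_num
  set K₂ := K₁ + 1
  have hK₂ : 0 < K₂ := by positivity
  refine ⟨W / (2 * D), W / (2 * K₂), by positivity, by positivity, fun y ψ S hy hψ hyS hsum => ?_⟩
  have hzle : ∀ k, ‖y.1 k * ψ k‖ ≤ D * ‖y.1 k‖ := fun k => by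
    rw [norm_mul, mul_comm]
    exact mul_le_mul_of_nonneg_right (hψ k) (norm_nonneg _)
  let z : lorentzSpace 𝕜 w hw hd q hq :=
    ⟨fun k => y.1 k * ψ k, mem_lorentzSpace_of_norm_le y hzle⟩
  have hzN : lorentzNorm z ≤ D := by
    simpa [hy] using lorentzNorm_mono_mul (f := z) (g := y) hD.le hzle
  -- The product `z` of `y` and `ψ` has `ℓ₁` norm at least `1` since its entries over `S` add up to
  -- `1`; by the choice of `W` its weak `ℓ₁` norm must exceed `W` at some index.
  obtain ⟨j, hj⟩ : ∃ j : ℕ, W < (j + 1) * rearrangement z.1 j := by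
    by_contra! hcon
    have h1 := hweak z W hW0.le hcon S
    have h2 : (1 : ℝ) ≤ ∑ k ∈ S, ‖z.1 k‖ := by
      rw [← norm_one (α := 𝕜), ← hsum]
      exact norm_sum_le _ _
    have h3 : K * (lorentzNorm z ^ r * W ^ (1 - r)) ≤ K * (D ^ r * W ^ (1 - r)) := by
      gcongr
      exact lorentzNorm_nonneg z
    linarith
  set n : ℕ := j + 1 with hn_def
  have hn : (0 : ℝ) < n := by positivity
  have hjn : W / n < rearrangement z.1 j := by
    rw [div_lt_iff₀' hn, hn_def]
    push_cast
    exact hj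
  set B₀ := S.filter fun k => W / n < ‖z.1 k‖ with hB₀
  have hB₀card : n ≤ B₀.card := by
    have h1 := lt_encard_of_lt_rearrangement (by positivity) hjn
    have h2 : {k | W / n < ‖z.1 k‖} ⊆ (B₀ : Set ℕ) := fun k hk => by
      have hk' : W / n < ‖z.1 k‖ := hk
      rw [hB₀, Finset.mem_coe, Finset.mem_filter]
      refine ⟨by_contra fun hkS => ?_, hk'⟩
      have : z.1 k = 0 := by simp only [z, hyS k hkS, zero_mul]
      rw [this, norm_zero] at hk'
      exact absurd hk' (not_lt.2 (by positivity))
    have h3 := h1.trans_le (Set.encard_le_encard h2)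
    rw [Set.encard_coe_eq_coe_finsetCard] at h3
    have : j < B₀.card := by exact_mod_cast h3
    omega
  -- The `ℓ₁` norm of `y` is at most `K₂`, so at most `n / 2` coordinates exceed `2 K₂ / n`. On the
  -- others `|ψ| > W / (n |y|) ≥ W / (2 K₂)`, while `|y| > W / (n D)` holds on the whole level set.
  have hbad : 2 * (B₀.filter fun k => ¬ ‖y.1 k‖ ≤ 2 * K₂ / n).card ≤ n := by
    have h1 := Finset.card_nsmul_le_sum (B₀.filter fun k => ¬ ‖y.1 k‖ ≤ 2 * K₂ / n)
      (fun k => ‖y.1 k‖) (2 * K₂ / n) fun k hk => (not_le.1 (Finset.mem_filter.1 hk).2).le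
    have h2 := hK₁ y (B₀.filter fun k => ¬ ‖y.1 k‖ ≤ 2 * K₂ / n)
    rw [hy, mul_one] at h2
    rw [nsmul_eq_mul] at h1
    have h3 := (h1.trans h2).trans (show K₁ ≤ K₂ by simp [K₂])
    rw [← mul_div_assoc, div_le_iff₀ hn] at h3
    have h4 : (2 * ((B₀.filter fun k => ¬ ‖y.1 k‖ ≤ 2 * K₂ / n).card : ℝ)) * K₂ ≤ n * K₂ := by
      linarith
    exact_mod_cast le_of_mul_le_mul_right h4 hK₂
  have hgood : (n + 1) / 2 ≤ (B₀.filter fun k => ‖y.1 k‖ ≤ 2 * K₂ / n).card := by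
    have := Finset.card_filter_add_card_filter_not (s := B₀) fun k => ‖y.1 k‖ ≤ 2 * K₂ / n
    omega
  obtain ⟨B, hB, hBcard⟩ := Finset.exists_subset_card_eq hgood
  refine ⟨B, fun k hk => (Finset.mem_filter.1 (Finset.mem_filter.1 (hB hk)).1).1,
    Finset.card_pos.1 (by omega), fun k hk => ?_⟩
  obtain ⟨hk1, hk2⟩ := Finset.mem_filter.1 (hB hk)
  have hk3 : W / n < ‖y.1 k‖ * ‖ψ k‖ := by
    rw [← norm_mul]
    exact (Finset.mem_filter.1 hk1).2
  have hBn : (n : ℝ) ≤ 2 * B.card := by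
    have : n ≤ 2 * B.card := by omega
    exact_mod_cast this
  have hB0 : (0 : ℝ) < B.card := by linarith
  rw [div_lt_iff₀ hn] at hk3
  constructor
  · rw [div_div, div_le_iff₀ (by positivity)]
    have h1 : ‖y.1 k‖ * ‖ψ k‖ * n ≤ ‖y.1 k‖ * D * (2 * B.card) := by
      gcongr
      exact hψ k
    linarith
  · rw [le_div_iff₀ hn] at hk2
    rw [div_le_iff₀ (by positivity)]
    have h1 : ‖ψ k‖ * (‖y.1 k‖ * n) ≤ ‖ψ k‖ * (2 * K₂) := by gcongr
    linarith

/-- The coordinates of a well complemented family `y` of blocks with supports `S m` and projecting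
functionals `φ m`. -/
structure IsProjectedBlocks (C : ℝ) {M : Type*} (y : M → lorentzSpace 𝕜 w hw hd q hq)
    (φ : M → lorentzSpace 𝕜 w hw hd q hq →ₗ[𝕜] 𝕜) (S : M → Finset ℕ) : Prop where
  norm_eq_one : ∀ m, lorentzNorm (y m) = 1
  ne_zero_iff : ∀ m k, (y m).1 k ≠ 0 ↔ k ∈ S m
  disjoint : ∀ m n, m ≠ n → Disjoint (S m) (S n)
  functional_eq_zero : ∀ m, ∀ k ∉ S m, φ m (lorentzUnit 𝕜 hw hd hq k) = 0
  functional_self : ∀ m, φ m (y m) = 1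
  bounded : ∀ m, ∃ B : ℝ, ∀ f, ‖φ m f‖ ≤ B * lorentzNorm f
  projection : ∀ f, ∃ h : lorentzSpace 𝕜 w hw hd q hq, lorentzNorm h ≤ C * lorentzNorm f ∧
    ∀ m, ∀ k ∈ S m, h.1 k = φ m f * (y m).1 k

namespace IsProjectedBlocks

variable {C : ℝ} {M : Type*} {y : M → lorentzSpace 𝕜 w hw hd q hq}
  {φ : M → lorentzSpace 𝕜 w hw hd q hq →ₗ[𝕜] 𝕜} {S : M → Finset ℕ}

theorem eq_zero (H : IsProjectedBlocks C y φ S) {m : M} {k : ℕ} (hk : k ∉ S m) :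
    (y m).1 k = 0 := by
  by_contra hne
  exact hk ((H.ne_zero_iff m k).1 hne)

/-- A bounded functional commutes with the expansion of `f` in unit vectors, and `φ m` vanishes on
the unit vectors outside `S m`. -/
theorem functional_apply (H : IsProjectedBlocks C y φ S) (hq' : q ≠ ∞) (m : M)
    (f : lorentzSpace 𝕜 w hw hd q hq) :
    φ m f = ∑ k ∈ S m, f.1 k * φ m (lorentzUnit 𝕜 hw hd hq k) := by
  obtain ⟨B, hB⟩ := H.bounded m
  have h1 : Tendsto (fun s : Finset ℕ => φ m (∑ k ∈ s, f.1 k • lorentzUnit 𝕜 hw hd hq k)) atTop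
      (𝓝 (φ m f)) := by
    rw [tendsto_iff_norm_sub_tendsto_zero]
    refine squeeze_zero (fun _ => norm_nonneg _) (fun s => ?_)
      (mul_zero B ▸ Tendsto.const_mul B (hasUncondSum_lorentzUnit hq' f))
    rw [norm_sub_rev, ← map_sub]
    exact hB _
  refine tendsto_nhds_unique h1 (tendsto_const_nhds.congr' ?_)
  filter_upwards [eventually_ge_atTop (S m)] with s hs
  rw [map_sum]
  simp only [map_smul, smul_eq_mul]
  exact Finset.sum_subset hs fun k _ hk => by rw [H.functional_eq_zero m k hk, mul_zero]

/-- On `S m` the projection of a unit vector coincides with its multiple of `y m`, a vector of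
quasi-norm one, and the unit vector has quasi-norm `w 0`. -/
theorem norm_functional_unit_le (H : IsProjectedBlocks C y φ S) (m : M) (k : ℕ) :
    ‖φ m (lorentzUnit 𝕜 hw hd hq k)‖ ≤ C * w 0 := by
  obtain ⟨h, hN, hh⟩ := H.projection (lorentzUnit 𝕜 hw hd hq k)
  have h1 : lorentzNorm (φ m (lorentzUnit 𝕜 hw hd hq k) • y m) ≤ lorentzNorm h := by
    refine lorentzNorm_mono fun j => ?_
    rw [Submodule.coe_smul, Pi.smul_apply, smul_eq_mul]
    by_cases hj : j ∈ S m
    · rw [hh m j hj]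
    · rw [H.eq_zero hj, mul_zero, norm_zero]
      exact norm_nonneg _
  rw [lorentzNorm_smul, H.norm_eq_one, mul_one] at h1
  rw [lorentzNorm_lorentzUnit] at hN
  exact h1.trans hN

theorem functional_of_ne (H : IsProjectedBlocks C y φ S) (hq' : q ≠ ∞) {m n : M} (hmn : m ≠ n) :
    φ m (y n) = 0 := by
  rw [H.functional_apply hq']
  refine Finset.sum_eq_zero fun k hk => ?_
  rw [H.eq_zero (Finset.disjoint_left.1 (H.disjoint m n hmn) hk), zero_mul]

end IsProjectedBlocks

end Blocks

/-! ### Few blocks have large flat parts -/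

section LargeBlocks

variable {𝕜 : Type*} [RCLike 𝕜] {w : ℕ → ℝ} {hw : IsWeight w} {hd : IsDoubling w} {q : ℝ≥0∞}
  {hq : 0 < q}

/-- The harmonic step function on disjoint blocks of non-decreasing sizes is in the unit ball of
weak `ℓ₁`. -/
theorem mul_rearrangement_le_one_of_harmonic {N : ℕ} {B : Fin N → Finset ℕ}
    (hB : ∀ i, (B i).Nonempty) (hmono : Monotone fun i => (B i).card) {g : ℕ → 𝕜}
    (hg : ∀ i, ∀ k ∈ B i, ‖g k‖ = 1 / (((i : ℕ) + 1) * (B i).card))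
    (hg0 : ∀ k, (∀ i, k ∉ B i) → g k = 0) (j : ℕ) :
    (j + 1) * rearrangement g j ≤ 1 := by
  have hj : (0 : ℝ) < j + 1 := by positivity
  rw [← le_div_iff₀' hj]
  refine rearrangement_le (by positivity) ?_
  set F := Finset.univ.filter fun i : Fin N => ((i : ℕ) + 1) * (B i).card < j + 1 with hF
  have hsub : {k | 1 / ((j : ℝ) + 1) < ‖g k‖} ⊆ (F.biUnion B : Set ℕ) := fun k hk => by
    have hk' : 1 / ((j : ℝ) + 1) < ‖g k‖ := hk
    obtain ⟨i, hi⟩ : ∃ i, k ∈ B i := by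
      by_contra! hcon
      rw [hg0 k hcon, norm_zero] at hk'
      exact absurd hk' (not_lt.2 (by positivity))
    rw [Finset.mem_coe, Finset.mem_biUnion]
    refine ⟨i, Finset.mem_filter.2 ⟨Finset.mem_univ i, ?_⟩, hi⟩
    have hc : (0 : ℝ) < (B i).card := by exact_mod_cast (hB i).card_pos
    rw [hg i k hi, one_div_lt_one_div hj (by positivity)] at hk'
    exact_mod_cast hk'
  refine (Set.encard_le_encard hsub).trans ?_
  rw [Set.encard_coe_eq_coe_finsetCard]
  suffices (F.biUnion B).card ≤ j by exact_mod_cast this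
  rcases F.eq_empty_or_nonempty with hFe | hFne
  · simp [hFe]
  -- `F` consists of the blocks with value above `1 / (j + 1)`. They number at most `i₀ + 1`, each
  -- of size at most that of block `i₀`, and `(i₀ + 1) * (B i₀).card ≤ j` since `i₀` itself belongs
  -- to `F`.
  · set i₀ := F.max' hFne
    have hi₀ : ((i₀ : ℕ) + 1) * (B i₀).card < j + 1 := (Finset.mem_filter.1 (F.max'_mem hFne)).2
    have hFsub : F ⊆ Finset.Iic i₀ := fun i hi => Finset.mem_Iic.2 (F.le_max' i hi)
    have hFc : F.card ≤ i₀ + 1 := by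
      have := Finset.card_le_card hFsub
      rwa [Fin.card_Iic] at this
    calc (F.biUnion B).card ≤ ∑ i ∈ F, (B i).card := Finset.card_biUnion_le
      _ ≤ F.card • (B i₀).card := Finset.sum_le_card_nsmul _ _ _ fun i hi =>
          hmono (F.le_max' i hi)
      _ ≤ (i₀ + 1) * (B i₀).card := by
          rw [smul_eq_mul]
          exact Nat.mul_le_mul_right _ hFc
      _ ≤ j := by omega

set_option maxHeartbeats 400000 in
variable (𝕜 hw hd hq) in
-- Many large flat parts would allow the projection to produce, from a vector of bounded quasi-norm,
-- a harmonic step function whose `ℓ₁` norm is too large for the interpolation inequality. Large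
-- size leaves room for the fractions `1 / (i L)` of the least flat part to be realized by actual
-- sets.
theorem exists_card_bound_of_flat_parts (hq1 : q < 1) {c : ℝ} (hc : 0 < c)
    (h : ∀ n : ℕ, c * n ≤ primitiveWeight w n) {C c₁ c₂ : ℝ} (hC : 0 < C) (hc₁ : 0 < c₁)
    (hc₂ : 0 < c₂) :
    ∃ N : ℕ, ∀ (M : Type) (y : M → lorentzSpace 𝕜 w hw hd q hq)
      (φ : M → lorentzSpace 𝕜 w hw hd q hq →ₗ[𝕜] 𝕜) (S B : M → Finset ℕ),
      IsProjectedBlocks C y φ S → (∀ m, B m ⊆ S m) → (∀ m, (B m).Nonempty) →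
      (∀ m, ∀ k ∈ B m, c₁ / (B m).card ≤ ‖(y m).1 k‖ ∧
        c₂ ≤ ‖φ m (lorentzUnit 𝕜 hw hd hq k)‖) →
      ∀ e : Fin N → M, Function.Injective e → ∃ i, (B (e i)).card < N := by
  classical
  obtain ⟨K, hK, hweak⟩ := sum_norm_le_of_weak 𝕜 (hw := hw) hd (hq := hq) hq1 hc h
  obtain ⟨K₂, hK₂, hlow⟩ := mul_primitiveWeight_card_le 𝕜 hw hd hq
  obtain ⟨K₃, hK₃, hupp⟩ := lorentzNorm_le_mul_primitiveWeight_card 𝕜 hw hd hq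
  obtain ⟨D, hD0, hD⟩ := primitiveWeight_doubling hw hd
  have hq' : q ≠ ∞ := (hq1.trans ENNReal.one_lt_top).ne
  have hr : 0 < q.toReal := ENNReal.toReal_pos hq.ne' hq'
  have hr1 : q.toReal < 1 := by
    rw [← ENNReal.toReal_one]
    exact (ENNReal.toReal_lt_toReal hq' ENNReal.one_ne_top).2 hq1
  set r := q.toReal
  -- Here `K₃ * D * (K₂ / c₁)` bounds the test vector, `C` the projection, and `(c₁ * c₂)⁻¹` is lost
  -- in the comparison with the step function, whose quasi-norm is thus at most `L * K₅`.
  set K₅ := (c₁ * c₂)⁻¹ * (C * (K₃ * D * (K₂ / c₁))) with hK₅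
  have hK₅0 : 0 ≤ K₅ := by positivity
  obtain ⟨N, hN, hN1⟩ : ∃ N : ℕ, K * K₅ ^ r <
      (∑ i ∈ Finset.range N, 1 / ((i : ℝ) + 1)) ^ (1 - r) ∧ 1 ≤ N := by
    have ht := (tendsto_rpow_atTop (by linarith : 0 < 1 - r)).comp
      Real.tendsto_sum_range_one_div_nat_succ_atTop
    exact ((ht.eventually_gt_atTop _).and (eventually_ge_atTop 1)).exists
  set L := ∑ i ∈ Finset.range N, 1 / ((i : ℝ) + 1) with hL
  refine ⟨N, fun M y φ S B H hBS hBne hflat e he => ?_⟩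
  by_contra! hcon
  have hL1 : 1 ≤ L := by
    have := Finset.single_le_sum (f := fun i : ℕ => 1 / ((i : ℝ) + 1)) (s := Finset.range N)
      (fun i _ => by positivity) (Finset.mem_range.2 hN1)
    simpa [hL] using this
  have hL0 : 0 < L := by linarith
  have hLfin : ∑ i : Fin N, 1 / (((i : ℕ) : ℝ) + 1) = L :=
    Fin.sum_univ_eq_sum_range (fun i => 1 / ((i : ℝ) + 1)) N
  clear_value L
  let σ := Tuple.sort fun i => (B (e i)).card
  let m : Fin N → M := fun i => e (σ i)
  have hm : Function.Injective m := he.comp σ.injective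
  have hmono : Monotone fun i => (B (m i)).card := Tuple.monotone_sort fun i => (B (e i)).card
  have hdisj : ∀ i j, i ≠ j → Disjoint (S (m i)) (S (m j)) := fun i j hij =>
    H.disjoint _ _ (hm.ne hij)
  let i₀ : Fin N := ⟨0, hN1⟩
  set n := (B (m i₀)).card with hn
  have hNn : N ≤ n := hcon (σ i₀)
  have hn0 : (0 : ℝ) < n := by exact_mod_cast (by omega : 0 < n)
  have hle : ∀ i, n ≤ (B (m i)).card := fun i => hmono (Fin.mk_le_of_le_val (Nat.zero_le _))
  have hcardE : ∀ i : Fin N, ⌈n / (((i : ℕ) + 1) * L)⌉₊ ≤ (B (m i)).card := fun i => by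
    refine le_trans (Nat.ceil_le.2 ?_) (hle i)
    refine div_le_self hn0.le ?_
    have : (1 : ℝ) ≤ (i : ℕ) + 1 := by
      have : (0 : ℝ) ≤ (i : ℕ) := Nat.cast_nonneg _
      linarith
    nlinarith
  choose E hEB hEcard using fun i => Finset.exists_subset_card_eq (hcardE i)
  have hES : ∀ i, E i ⊆ S (m i) := fun i => (hEB i).trans (hBS _)
  -- The sizes `n / ((i + 1) L)` add up to `n`, and rounding up costs at most one point per block.
  -- As `N ≤ n`, the union has at most `2 n` points, which is where doubling enters.
  set U := Finset.univ.biUnion E with hU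
  have hUcard : U.card ≤ 2 * n := by
    have h1 : (U.card : ℝ) ≤ n + N := by
      calc (U.card : ℝ) ≤ ∑ i, ((E i).card : ℝ) := by
            exact_mod_cast Finset.card_biUnion_le
        _ ≤ ∑ i : Fin N, (n / L * (1 / ((i : ℕ) + 1)) + 1) := by
            refine Finset.sum_le_sum fun i _ => ?_
            rw [hEcard]
            refine (Nat.ceil_lt_add_one (by positivity)).le.trans (le_of_eq ?_)
            rw [div_mul_div_comm, mul_one, mul_comm L]
        _ = n + N := by
            rw [Finset.sum_add_distrib, ← Finset.mul_sum, hLfin, div_mul_cancel₀ _ hL0.ne']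
            simp
    have h2 : U.card ≤ n + N := by exact_mod_cast h1
    omega
  -- the test vector and its norm
  set Φ : ℕ → 𝕜 := fun k => ∑ i, φ (m i) (lorentzUnit 𝕜 hw hd hq k) with hΦ
  have hΦE : ∀ i, ∀ k ∈ S (m i), Φ k = φ (m i) (lorentzUnit 𝕜 hw hd hq k) := fun i k hk => by
    rw [hΦ]
    refine Finset.sum_eq_single i (fun j _ hji => H.functional_eq_zero _ k fun hkj => ?_) (by simp)
    exact Finset.disjoint_left.1 (hdisj j i hji) hkj hk
  -- The phases are chosen so that every term of `φ (m i) f` is a non-negative real, equal to `‖φ (m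
  -- i) eₖ‖ / n` for `k` in `E i`.
  let f₀ : ℕ → 𝕜 := fun k =>
    if k ∈ U then (starRingEnd 𝕜) (Φ k) * ((‖Φ k‖ * n)⁻¹ : ℝ) else 0
  have hf₀U : ∀ k ∉ U, f₀ k = 0 := fun k hk => if_neg hk
  have hf₀ : ∀ k, ‖f₀ k‖ ≤ 1 / n := fun k => by
    by_cases hk : k ∈ U
    · simp only [f₀, if_pos hk, norm_mul, RCLike.norm_conj, RCLike.norm_ofReal]
      rw [abs_of_nonneg (by positivity), mul_inv, ← mul_assoc, one_div]
      refine mul_le_of_le_one_left (by positivity) ?_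
      exact mul_inv_le_one
    · rw [hf₀U k hk, norm_zero]
      positivity
  let f : lorentzSpace 𝕜 w hw hd q hq := ⟨f₀, mem_lorentzSpace_of_finite U hf₀U⟩
  -- The block with the least flat part has quasi-norm one and modulus at least `c₁ / n` at `n`
  -- points, which bounds `sₙ / n`.
  have hsn : primitiveWeight w n ≤ K₂ / c₁ * n := by
    have h1 := hlow (y (m i₀)) (B (m i₀)) (c₁ / n) (by positivity)
      fun k hk => (hflat _ k hk).1
    rw [H.norm_eq_one, mul_one, ← hn, div_mul_eq_mul_div, div_le_iff₀ hn0] at h1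
    rw [div_mul_eq_mul_div, le_div_iff₀ hc₁]
    linarith
  have hfN : lorentzNorm f ≤ K₃ * D * (K₂ / c₁) := by
    have h1 := hupp f U (1 / n) (by positivity) hf₀ hf₀U
    have h2 : primitiveWeight w U.card ≤ D * primitiveWeight w n := by
      refine (primitiveWeight_mono hw hUcard).trans ?_
      have := hD (2 * n) (by omega)
      rwa [show (2 * n + 1) / 2 = n by omega] at this
    calc lorentzNorm f ≤ K₃ * (1 / n * primitiveWeight w U.card) := h1
      _ ≤ K₃ * (1 / n * (D * (K₂ / c₁ * n))) := by
          gcongr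
          exact h2.trans (mul_le_mul_of_nonneg_left hsn hD0)
      _ = _ := by field_simp
  have hφf : ∀ i : Fin N, c₂ / (((i : ℕ) + 1) * L) ≤ ‖φ (m i) f‖ := fun i => by
    have e1 : φ (m i) f =
        ((∑ k ∈ E i, ‖φ (m i) (lorentzUnit 𝕜 hw hd hq k)‖ * (n : ℝ)⁻¹ : ℝ) : 𝕜) := by
      rw [H.functional_apply hq', ← Finset.sum_subset (hES i) fun k hkS hkE => ?_]
      · push_cast
        refine Finset.sum_congr rfl fun k hk => ?_
        have hkU : k ∈ U := Finset.mem_biUnion.2 ⟨i, Finset.mem_univ i, hk⟩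
        have hΦk := hΦE i k (hES i hk)
        have hne : ‖Φ k‖ ≠ 0 := by
          have := (hflat (m i) k (hEB i hk)).2
          rw [← hΦk] at this
          linarith
        change f₀ k * _ = _
        simp only [f₀, if_pos hkU]
        rw [← hΦk, mul_right_comm, RCLike.conj_mul]
        push_cast
        have hne' : (‖Φ k‖ : 𝕜) ≠ 0 := by exact_mod_cast hne
        rw [mul_inv, sq, ← mul_assoc, mul_assoc (‖Φ k‖ : 𝕜), mul_inv_cancel₀ hne', mul_one]
      · have hkU : k ∉ U := fun hkU => by
          obtain ⟨j, -, hj⟩ := Finset.mem_biUnion.1 hkU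
          rcases eq_or_ne j i with rfl | hji
          · exact hkE hj
          · exact Finset.disjoint_left.1 (hdisj j i hji) (hES j hj) hkS
        change f₀ k * _ = 0
        rw [hf₀U k hkU, zero_mul]
    rw [e1, RCLike.norm_ofReal]
    refine le_trans ?_ (le_abs_self _)
    have h1 := Finset.card_nsmul_le_sum (E i)
      (fun k => ‖φ (m i) (lorentzUnit 𝕜 hw hd hq k)‖ * (n : ℝ)⁻¹) (c₂ * (n : ℝ)⁻¹) fun k hk =>
        mul_le_mul_of_nonneg_right (hflat (m i) k (hEB i hk)).2 (by positivity)
    refine le_trans ?_ h1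
    rw [nsmul_eq_mul, hEcard]
    have h2 := Nat.le_ceil ((n : ℝ) / (((i : ℕ) + 1) * L))
    calc c₂ / (((i : ℕ) + 1) * L) = n / (((i : ℕ) + 1) * L) * (c₂ * (n : ℝ)⁻¹) := by
          field_simp
      _ ≤ _ := by gcongr
  obtain ⟨p, hpN, hp⟩ := H.projection f
  -- the harmonic step function
  let g₀ : ℕ → 𝕜 := fun k => ∑ i : Fin N,
    if k ∈ B (m i) then ((1 / (((i : ℕ) + 1) * (B (m i)).card) : ℝ) : 𝕜) else 0
  have hg₀ : ∀ i, ∀ k ∈ B (m i), ‖g₀ k‖ = 1 / (((i : ℕ) + 1) * (B (m i)).card) := fun i k hk => by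
    have : g₀ k = ((1 / (((i : ℕ) + 1) * (B (m i)).card) : ℝ) : 𝕜) := by
      simp only [g₀]
      rw [Finset.sum_eq_single i (fun j _ hji => if_neg fun hkj => ?_) (by simp), if_pos hk]
      exact Finset.disjoint_left.1 (hdisj j i hji) (hBS _ hkj) (hBS _ hk)
    rw [this, RCLike.norm_ofReal, abs_of_nonneg (by positivity)]
  have hg₀0 : ∀ k, (∀ i, k ∉ B (m i)) → g₀ k = 0 := fun k hk =>
    Finset.sum_eq_zero fun i _ => if_neg (hk i)
  -- On `B (m i)` the projection `p` is `φ (m i) f` times the block, hence has modulus at least `c₂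
  -- / ((i + 1) L) * (c₁ / |B (m i)|)`.
  have hgp : ∀ k, ‖g₀ k‖ ≤ L * (c₁ * c₂)⁻¹ * ‖p.1 k‖ := fun k => by
    by_cases hk : ∃ i, k ∈ B (m i)
    · obtain ⟨i, hi⟩ := hk
      have hcard : (0 : ℝ) < (B (m i)).card := by exact_mod_cast (hBne (m i)).card_pos
      rw [hg₀ i k hi, hp (m i) k (hBS _ hi), norm_mul]
      calc 1 / (((i : ℕ) + 1) * ((B (m i)).card : ℝ)) = L * (c₁ * c₂)⁻¹ *
            (c₂ / (((i : ℕ) + 1) * L) * (c₁ / (B (m i)).card)) := by field_simp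
        _ ≤ _ := by
          gcongr
          · exact hφf i
          · exact (hflat _ k hi).1
    · rw [hg₀0 k fun i hi => hk ⟨i, hi⟩, norm_zero]
      exact mul_nonneg (mul_nonneg hL0.le (inv_nonneg.2 (mul_pos hc₁ hc₂).le)) (norm_nonneg _)
  let g : lorentzSpace 𝕜 w hw hd q hq := ⟨g₀, mem_lorentzSpace_of_norm_le p hgp⟩
  have hgN : lorentzNorm g ≤ L * K₅ := by
    refine (lorentzNorm_mono_mul (f := g) (g := p) 
      (mul_nonneg hL0.le (inv_nonneg.2 (mul_pos hc₁ hc₂).le)) hgp).trans ?_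
    rw [hK₅, mul_assoc]
    gcongr
    exact hpN.trans (by gcongr)
  have hsum := hweak g 1 zero_le_one
    (mul_rearrangement_le_one_of_harmonic (fun i => hBne (m i)) hmono hg₀ hg₀0)
    (Finset.univ.biUnion fun i => B (m i))
  rw [Real.one_rpow, mul_one, Finset.sum_biUnion fun i _ j _ hij =>
    (hdisj i j hij).mono (hBS _) (hBS _)] at hsum
  have hsumL : ∑ i, ∑ k ∈ B (m i), ‖g.1 k‖ = L := by
    rw [← hLfin]
    refine Finset.sum_congr rfl fun i _ => ?_
    have hcard : (0 : ℝ) < (B (m i)).card := by exact_mod_cast (hBne (m i)).card_pos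
    rw [Finset.sum_congr rfl (hg₀ i), Finset.sum_const, nsmul_eq_mul]
    field_simp
  rw [hsumL] at hsum
  -- Interpolation for a function of `ℓ₁` norm `L`, weak norm at most `1` and quasi-norm at most `L
  -- * K₅`; dividing by `L ^ r` contradicts the choice of `N`.
  have h1 : L ≤ K * K₅ ^ r * L ^ r := by
    refine hsum.trans ?_
    rw [mul_assoc, mul_comm (K₅ ^ r), ← Real.mul_rpow hL0.le hK₅0]
    gcongr
    exact lorentzNorm_nonneg g
  have h2 : L = L ^ (1 - r) * L ^ r := by
    rw [← Real.rpow_add hL0, sub_add_cancel, Real.rpow_one]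
  have h3 : K * K₅ ^ r * L ^ r < L ^ (1 - r) * L ^ r :=
    mul_lt_mul_of_pos_right hN (Real.rpow_pos_of_pos hL0 r)
  linarith

end LargeBlocks

/-! ### Equivalence of blocks with unit vectors -/

section Universality

variable {𝕜 : Type*} [RCLike 𝕜] {w : ℕ → ℝ} {hw : IsWeight w} {hd : IsDoubling w} {q : ℝ≥0∞}
  {hq : 0 < q}

variable (𝕜 hw hd hq) in
theorem lorentzNorm_sum_le : ∃ κ : ℝ, 1 ≤ κ ∧
    (∀ f g : lorentzSpace 𝕜 w hw hd q hq,
      lorentzNorm (f + g) ≤ κ * (lorentzNorm f + lorentzNorm g)) ∧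
    ∀ {M : Type} (s : Finset M) (g : M → lorentzSpace 𝕜 w hw hd q hq),
      lorentzNorm (∑ i ∈ s, g i) ≤ κ ^ s.card * ∑ i ∈ s, lorentzNorm (g i) := by
  classical
  obtain ⟨κ, hκ, hadd⟩ := lorentzNorm_add_le 𝕜 hw hd hq
  refine ⟨κ, hκ, hadd, fun {M} s g => ?_⟩
  have hκ0 : 0 ≤ κ := by linarith
  induction s using Finset.induction_on with
  | empty => simp [lorentzNorm_zero]
  | insert a s ha ih =>
    rw [Finset.sum_insert ha, Finset.sum_insert ha, Finset.card_insert_of_notMem ha, pow_succ']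
    refine (hadd _ _).trans ?_
    rw [mul_assoc]
    gcongr
    rw [mul_add]
    exact add_le_add (le_mul_of_one_le_left (lorentzNorm_nonneg _) (one_le_pow₀ hκ)) ih

/-- The kernel of a bounded functional is a closed subspace. This gives the coordinates of vectors
in the closed span without expanding them in the blocks. -/
theorem eq_zero_of_mem_closedSpan {M : Type*} {y : M → lorentzSpace 𝕜 w hw hd q hq}
    {ψ : lorentzSpace 𝕜 w hw hd q hq →ₗ[𝕜] 𝕜} {B : ℝ} (hB : ∀ f, ‖ψ f‖ ≤ B * lorentzNorm f)
    (hy : ∀ n, ψ (y n) = 0) {f : lorentzSpace 𝕜 w hw hd q hq}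
    (hf : f ∈ closedSpan 𝕜 lorentzNorm y) : ψ f = 0 := by
  have hle : closedSpan 𝕜 lorentzNorm y ≤ LinearMap.ker ψ := by
    refine closedSpan_le hy fun f hf => ?_
    rw [LinearMap.mem_ker, ← norm_le_zero_iff]
    refine le_of_forall_pos_le_add fun ε hε => ?_
    have hB1 : 0 < |B| + 1 := by positivity
    obtain ⟨g, hg, hfg⟩ := hf (ε / (|B| + 1)) (by positivity)
    have h1 := hB (f - g)
    rw [map_sub, LinearMap.mem_ker.1 hg, sub_zero] at h1
    rw [lt_div_iff₀ hB1] at hfg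
    have h2 := lorentzNorm_nonneg (f - g)
    have h3 := mul_le_mul_of_nonneg_right (le_abs_self B) h2
    linarith
  exact hle hf

namespace IsProjectedBlocks

variable {C : ℝ} {M : Type*} {y : M → lorentzSpace 𝕜 w hw hd q hq}
  {φ : M → lorentzSpace 𝕜 w hw hd q hq →ₗ[𝕜] 𝕜} {S : M → Finset ℕ}

theorem index_unique (H : IsProjectedBlocks C y φ S) {m n : M} {k : ℕ} (hm : k ∈ S m)
    (hn : k ∈ S n) : m = n := by
  by_contra hne
  exact Finset.disjoint_left.1 (H.disjoint m n hne) hm hn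

/-- The functional `f ↦ f k - (y m) k * φ m f` is bounded and annihilates every block: `y m` by
normalization, the others because they vanish at `k` and under `φ m`. -/
theorem apply_of_mem_closedSpan (H : IsProjectedBlocks C y φ S) (hq' : q ≠ ∞)
    {f : lorentzSpace 𝕜 w hw hd q hq} (hf : f ∈ closedSpan 𝕜 lorentzNorm y) {m : M} {k : ℕ}
    (hk : k ∈ S m) : f.1 k = φ m f * (y m).1 k := by
  obtain ⟨B, hB⟩ := H.bounded m
  let ψ : lorentzSpace 𝕜 w hw hd q hq →ₗ[𝕜] 𝕜 :=
    LinearMap.proj k ∘ₗ (lorentzSpace 𝕜 w hw hd q hq).subtype - (y m).1 k • φ m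
  have hψ : ∀ f, ψ f = f.1 k - (y m).1 k * φ m f := fun f => rfl
  have h := eq_zero_of_mem_closedSpan (ψ := ψ) (B := (w 0)⁻¹ + ‖(y m).1 k‖ * B) (y := y)
    (fun f => by
      rw [hψ, add_mul, mul_assoc]
      refine (norm_sub_le _ _).trans (add_le_add (norm_apply_le f k) ?_)
      rw [norm_mul]
      exact mul_le_mul_of_nonneg_left (hB f) (norm_nonneg _))
    (fun n => by
      rw [hψ]
      rcases eq_or_ne m n with rfl | hmn
      · rw [H.functional_self, mul_one, sub_self]
      · rw [H.functional_of_ne hq' hmn, mul_zero, sub_zero]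
        exact H.eq_zero fun hkn => hmn (H.index_unique hk hkn)) hf
  rw [hψ, sub_eq_zero] at h
  rw [h, mul_comm]

theorem apply_eq_zero_of_mem_closedSpan (H : IsProjectedBlocks C y φ S)
    {f : lorentzSpace 𝕜 w hw hd q hq} (hf : f ∈ closedSpan 𝕜 lorentzNorm y) {k : ℕ}
    (hk : ∀ m, k ∉ S m) : f.1 k = 0 :=
  eq_zero_of_mem_closedSpan (y := y) (B := (w 0)⁻¹)
    (ψ := LinearMap.proj k ∘ₗ (lorentzSpace 𝕜 w hw hd q hq).subtype)
    (fun f => norm_apply_le f k) (fun n => H.eq_zero (hk n)) hf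

theorem norm_functional_le (H : IsProjectedBlocks C y φ S) (hq' : q ≠ ∞)
    {f : lorentzSpace 𝕜 w hw hd q hq} (hf : f ∈ closedSpan 𝕜 lorentzNorm y) (m : M) :
    ‖φ m f‖ ≤ lorentzNorm f := by
  have h : lorentzNorm (φ m f • y m) ≤ lorentzNorm f := by
    refine lorentzNorm_mono fun k => ?_
    rw [Submodule.coe_smul, Pi.smul_apply, smul_eq_mul]
    by_cases hk : k ∈ S m
    · rw [H.apply_of_mem_closedSpan hq' hf hk]
    · rw [H.eq_zero hk, mul_zero, norm_zero]
      exact norm_nonneg _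
  rwa [lorentzNorm_smul, H.norm_eq_one, mul_one] at h

theorem nonempty_support (H : IsProjectedBlocks C y φ S) (m : M) : (S m).Nonempty := by
  by_contra hcon
  rw [Finset.not_nonempty_iff_eq_empty] at hcon
  have h0 : y m = 0 := Subtype.ext (funext fun k => H.eq_zero (by rw [hcon]; simp))
  have h1 := H.norm_eq_one m
  rw [h0, lorentzNorm_zero] at h1
  exact zero_ne_one h1

end IsProjectedBlocks

variable (𝕜 hw hd hq) in
/-- Blocks that have, up to few exceptions, a coordinate at which both the block and its functional
are large are equivalent to unit vectors. -/
theorem exists_cEquivalent_lorentzUnit (hq' : q ≠ ∞) (C : ℝ) {δ : ℝ} (hδ : 0 < δ) (N : ℕ) :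
    ∃ D : ℝ, 1 ≤ D ∧ ∀ (M : Type) (y : M → lorentzSpace 𝕜 w hw hd q hq)
      (φ : M → lorentzSpace 𝕜 w hw hd q hq →ₗ[𝕜] 𝕜) (S : M → Finset ℕ) (F : Finset M),
      IsProjectedBlocks C y φ S → F.card ≤ N →
      (∀ m ∉ F, ∃ k ∈ S m, δ ≤ ‖(y m).1 k‖ ∧ δ ≤ ‖φ m (lorentzUnit 𝕜 hw hd hq k)‖) →
      ∃ π : M → ℕ, (∀ m, π m ∈ S m) ∧ CEquivalent 𝕜 lorentzNorm lorentzNorm D y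
        fun m => ((w 0 : 𝕜))⁻¹ • lorentzUnit 𝕜 hw hd hq (π m) := by
  classical
  obtain ⟨κ, hκ, hadd, hsum⟩ := lorentzNorm_sum_le 𝕜 hw hd hq
  obtain ⟨K, hK, hupp⟩ := lorentzNorm_le_mul_primitiveWeight_card 𝕜 hw hd hq
  have hw0 := hw.2
  have hκ0 : 0 < κ := by linarith
  -- In both constants the first summand serves the good blocks, through `δ`, and the second the at
  -- most `N` exceptional ones: a flat bound on at most `N` coordinates in `D₁`, a crude finite
  -- quasi-triangle inequality in `D₂`.
  set D₁ := κ * ((w 0)⁻¹ * δ⁻¹ + K * ((w 0)⁻¹ * primitiveWeight w N))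
  set D₂ := κ * (w 0 * δ⁻¹ * C + κ ^ N * N)
  refine ⟨max 1 (max D₁ D₂), le_max_left _ _, fun M y φ S F H hF hgood => ?_⟩
  have hex : ∀ m, ∃ k ∈ S m, m ∉ F →
      δ ≤ ‖(y m).1 k‖ ∧ δ ≤ ‖φ m (lorentzUnit 𝕜 hw hd hq k)‖ := fun m => by
    by_cases hm : m ∈ F
    · obtain ⟨k, hk⟩ := H.nonempty_support m
      exact ⟨k, hk, fun h => absurd hm h⟩
    · obtain ⟨k, hk, h⟩ := hgood m hm
      exact ⟨k, hk, fun _ => h⟩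
  choose π hπ hπδ using hex
  have hinj : Function.Injective π := fun m n hmn => H.index_unique (hπ m) (hmn ▸ hπ n)
  have hwn : ‖((w 0 : 𝕜))⁻¹‖ = (w 0)⁻¹ := by
    rw [norm_inv, RCLike.norm_ofReal, abs_of_pos hw0]
  have hw0' : (w 0 : 𝕜) ≠ 0 := by exact_mod_cast hw0.ne'
  -- The image of `f` has coordinate `φ m f / w 0` at `π m` and `0` elsewhere. Defining it by
  -- coordinates avoids summing a series; membership in the space follows by domination.
  let t : lorentzSpace 𝕜 w hw hd q hq → ℕ → 𝕜 := fun f =>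
    Function.extend π (fun m => ((w 0 : 𝕜))⁻¹ * φ m f) 0
  have ht : ∀ f m, t f (π m) = ((w 0 : 𝕜))⁻¹ * φ m f := fun f m => hinj.extend_apply _ _ m
  have ht0 : ∀ f k, (∀ m, π m ≠ k) → t f k = 0 := fun f k hk =>
    Function.extend_apply' _ _ _ (by rintro ⟨m, hm⟩; exact hk m hm)
  have hbound : ∀ f ∈ closedSpan 𝕜 lorentzNorm y, ∃ ht : t f ∈ lorentzSpace 𝕜 w hw hd q hq,
      lorentzNorm (⟨t f, ht⟩ : lorentzSpace 𝕜 w hw hd q hq) ≤ D₁ * lorentzNorm f := by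
    intro f hf
    have hN := lorentzNorm_nonneg f
    let u₁ : ℕ → 𝕜 := fun k => if k ∈ F.image π then 0 else t f k
    let u₂ : ℕ → 𝕜 := fun k => if k ∈ F.image π then t f k else 0
    have hu : u₁ + u₂ = t f := by
      ext k
      by_cases hk : k ∈ F.image π
      · simp only [u₁, u₂, Pi.add_apply, if_pos hk, zero_add]
      · simp only [u₁, u₂, Pi.add_apply, if_neg hk, add_zero]
    -- At `π m` the vector `f` equals `φ m f * (y m) (π m)`, of modulus at least `δ ‖φ m f‖` for a
    -- good block, so `f` itself dominates this part.
    have h1 : ∀ k, ‖u₁ k‖ ≤ (w 0)⁻¹ * δ⁻¹ * ‖f.1 k‖ := fun k => by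
      by_cases hk : k ∉ F.image π ∧ ∃ m, π m = k
      · obtain ⟨hkF, m, rfl⟩ := hk
        have hm : m ∉ F := fun hm => hkF (Finset.mem_image_of_mem π hm)
        simp only [u₁, if_neg hkF]
        rw [ht, H.apply_of_mem_closedSpan hq' hf (hπ m), norm_mul, norm_mul, hwn, mul_assoc]
        refine mul_le_mul_of_nonneg_left ?_ (by positivity)
        rw [inv_mul_eq_div, le_div_iff₀ hδ]
        exact mul_le_mul_of_nonneg_left (hπδ m hm).1 (norm_nonneg _)
      · have : u₁ k = 0 := by
          by_cases hkF : k ∈ F.image π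
          · exact if_pos hkF
          · simp only [u₁, if_neg hkF]
            exact ht0 f k fun m hm => hk ⟨hkF, m, hm⟩
        rw [this, norm_zero]
        exact mul_nonneg (by positivity) (norm_nonneg _)
    have h2 : ∀ k, ‖u₂ k‖ ≤ (w 0)⁻¹ * lorentzNorm f := fun k => by
      by_cases hk : k ∈ F.image π
      · obtain ⟨m, -, rfl⟩ := Finset.mem_image.1 hk
        simp only [u₂, if_pos hk]
        rw [ht, norm_mul, hwn]
        gcongr
        exact H.norm_functional_le hq' hf m
      · simp only [u₂, if_neg hk, norm_zero]
        positivity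
    have h2' : ∀ k ∉ F.image π, u₂ k = 0 := fun k hk => if_neg hk
    let v₁ : lorentzSpace 𝕜 w hw hd q hq := ⟨u₁, mem_lorentzSpace_of_norm_le f h1⟩
    let v₂ : lorentzSpace 𝕜 w hw hd q hq := ⟨u₂, mem_lorentzSpace_of_finite _ h2'⟩
    have hv : (v₁ + v₂ : lorentzSpace 𝕜 w hw hd q hq).1 = t f := hu
    refine ⟨hv ▸ (v₁ + v₂).2, ?_⟩
    have e : (⟨t f, hv ▸ (v₁ + v₂).2⟩ : lorentzSpace 𝕜 w hw hd q hq) = v₁ + v₂ :=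
      Subtype.ext hv.symm
    rw [e]
    have h3 : lorentzNorm v₁ ≤ (w 0)⁻¹ * δ⁻¹ * lorentzNorm f :=
      lorentzNorm_mono_mul (by positivity) h1
    have h4 : lorentzNorm v₂ ≤ K * ((w 0)⁻¹ * lorentzNorm f * primitiveWeight w N) := by
      refine (hupp v₂ _ _ (by positivity) h2 h2').trans ?_
      gcongr
      exact primitiveWeight_mono hw (Finset.card_image_le.trans hF)
    calc lorentzNorm (v₁ + v₂) ≤ κ * (lorentzNorm v₁ + lorentzNorm v₂) := hadd _ _
      _ ≤ κ * ((w 0)⁻¹ * δ⁻¹ * lorentzNorm f +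
          K * ((w 0)⁻¹ * lorentzNorm f * primitiveWeight w N)) := by gcongr
      _ = D₁ * lorentzNorm f := by ring
  let T : closedSpan 𝕜 lorentzNorm y →ₗ[𝕜] lorentzSpace 𝕜 w hw hd q hq :=
    { toFun := fun f => ⟨t f.1, (hbound f.1 f.2).fst⟩
      map_add' := fun f g => by
        refine Subtype.ext (funext fun k => ?_)
        change t (f.1 + g.1) k = t f.1 k + t g.1 k
        by_cases hk : ∃ m, π m = k
        · obtain ⟨m, rfl⟩ := hk
          rw [ht, ht, ht, map_add, mul_add]
        · rw [ht0 _ k fun m hm => hk ⟨m, hm⟩, ht0 _ k fun m hm => hk ⟨m, hm⟩,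
            ht0 _ k fun m hm => hk ⟨m, hm⟩, add_zero]
      map_smul' := fun c f => by
        refine Subtype.ext (funext fun k => ?_)
        change t (c • f.1) k = c * t f.1 k
        by_cases hk : ∃ m, π m = k
        · obtain ⟨m, rfl⟩ := hk
          rw [ht, ht, map_smul, smul_eq_mul, mul_left_comm]
        · rw [ht0 _ k fun m hm => hk ⟨m, hm⟩, ht0 _ k fun m hm => hk ⟨m, hm⟩, mul_zero] }
  refine ⟨π, hπ, T, fun n => ?_, fun f => ⟨?_, ?_⟩⟩
  · refine Subtype.ext (funext fun k => ?_)
    change t (y n) k = ((w 0 : 𝕜))⁻¹ * (Pi.single (π n) 1 : ℕ → 𝕜) k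
    by_cases hk : ∃ m, π m = k
    · obtain ⟨m, rfl⟩ := hk
      rw [ht]
      rcases eq_or_ne m n with rfl | hmn
      · rw [H.functional_self, Pi.single_eq_same]
      · rw [H.functional_of_ne hq' hmn, Pi.single_eq_of_ne (hinj.ne hmn)]
    · rw [ht0 _ k fun m hm => hk ⟨m, hm⟩, Pi.single_eq_of_ne fun h => hk ⟨n, h.symm⟩, mul_zero]
  · refine (hbound f.1 f.2).snd.trans ?_
    exact mul_le_mul_of_nonneg_right ((le_max_left _ _).trans (le_max_right _ _))
      (lorentzNorm_nonneg _)
  · obtain ⟨f, hf⟩ := f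
    change lorentzNorm f ≤ _
    set u := T ⟨f, hf⟩ with hu_def
    have hu : ∀ k, u.1 k = t f k := fun k => rfl
    have hNu := lorentzNorm_nonneg u
    obtain ⟨h, hhN, hh⟩ := H.projection u
    -- The only coordinate of `u` in `S m` that may be non-zero is `π m`. The projection of `u` thus
    -- recovers `f` block by block up to the factor `φ m e_{π m} / w 0`, whose modulus is at least
    -- `δ / w 0` on the good blocks.
    have hφu : ∀ m, φ m u = ((w 0 : 𝕜))⁻¹ * φ m f * φ m (lorentzUnit 𝕜 hw hd hq (π m)) := fun m => by
      rw [H.functional_apply hq' m u, Finset.sum_eq_single_of_mem (π m) (hπ m) fun k hk hkm => ?_,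
        hu, ht]
      rw [hu, ht0 f k fun m' hm' => ?_, zero_mul]
      subst hm'
      exact hkm (by rw [H.index_unique (hπ m') hk])
    have hφf : ∀ m, ‖φ m f‖ ≤ lorentzNorm u := fun m => by
      have := mul_norm_le_lorentzNorm u (π m)
      rwa [hu, ht, norm_mul, hwn, ← mul_assoc, mul_inv_cancel₀ hw0.ne', one_mul] at this
    let g₁ : ℕ → 𝕜 := fun k => if k ∈ F.biUnion S then 0 else f.1 k
    have hg₁ : ∀ k, ‖g₁ k‖ ≤ w 0 * δ⁻¹ * ‖h.1 k‖ := fun k => by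
      by_cases hk : k ∉ F.biUnion S ∧ ∃ m, k ∈ S m
      · obtain ⟨hkF, m, hkm⟩ := hk
        have hm : m ∉ F := fun hm => hkF (Finset.mem_biUnion.2 ⟨m, hm, hkm⟩)
        simp only [g₁, if_neg hkF]
        rw [hh m k hkm, H.apply_of_mem_closedSpan hq' hf hkm, hφu, norm_mul, norm_mul, norm_mul,
          norm_mul, hwn]
        have h5 := (hπδ m hm).2
        have h6 := norm_nonneg (φ m f)
        have h7 := norm_nonneg ((y m).1 k)
        calc ‖φ m f‖ * ‖(y m).1 k‖ = w 0 * δ⁻¹ * ((w 0)⁻¹ * ‖φ m f‖ * δ * ‖(y m).1 k‖) := by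
              field_simp
          _ ≤ _ := by gcongr
      · have : g₁ k = 0 := by
          by_cases hkF : k ∈ F.biUnion S
          · exact if_pos hkF
          · simp only [g₁, if_neg hkF]
            exact H.apply_eq_zero_of_mem_closedSpan hf fun m hm => hk ⟨hkF, m, hm⟩
        rw [this, norm_zero]
        exact mul_nonneg (by positivity) (norm_nonneg _)
    let f₁ : lorentzSpace 𝕜 w hw hd q hq := ⟨g₁, mem_lorentzSpace_of_norm_le h hg₁⟩
    have hf₁ : lorentzNorm f₁ ≤ w 0 * δ⁻¹ * (C * lorentzNorm u) :=
      (lorentzNorm_mono_mul (by positivity) hg₁).trans (by gcongr)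
    have hf₂ : lorentzNorm (∑ m ∈ F, φ m f • y m) ≤ κ ^ N * (N * lorentzNorm u) := by
      refine (hsum F _).trans ?_
      have h1 : ∑ m ∈ F, lorentzNorm (φ m f • y m) ≤ N * lorentzNorm u := by
        refine (Finset.sum_le_card_nsmul F _ (lorentzNorm u) fun m _ => ?_).trans ?_
        · rw [lorentzNorm_smul, H.norm_eq_one, mul_one]
          exact hφf m
        · rw [nsmul_eq_mul]
          gcongr
      refine mul_le_mul (pow_le_pow_right₀ hκ hF) h1 (Finset.sum_nonneg fun _ _ =>
        lorentzNorm_nonneg _) (by positivity)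
    have hdec : f = f₁ + ∑ m ∈ F, φ m f • y m := by
      refine Subtype.ext (funext fun k => ?_)
      rw [Submodule.coe_add, Pi.add_apply, AddSubmonoidClass.coe_finsetSum, Finset.sum_apply]
      change _ = g₁ k + ∑ m ∈ F, φ m f * (y m).1 k
      by_cases hk : k ∈ F.biUnion S
      · obtain ⟨m, hm, hkm⟩ := Finset.mem_biUnion.1 hk
        rw [Finset.sum_eq_single_of_mem m hm fun n _ hnm => ?_]
        · simp only [g₁, if_pos hk, zero_add]
          exact H.apply_of_mem_closedSpan hq' hf hkm
        · rw [H.eq_zero fun hkn => hnm (H.index_unique hkn hkm), mul_zero]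
      · rw [Finset.sum_eq_zero fun m hm => ?_]
        · simp only [g₁, if_neg hk, add_zero]
        · rw [H.eq_zero fun hkm => hk (Finset.mem_biUnion.2 ⟨m, hm, hkm⟩), mul_zero]
    calc lorentzNorm f = lorentzNorm (f₁ + ∑ m ∈ F, φ m f • y m) := by rw [← hdec]
      _ ≤ κ * (lorentzNorm f₁ + lorentzNorm (∑ m ∈ F, φ m f • y m)) := hadd _ _
      _ ≤ κ * (w 0 * δ⁻¹ * (C * lorentzNorm u) + κ ^ N * (N * lorentzNorm u)) := by gcongr
      _ = D₂ * lorentzNorm u := by ring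
      _ ≤ _ := mul_le_mul_of_nonneg_right ((le_max_right _ _).trans (le_max_right _ _)) hNu

/-- Only the full index set is needed among the sets `A`; homogeneity extends the bound from the
unit ball, and disjointness of the supports lets the coordinates of the projection be read off one
block at a time. -/
theorem isProjectedBlocks_of_isWellComplemented (hq' : q ≠ ∞) {C : ℝ} {M : Type}
    {y : M → lorentzSpace 𝕜 w hw hd q hq} (hy : IsNormalized lorentzNorm y)
    (h : IsWellComplemented 𝕜 lorentzNorm
      (fun n => ((w 0 : 𝕜))⁻¹ • lorentzUnit 𝕜 hw hd hq n) C y) :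
    ∃ (φ : M → lorentzSpace 𝕜 w hw hd q hq →ₗ[𝕜] 𝕜) (S : M → Finset ℕ),
      IsProjectedBlocks C y φ S ∧ ∀ m, ∀ k ∈ S m,
        k ∈ vecSupport 𝕜 lorentzNorm
          (fun n => ((w 0 : 𝕜))⁻¹ • lorentzUnit 𝕜 hw hd hq n) (y m) := by
  have hw0 : ((w 0 : 𝕜))⁻¹ ≠ 0 := inv_ne_zero (by exact_mod_cast hw.2.ne')
  obtain ⟨-, hfin, hdisj, φ, hφ, hsupp, hA⟩ := h
  simp only [vecSupport_smul_lorentzUnit hq' hw0] at hfin hdisj hsupp ⊢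
  have hmem : ∀ m k, k ∈ (hfin m).toFinset ↔ (y m).1 k ≠ 0 := fun m k => (hfin m).mem_toFinset
  refine ⟨φ, fun m => (hfin m).toFinset, ⟨hy, fun m k => (hmem m k).symm, fun m n hmn => ?_,
    fun m k hk => ?_, hφ.biorthogonal_self, hφ.bounded, fun f => ?_⟩, fun m k hk => (hmem m k).1 hk⟩
  · rw [Set.Finite.disjoint_toFinset]
    exact hdisj m n hmn
  · by_contra hne
    refine hk ((hmem m k).2 (hsupp m ?_))
    change φ m (((w 0 : 𝕜))⁻¹ • lorentzUnit 𝕜 hw hd hq k) ≠ 0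
    rw [map_smul, smul_eq_mul]
    exact mul_ne_zero hw0 hne
  · rcases eq_or_ne (lorentzNorm f) 0 with h0 | h0
    · refine ⟨0, by rw [lorentzNorm_zero, h0, mul_zero], fun m k _ => ?_⟩
      have hf0 : f = 0 := (isQuasiBanach_lorentzNorm.eq_zero_iff f).1 h0
      rw [hf0, map_zero, zero_mul]
      rfl
    · have hN : 0 < lorentzNorm f := (lorentzNorm_nonneg f).lt_of_ne' h0
      have hN' : (lorentzNorm f : 𝕜) ≠ 0 := by exact_mod_cast h0
      have hn : ‖(lorentzNorm f : 𝕜)‖ = lorentzNorm f := by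
        rw [RCLike.norm_ofReal, abs_of_pos hN]
      obtain ⟨g, hg, hgC⟩ := hA Set.univ (((lorentzNorm f : 𝕜))⁻¹ • f) (by
        rw [lorentzNorm_smul, norm_inv, hn, inv_mul_cancel₀ h0])
      refine ⟨(lorentzNorm f : 𝕜) • g, ?_, fun m k hk => ?_⟩
      · rw [lorentzNorm_smul, hn, mul_comm]
        gcongr
      · have h1 := hg.tendsto_apply k
        have h2 := hasSum_single (f := fun n => (Set.univ.indicator
          (fun m => φ m (((lorentzNorm f : 𝕜))⁻¹ • f)) n) * (y n).1 k) m fun n hnm => by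
            have : (y n).1 k = 0 := by
              by_contra hne
              exact Set.disjoint_left.1 (hdisj n m hnm) hne ((hmem m k).1 hk)
            rw [this, mul_zero]
        have h3 := h1.unique h2
        rw [Submodule.coe_smul, Pi.smul_apply, h3, Set.indicator_univ, map_smul, smul_eq_mul,
          smul_eq_mul, ← mul_assoc, ← mul_assoc, mul_inv_cancel₀ hN', one_mul]

/-- If more than `N` indices, possibly infinitely many, violated `p`, an enumeration of `N` of them
would contradict the hypothesis. -/
theorem exists_finset_of_no_large_family {M : Type} {p : M → Prop} {N : ℕ}
    (h : ∀ e : Fin N → M, Function.Injective e → ∃ i, p (e i)) :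
    ∃ F : Finset M, F.card ≤ N ∧ ∀ m ∉ F, p m := by
  by_cases hfin : {m | ¬ p m}.Finite
  · refine ⟨hfin.toFinset, ?_, fun m hm => by_contra fun hp => hm (hfin.mem_toFinset.2 hp)⟩
    by_contra! hcard
    obtain ⟨t, ht, htc⟩ := Finset.exists_subset_card_eq hcard.le
    obtain ⟨i, hi⟩ := h (fun i => ((t.equivFinOfCardEq htc).symm i : M))
      (Subtype.val_injective.comp (t.equivFinOfCardEq htc).symm.injective)
    exact hfin.mem_toFinset.1 (ht ((t.equivFinOfCardEq htc).symm i).2) hi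
  · obtain ⟨t, ht, htc⟩ := Set.Infinite.exists_subset_card_eq hfin N
    obtain ⟨i, hi⟩ := h (fun i => ((t.equivFinOfCardEq htc).symm i : M))
      (Subtype.val_injective.comp (t.equivFinOfCardEq htc).symm.injective)
    exact absurd hi (ht ((t.equivFinOfCardEq htc).symm i).2)

theorem isUniformlyUniversal_lorentzUnit (hq1 : q < 1) {c : ℝ} (hc : 0 < c)
    (h : ∀ n : ℕ, c * n ≤ primitiveWeight w n) :
    IsUniformlyUniversal 𝕜 lorentzNorm fun n => ((w 0 : 𝕜))⁻¹ • lorentzUnit 𝕜 hw hd hq n := by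
  have hq' : q ≠ ∞ := (hq1.trans ENNReal.one_lt_top).ne
  have hw0 := hw.2
  have hw0' : ((w 0 : 𝕜))⁻¹ ≠ 0 := inv_ne_zero (by exact_mod_cast hw0.ne')
  refine ⟨isUncondBasis_smul_lorentzUnit hq' hw0', fun n => ?_, ?_⟩
  · rw [lorentzNorm_smul, lorentzNorm_lorentzUnit, norm_inv, RCLike.norm_ofReal, abs_of_pos hw0,
      inv_mul_cancel₀ hw0.ne']
  suffices hD : ∀ C : ℝ, 1 ≤ C → ∃ D : ℝ, 1 ≤ D ∧
      ∀ (M : Type) [Countable M] (y : M → lorentzSpace 𝕜 w hw hd q hq),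
      IsNormalized lorentzNorm y →
      IsWellComplemented 𝕜 lorentzNorm
        (fun n => ((w 0 : 𝕜))⁻¹ • lorentzUnit 𝕜 hw hd hq n) C y →
      ∃ π : M → ℕ, (∀ m, π m ∈ vecSupport 𝕜 lorentzNorm
        (fun n => ((w 0 : 𝕜))⁻¹ • lorentzUnit 𝕜 hw hd hq n) (y m)) ∧
        CEquivalent 𝕜 lorentzNorm lorentzNorm D y
          fun m => ((w 0 : 𝕜))⁻¹ • lorentzUnit 𝕜 hw hd hq (π m) by
    choose! η hη1 hη using hD
    exact ⟨η, hη1, hη⟩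
  intro C hC
  have hC0 : 0 < C := by linarith
  -- The coordinates of the functionals are bounded by `C * w 0`. All constants that follow depend
  -- on `C` and the space, not on the family, which is the uniformity of `η`.
  obtain ⟨c₁, c₂, hc₁, hc₂, hflat⟩ := exists_flat_part 𝕜 hw hd hq hq1 hc h
    (D := C * w 0) (by positivity)
  obtain ⟨N, hN⟩ := exists_card_bound_of_flat_parts 𝕜 hw hd hq hq1 hc h hC0 hc₁ hc₂
  obtain ⟨D, hD1, hD⟩ := exists_cEquivalent_lorentzUnit 𝕜 hw hd hq hq' C
    (δ := min (c₁ / (N + 1)) c₂) (lt_min (by positivity) hc₂) N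
  refine ⟨D, hD1, fun M _ y hy hyC => ?_⟩
  obtain ⟨φ, S, H, hS⟩ := isProjectedBlocks_of_isWellComplemented hq' hy hyC
  have hB : ∀ m, ∃ B ⊆ S m, B.Nonempty ∧ ∀ k ∈ B, c₁ / B.card ≤ ‖(y m).1 k‖ ∧
      c₂ ≤ ‖φ m (lorentzUnit 𝕜 hw hd hq k)‖ := fun m =>
    hflat (y m) (fun k => φ m (lorentzUnit 𝕜 hw hd hq k)) (S m) (hy m)
      (H.norm_functional_unit_le m) (fun k hk => H.eq_zero hk)
      ((H.functional_apply hq' m (y m)).symm.trans (H.functional_self m))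
  choose B hBS hBne hBflat using hB
  obtain ⟨F, hFN, hF⟩ := exists_finset_of_no_large_family (p := fun m => (B m).card < N)
    (hN M y φ S B H hBS hBne hBflat)
  -- Outside `F` the flat part has fewer than `N` points, so at any of its points the block has
  -- modulus at least `c₁ / (N + 1)` and the functional at least `c₂`. The `+ 1` keeps the
  -- denominator positive.
  obtain ⟨π, hπ, hequiv⟩ := hD M y φ S F H hFN fun m hm => by
    obtain ⟨k, hk⟩ := hBne m
    refine ⟨k, hBS m hk, (min_le_left _ _).trans (le_trans ?_ (hBflat m k hk).1),
      (min_le_right _ _).trans (hBflat m k hk).2⟩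
    have h1 : (0 : ℝ) < (B m).card := by exact_mod_cast (hBne m).card_pos
    have h2 : ((B m).card : ℝ) ≤ N + 1 := by
      have := hF m hm
      exact_mod_cast (by omega : (B m).card ≤ N + 1)
    gcongr
  exact ⟨π, fun m => hS m _ (hπ m), hequiv⟩

end Universality

/-! ### The three claims -/

theorem mainTheorem8 (𝕜 : Type*) [RCLike 𝕜] (w : ℕ → ℝ) (hw : IsWeight w) (hd : IsDoubling w) :
    -- the weak space, with three equivalent conditions
    ((LorentzIncludedInEllOne 𝕜 (q := ∞) hw hd ENNReal.zero_lt_top ↔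
        Summable fun n : ℕ => 1 / primitiveWeight w (n + 1)) ∧
      ((Summable fun n : ℕ => 1 / primitiveWeight w (n + 1)) ↔
        IsStronglyAbsoluteBasis 𝕜
          (fun f : lorentzSeparablePart 𝕜 (q := ∞) hw hd ENNReal.zero_lt_top =>
            lorentzNorm (f : lorentzSpace 𝕜 w hw hd ∞ ENNReal.zero_lt_top))
          (lorentzSeparableUnit 𝕜 (q := ∞) hw hd ENNReal.zero_lt_top))) ∧
    -- `1 < q < ∞` with conjugate exponent `q'`; the sum is `∞` if some `w n` is zero
    (∀ (q q' : ℝ≥0∞) (hq : 0 < q), 1 < q → q < ∞ → q.HolderConjugate q' →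
      ∑' n : ℕ, ENNReal.ofReal (w n) ^ (-q'.toReal + 1) *
        (ENNReal.ofReal (primitiveWeight w (n + 1)))⁻¹ < ∞ →
      IsStronglyAbsoluteBasis 𝕜 lorentzNorm (lorentzUnit 𝕜 hw hd hq)) ∧
    -- `0 < q ≤ 1`
    (∀ (q : ℝ≥0∞) (hq : 0 < q), q ≤ 1 →
      (LorentzIncludedInEllOne 𝕜 hw hd hq ↔
        0 < ⨅ n : ℕ, primitiveWeight w (n + 1) / (n + 1)) ∧
      (Tendsto (fun n : ℕ => primitiveWeight w n / n) atTop atTop →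
        IsStronglyAbsoluteBasis 𝕜 lorentzNorm (lorentzUnit 𝕜 hw hd hq)) ∧
      -- the unit vectors have quasi-norm `w 0`; normalized, they are `(w 0)⁻¹ • eₙ`
      ((0 < ⨅ n : ℕ, primitiveWeight w (n + 1) / (n + 1)) → q < 1 →
        IsUniformlyUniversal 𝕜 lorentzNorm
          (fun n => ((w 0 : 𝕜))⁻¹ • lorentzUnit 𝕜 hw hd hq n))) := by
  refine ⟨⟨⟨summable_of_lorentzIncludedInEllOne, lorentzIncludedInEllOne_top⟩,
    isStronglyAbsoluteBasis_top, summable_of_isStronglyAbsoluteBasis⟩,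
    fun q q' hq h1 ht hqq h => isStronglyAbsoluteBasis_of_one_lt h1 ht hqq h,
    fun q hq hq1 => ⟨⟨iInf_pos_of_lorentzIncludedInEllOne, fun h => ?_⟩,
      isStronglyAbsoluteBasis_of_le_one hq1, fun h hlt => ?_⟩⟩
  · obtain ⟨c, hc, hcn⟩ := le_primitiveWeight_of_iInf_pos h
    exact lorentzIncludedInEllOne_of_le_one hq1 hc hcn
  · obtain ⟨c, hc, hcn⟩ := le_primitiveWeight_of_iInf_pos h
    exact isUniformlyUniversal_lorentzUnit hlt hc hcn
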